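/- Let $K$ be a field of arbitrary characteristic with algebraic closure $\overline K$, and let $n,d,r,\delta\ge 1$ be integers with $r\le n$. Put $$D:=\delta^{r+1}+1,\qquad p_{\max}:=(n+\delta^r)^{8\delta^{r+1}}\lceil\log_2 D\rceil^2+1 ,$$ and let $H_1,H_2\subset\overline K$ be arbitrary subsets of sizes $\delta^r\, r\, p_{\max}$ and $d+1$, respectively. For an $r$-subset $I=\{j_1<\dots<j_r\}$ of $\{1,\dots,n\}$ with complement $\{j_{r+1}<\dots<j_n\}$, an integer $p\ge 1$ and $c\in\overline K$, let $\Phi_{I,D,p,c}:\overline K[x_1,\dots,x_n]\to\overline K[z_1,\dots,z_r]$ be the $\overline K$-algebra homomorphism with $$x_{j_i}\mapsto z_i\quad(1\le i\le r),\qquad x_{j_i}\mapsto c^{\,D^{\,i-r}\bmod p}\quad(r<i\le n),$$ where $a\bmod p$ is the residue in $\{0,\dots,p-1\}$. Define $$\mathcal H_{d,r,\delta}:=\Bigl\{\bigl(\Phi_{I,D,p,c}(x_1)(a),\dots,\Phi_{I,D,p,c}(x_n)(a)\bigr)\;\Big|\; I\in\tbinom{[n]}{r},\ 1\le p\le p_{\max},\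 c\in H_1,\ a\in H_2^r\Bigr\}\subset\overline K^n .$$ (1) $\mathcal H_{d,r,\delta}$ is a hitting set for the class of degree-$d$ circuits whose inputs are degree-$\delta$ subcircuits of transcendence degree at most $r$. That is: let $C$ be an $m$-variate arithmetic circuit over $K$ (for any $m$), and let $f_1,\dots,f_m\in K[x_1,\dots,x_n]$ be polynomials (computed by arithmetic circuits) of degree at most $\delta$, at most $r$ of which are algebraically independent over $K$. If $C(f_1,\dots,f_m)$ is a nonzero polynomial of degree at most $d$, then it is nonzero at some point of $\mathcal H_{d,r,\delta}$. (2) $\mathcal H_{d,r,\delta}$ can be constructed in $\mathrm{poly}(dr\delta n)^{r\delta^{r+1}}$ time. That is: there are one program for an algebraic random access machine and one polynomial $q$, both independent of $K,n,d,r,\delta,H_1,H_2$, such that the program, given $n,d,r,\delta$ and lists of the elements of $H_1$ and of $H_2$, prints a list of points (repetitions allowed) whose set of members is $\mathcal H_{d,r,\delta}$, and halts after at most $q(dr\delta n)^{r\delta^{r+1}}$ steps. Each field operation in $\overline K$, each zero test in $\overline K$, and each addition, subtraction, comparison or memory access on nonnegative integers costs one step. -/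

import Mathlib

universe u

/-! ## Arithmetic circuits -/

/-- A gate of an arithmetic circuit over `K` with `m` inputs: an input, a constant, or the sum or
product of the values of two earlier gates, which are given by their positions. -/
inductive Gate (K : Type u) (m : ℕ) : Type u
  | input (i : Fin m)
  | const (a : K)
  | add (i j : ℕ)
  | mul (i j : ℕ)

/-- An `m`-variate arithmetic circuit over `K` (a directed acyclic graph with fan-in two), written
as the list of its gates in a topological order; the last gate is the output gate. -/
abbrev ArithCircuit (K : Type u) (m : ℕ) : Type u := List (Gate K m)

/-- The value of a gate on the input `x`, where `prev` lists the values of the earlier gates. -/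
def Gate.val {K : Type u} {m : ℕ} [CommSemiring K] {R : Type u} [CommSemiring R] [Algebra K R]
    (x : Fin m → R) (prev : List R) : Gate K m → R
  | .input i => x i
  | .const a => algebraMap K R a
  | .add i j => prev.getD i 0 + prev.getD j 0
  | .mul i j => prev.getD i 0 * prev.getD j 0

/-- The value of a circuit on the input `x`, for `x` in any `K`-algebra. -/
def ArithCircuit.eval {K : Type u} {m : ℕ} [CommSemiring K] {R : Type u} [CommSemiring R]
    [Algebra K R] (C : ArithCircuit K m) (x : Fin m → R) : R :=
  (C.foldl (fun prev g => prev ++ [g.val x prev]) []).getLastD 0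

/-- The polynomial computed by a circuit. -/
noncomputable def ArithCircuit.poly {K : Type u} {n : ℕ} [CommSemiring K]
    (C : ArithCircuit K n) : MvPolynomial (Fin n) K :=
  C.eval (R := MvPolynomial (Fin n) K) MvPolynomial.X

open Classical in
/-- The transcendence degree of `{f₁, …, fₘ}`: the maximal number of algebraically independent
polynomials among them. -/
noncomputable def polyTrdeg {K : Type u} [Field K] {n m : ℕ}
    (f : Fin m → MvPolynomial (Fin n) K) : ℕ :=
  (Finset.univ.filter fun s : Finset (Fin m) =>
    AlgebraicIndependent K (fun i : s => f i)).sup Finset.card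

/-- The polynomials computed by circuits `C(f₁, …, fₘ)` of degree at most `d`, where `C` is an
`m`-variate circuit (`m` arbitrary) and `f₁, …, fₘ` are (computed by) `n`-variate subcircuits of
degree at most `δ` and transcendence degree at most `r`. -/
def circuitClass (K : Type u) [Field K] (n d r δ : ℕ) : Set (MvPolynomial (Fin n) K) :=
  {g | ∃ (m : ℕ) (C : ArithCircuit K m) (S : Fin m → ArithCircuit K n),
    (∀ i, (S i).poly.totalDegree ≤ δ) ∧
    polyTrdeg (fun i => (S i).poly) ≤ r ∧
    g = C.eval (fun i => (S i).poly) ∧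
    g.totalDegree ≤ d}

/-- `𝓗 ⊆ K̄ⁿ` is a hitting set for the class `𝓕` of `n`-variate polynomials over `K`. -/
def IsHittingSet {K : Type u} [Field K] {n : ℕ} (𝓗 : Set (Fin n → AlgebraicClosure K))
    (𝓕 : Set (MvPolynomial (Fin n) K)) : Prop :=
  ∀ g ∈ 𝓕, g ≠ 0 → ∃ a ∈ 𝓗, MvPolynomial.aeval a g ≠ 0

/-! ## The Kronecker-type maps and the hitting set -/

/-- The number of elements of `I` that are smaller than `j`. If `j` is the `i`-th smallest element
of `I` (counting from 1) then this is `i - 1`. -/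
def rankIn {n : ℕ} (I : Finset (Fin n)) (j : Fin n) : ℕ :=
  (I.filter fun k => k < j).card

theorem rankIn_lt {n r : ℕ} {I : Finset (Fin n)} (hI : I.card = r) {j : Fin n} (hj : j ∈ I) :
    rankIn I j < r := by
  rw [← hI]
  apply Finset.card_lt_card
  refine ⟨Finset.filter_subset _ _, fun h => ?_⟩
  exact lt_irrefl j (Finset.mem_filter.mp (h hj)).2

/-- The `L`-algebra homomorphism `Φ_{I,D,p} : L[x₁, …, xₙ] → L[z₁, …, z_r][t]`. It maps the `i`-th
variable with index in `I` to `zᵢ`, and the `i`-th variable with index outside `I` to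
`t ^ (Dⁱ mod p)`. -/
noncomputable def PhiMod (L : Type u) [CommRing L] {n r : ℕ} (I : Finset (Fin n))
    (hI : I.card = r) (D p : ℕ) :
    MvPolynomial (Fin n) L →ₐ[L] Polynomial (MvPolynomial (Fin r) L) :=
  MvPolynomial.aeval fun j =>
    if hj : j ∈ I then Polynomial.C (MvPolynomial.X ⟨rankIn I j, rankIn_lt hI hj⟩)
    else Polynomial.X ^ (D ^ (rankIn Iᶜ j + 1) % p)

/-- The `L`-algebra homomorphism `Φ_{I,D,p,c} : L[x₁, …, xₙ] → L[z₁, …, z_r]`, obtained from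
`Φ_{I,D,p}` by substituting the constant `c` for `t`. -/
noncomputable def Phi (L : Type u) [CommRing L] {n r : ℕ} (I : Finset (Fin n))
    (hI : I.card = r) (D p : ℕ) (c : L) :
    MvPolynomial (Fin n) L →ₐ[L] MvPolynomial (Fin r) L :=
  ((Polynomial.aeval (R := MvPolynomial (Fin r) L) (MvPolynomial.C c)).restrictScalars L).comp
    (PhiMod L I hI D p)

/-- `D = δ^{r+1} + 1`. -/
def paramD (r δ : ℕ) : ℕ := δ ^ (r + 1) + 1

/-- `p_max = (n + δ^r)^{8 δ^{r+1}} ⌈log₂ D⌉² + 1`. -/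
def pMax (n r δ : ℕ) : ℕ :=
  (n + δ ^ r) ^ (8 * δ ^ (r + 1)) * (Nat.clog 2 (paramD r δ)) ^ 2 + 1

/-- The set of all points `(Φ_{I,D,p,c}(x₁)(a), …, Φ_{I,D,p,c}(xₙ)(a))`, where `I` is an `r`-subset
of `{1, …, n}`, `1 ≤ p ≤ p_max`, `c ∈ H₁` and `a ∈ H₂^r`. -/
def hittingSet {L : Type u} [CommRing L] (n r δ : ℕ) (H₁ H₂ : Finset L) : Set (Fin n → L) :=
  {x | ∃ (I : Finset (Fin n)) (hI : I.card = r) (p : ℕ) (c : L) (a : Fin r → L),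
    1 ≤ p ∧ p ≤ pMax n r δ ∧ c ∈ H₁ ∧ (∀ i, a i ∈ H₂) ∧
    x = fun j => MvPolynomial.eval a (Phi L I hI (paramD r δ) p c (MvPolynomial.X j))}

/-! ## Algebraic random access machines

The machine has integer registers, an integer memory, field registers, a field memory and a
write-only output tape. Memory cells are addressed through integer registers. Every instruction
and every test costs one step. The only operations on integers are addition and truncated
subtraction, and programs contain no field constants besides `0` and `1`, so that one program runs
over every field. -/

/-- The configurations of the machine over `L`. -/
structure RamState (L : Type u) : Type u where
  reg : ℕ → ℕ
  mem : ℕ → ℕ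
  freg : ℕ → L
  fmem : ℕ → L
  out : List L

/-- The instructions. The arguments are names of registers, except for the numeral `k`. -/
inductive Instr : Type
  | set (x k : ℕ)
  | add (x y z : ℕ)
  | sub (x y z : ℕ)
  | load (x y : ℕ)
  | store (x y : ℕ)
  | fzero (v : ℕ)
  | fone (v : ℕ)
  | fadd (v w w' : ℕ)
  | fsub (v w w' : ℕ)
  | fmul (v w w' : ℕ)
  | finv (v w : ℕ)
  | fload (v x : ℕ)
  | fstore (x v : ℕ)
  | print (v : ℕ)

/-- The effect of one instruction. -/
def Instr.apply {L : Type u} [Field L] (s : RamState L) : Instr → RamState L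
  | .set x k => { s with reg := Function.update s.reg x k }
  | .add x y z => { s with reg := Function.update s.reg x (s.reg y + s.reg z) }
  | .sub x y z => { s with reg := Function.update s.reg x (s.reg y - s.reg z) }
  | .load x y => { s with reg := Function.update s.reg x (s.mem (s.reg y)) }
  | .store x y => { s with mem := Function.update s.mem (s.reg x) (s.reg y) }
  | .fzero v => { s with freg := Function.update s.freg v 0 }
  | .fone v => { s with freg := Function.update s.freg v 1 }
  | .fadd v w w' => { s with freg := Function.update s.freg v (s.freg w + s.freg w') }
  | .fsub v w w' => { s with freg := Function.update s.freg v (s.freg w - s.freg w') }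
  | .fmul v w w' => { s with freg := Function.update s.freg v (s.freg w * s.freg w') }
  | .finv v w => { s with freg := Function.update s.freg v (s.freg w)⁻¹ }
  | .fload v x => { s with freg := Function.update s.freg v (s.fmem (s.reg x)) }
  | .fstore x v => { s with fmem := Function.update s.fmem (s.reg x) (s.freg v) }
  | .print v => { s with out := s.out ++ [s.freg v] }

/-- Programs: instructions, composition, branching on `reg x < reg y` or on `freg v = 0`, and loops
that are repeated while `reg x < reg y`. -/
inductive Prog : Type
  | instr (i : Instr)
  | seq (P Q : Prog)
  | ifLt (x y : ℕ) (P Q : Prog)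
  | ifZero (v : ℕ) (P Q : Prog)
  | whileLt (x y : ℕ) (P : Prog)

/-- `Exec P s t s'`: the program `P`, started in `s`, halts in `s'` after exactly `t` steps. -/
inductive Exec {L : Type u} [Field L] : Prog → RamState L → ℕ → RamState L → Prop
  | instr (i : Instr) (s : RamState L) : Exec (.instr i) s 1 (i.apply s)
  | seq {P Q : Prog} {s s' s'' : RamState L} {t t' : ℕ} :
      Exec P s t s' → Exec Q s' t' s'' → Exec (.seq P Q) s (t + t') s''
  | ifLt_pos {x y : ℕ} {P Q : Prog} {s s' : RamState L} {t : ℕ} :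
      s.reg x < s.reg y → Exec P s t s' → Exec (.ifLt x y P Q) s (t + 1) s'
  | ifLt_neg {x y : ℕ} {P Q : Prog} {s s' : RamState L} {t : ℕ} :
      ¬ s.reg x < s.reg y → Exec Q s t s' → Exec (.ifLt x y P Q) s (t + 1) s'
  | ifZero_pos {v : ℕ} {P Q : Prog} {s s' : RamState L} {t : ℕ} :
      s.freg v = 0 → Exec P s t s' → Exec (.ifZero v P Q) s (t + 1) s'
  | ifZero_neg {v : ℕ} {P Q : Prog} {s s' : RamState L} {t : ℕ} :
      s.freg v ≠ 0 → Exec Q s t s' → Exec (.ifZero v P Q) s (t + 1) s'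
  | while_done {x y : ℕ} {P : Prog} {s : RamState L} :
      ¬ s.reg x < s.reg y → Exec (.whileLt x y P) s 1 s
  | while_step {x y : ℕ} {P : Prog} {s s' s'' : RamState L} {t t' : ℕ} :
      s.reg x < s.reg y → Exec P s t s' → Exec (.whileLt x y P) s' t' s'' →
        Exec (.whileLt x y P) s (t + t' + 1) s''

/-- The initial configuration: `n, d, r, δ` in the integer registers `0, 1, 2, 3`, the list `l` in
the field memory, zero everywhere else, and an empty output tape. -/
def initState {L : Type u} [Field L] (n d r δ : ℕ) (l : List L) : RamState L where
  reg := fun k => [n, d, r, δ].getD k 0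
  mem := fun _ => 0
  freg := fun _ => 0
  fmem := fun k => l.getD k 0
  out := []

/-- Started on `n, d, r, δ` and the field elements `l`, the program `P` halts after exactly `t`
steps, having printed a list of points of `Lⁿ` (coordinate by coordinate, point after point) whose
set of members is `A`. -/
def Constructs {L : Type u} [Field L] (P : Prog) (n d r δ : ℕ) (l : List L) (t : ℕ)
    (A : Set (Fin n → L)) : Prop :=
  ∃ (s : RamState L) (pts : List (Fin n → L)),
    Exec P (initState n d r δ l) t s ∧
    s.out = (pts.map List.ofFn).flatten ∧ ∀ x, x ∈ pts ↔ x ∈ A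

/-! ## Specialization of linear independence -/

section Perron

open MvPolynomial

/-! Part (1) rests on faithful homomorphisms. Take a maximal algebraically independent subfamily of
the `f i` and pad it with variables to a transcendence basis `b` of size `n` in which `b j = X j`
for `n - r` indices; let `I` be the set of the other `r` indices
(`exists_algebraicIndependent_extension`). Every polynomial in the `f i` is algebraic over `K[b j :
j ∈ I]`, so a homomorphism that keeps these `r` elements independent kills no nonzero one
(`map_ne_zero_of_isAlgebraic_adjoin`).

Independence is preserved by a certificate argument that works in every characteristic. Perron's
theorem (`exists_relation_weight_le`) gives a relation of low weighted degree between `X i` and `b`.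
One of its coefficients, evaluated at `b`, is a nonzero polynomial of degree at most `δ ^ r`
(`exists_certificate`). If a map sends the variables outside `I` to constants and does not kill this
polynomial, the relation survives. If this holds for all `i ∈ I`, every `z` variable is algebraic
over the images of the `b j`. There are `r` of these in a ring of transcendence degree `r`, so they
are independent.

It remains to keep `r` nonzero polynomials of degree at most `δ ^ r` alive. Substituting powers `t ^
(D ^ i)` is injective on the monomials involved, because `D` exceeds all exponents. Reducing the
exponents modulo `p` is harmless if `p` divides none of a short list of nonzero integers; their
product is too small to be divisible by every `p ≤ pMax` (`Nat.exists_not_dvd_of_lt_two_pow`). Root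
counting then provides `c ∈ H₁` and a point of `H₂ ^ r`.

For part (2), the points are indexed by integers in mixed radix such that every integer below
`numCodes` decodes to a point and every point occurs. The time budget exceeds a fixed power of all
numbers that occur, so multiplication by repeated addition and division by repeated subtraction are
affordable. -/

theorem linearIndependent_of_map_eval {K : Type*} [Field K] {σ ι : Type*} (a : K)
    (v : ι → MvPolynomial σ (Polynomial K))
    (h : LinearIndependent K fun i => map (Polynomial.evalRingHom a) (v i)) :
    LinearIndependent (Polynomial K) v := by
  rw [linearIndependent_iff'] at h ⊢
  intro s g hg
  have step : ∀ g : ι → Polynomial K, ∑ i ∈ s, g i • v i = 0 →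
      ∀ i ∈ s, (Polynomial.X - Polynomial.C a) ∣ g i := by
    intro g hg i hi
    have h1 := congrArg (map (Polynomial.evalRingHom a)) hg
    simp only [map_sum, smul_eq_C_mul, map_mul, map_C, map_zero] at h1
    have := h s (fun i => (g i).eval a) (by simpa [smul_eq_C_mul] using h1) i hi
    exact Polynomial.dvd_iff_isRoot.mpr this
  -- The factor `X - a` can be cancelled from a whole relation, leaving a relation among the same
  -- vectors; by iteration every power of `X - a` divides every coefficient.
  have key : ∀ N : ℕ, ∀ g : ι → Polynomial K, ∑ i ∈ s, g i • v i = 0 →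
      ∀ i ∈ s, (Polynomial.X - Polynomial.C a) ^ N ∣ g i := by
    intro N
    induction N with
    | zero => intro g _ i _; simp
    | succ N ih =>
      intro g hg i hi
      have hd := step g hg
      choose! q hq using hd
      have hsum : ∑ i ∈ s, q i • v i = 0 := by
        have h2 : (Polynomial.X - Polynomial.C a) • ∑ i ∈ s, q i • v i = 0 := by
          rw [← hg, Finset.smul_sum]
          refine Finset.sum_congr rfl fun i hi => ?_
          rw [hq i hi, mul_smul]
        rw [smul_eq_C_mul] at h2
        rcases mul_eq_zero.mp h2 with h3 | h3
        · rw [C_eq_zero] at h3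
          exact absurd h3 (Polynomial.X_sub_C_ne_zero a)
        · exact h3
      rw [hq i hi, pow_succ']
      exact mul_dvd_mul_left _ (ih q hsum i hi)
  intro i hi
  by_contra hne
  have hd := Polynomial.natDegree_le_of_dvd (key ((g i).natDegree + 1) g hg i hi) hne
  rw [Polynomial.natDegree_pow, Polynomial.natDegree_X_sub_C] at hd
  omega

/-- Independence at one parameter value passes to the generic value. In Perron's theorem it is used
at `1`, where the deformed system is trivial, and at `0`, where it is the given one. -/
theorem linearIndependent_map_fractionRing {K : Type*} [Field K] {σ ι : Type*} (a : K)
    (v : ι → MvPolynomial σ (Polynomial K))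
    (h : LinearIndependent K fun i => map (Polynomial.evalRingHom a) (v i)) :
    LinearIndependent (FractionRing (Polynomial K)) fun i =>
      map (algebraMap (Polynomial K) (FractionRing (Polynomial K))) (v i) := by
  have h1 := linearIndependent_of_map_eval a v h
  rw [← LinearIndependent.iff_fractionRing (R := Polynomial K)]
  have h2 := h1.map' (mapAlgHom (σ := σ)
    (Algebra.ofId (Polynomial K) (FractionRing (Polynomial K)))).toLinearMap (by
      rw [LinearMap.ker_eq_bot]
      exact map_injective _ (IsFractionRing.injective (Polynomial K) _))
  exact h2

theorem totalDegree_map_le {R S σ : Type*} [CommSemiring R] [CommSemiring S] (φ : R →+* S)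
    (p : MvPolynomial σ R) : (map φ p).totalDegree ≤ p.totalDegree :=
  Finset.sup_mono (support_map_subset _ _)

/-! ## Perron's theorem -/

variable {σ : Type*} [Fintype σ]

/-- The product of the `F j` to the quotients and of the variables to the remainders of the
exponents `e j` modulo `w j`. -/
noncomputable def quotRemMonomial {R : Type*} [CommRing R] (w : σ → ℕ) (F : σ → MvPolynomial σ R)
    (e : σ →₀ ℕ) : MvPolynomial σ R :=
  ∏ j, (F j ^ (e j / w j) * X j ^ (e j % w j))

theorem map_quotRemMonomial {R S : Type*} [CommRing R] [CommRing S] (φ : R →+* S) (w : σ → ℕ)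
    (F : σ → MvPolynomial σ R) (e : σ →₀ ℕ) :
    map φ (quotRemMonomial w F e) = quotRemMonomial w (fun j => map φ (F j)) e := by
  simp [quotRemMonomial]

theorem quotRemMonomial_X_pow {R : Type*} [CommRing R] (w : σ → ℕ) (e : σ →₀ ℕ) :
    quotRemMonomial w (fun j => (X j : MvPolynomial σ R) ^ w j) e = monomial e 1 := by
  rw [quotRemMonomial, monomial_eq, C_1, one_mul, Finsupp.prod_fintype _ _ (by simp)]
  refine Finset.prod_congr rfl fun j _ => ?_
  rw [← pow_mul, ← pow_add, Nat.div_add_mod]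

theorem totalDegree_quotRemMonomial_le {R : Type*} [CommRing R] {w : σ → ℕ}
    {F : σ → MvPolynomial σ R} (hF : ∀ j, (F j).totalDegree ≤ w j) (e : σ →₀ ℕ) :
    (quotRemMonomial w F e).totalDegree ≤ e.degree := by
  rw [quotRemMonomial, Finsupp.degree_eq_sum]
  refine (totalDegree_finsetProd _ _).trans (Finset.sum_le_sum fun j _ => ?_)
  refine (totalDegree_mul _ _).trans ?_
  have h1 : (F j ^ (e j / w j)).totalDegree ≤ e j / w j * w j :=
    (totalDegree_pow _ _).trans (Nat.mul_le_mul_left _ (hF j))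
  have h2 : ((X j : MvPolynomial σ R) ^ (e j % w j)).totalDegree ≤ e j % w j := by
    refine (totalDegree_pow _ _).trans ?_
    refine (Nat.mul_le_mul_left _ ?_).trans_eq (mul_one _)
    exact (totalDegree_monomial_le _ _).trans (by simp)
  have h3 := Nat.div_add_mod' (e j) (w j)
  omega

/-- A dimension count: the elements with index of degree at most `N` lie in the space of polynomials
of degree at most `N` and are as many as its monomials, so independence makes them a basis. -/
theorem mem_span_quotRemMonomial {k : Type*} [Field k] {w : σ → ℕ} {F : σ → MvPolynomial σ k}
    (hF : ∀ j, (F j).totalDegree ≤ w j) (hind : LinearIndependent k (quotRemMonomial w F))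
    {h : MvPolynomial σ k} {N : ℕ} (hh : h.totalDegree ≤ N) :
    h ∈ Submodule.span k (quotRemMonomial w F '' {e | e.degree ≤ N}) := by
  classical
  let S : Set (σ →₀ ℕ) := {n | (n.sum fun _ e => e) ≤ N}
  have hS : ∀ e : σ →₀ ℕ, e ∈ S ↔ e.degree ≤ N := fun e => Iff.rfl
  let V := restrictTotalDegree σ k N
  let bas : Module.Basis S k V := basisRestrictSupport k S
  have hmem : ∀ e : S, quotRemMonomial w F e ∈ V := fun e =>
    (mem_restrictTotalDegree _ _ _).mpr ((totalDegree_quotRemMonomial_le hF e).trans e.2)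
  let v : S → V := fun e => ⟨quotRemMonomial w F e, hmem e⟩
  have hv : LinearIndependent k v := by
    have h1 : LinearIndependent k (fun e : S => quotRemMonomial w F e) :=
      hind.comp _ Subtype.val_injective
    exact LinearIndependent.of_comp V.subtype h1
  have : Finite S := Module.Finite.finite_basis bas
  have : Fintype S := Fintype.ofFinite S
  have hspan := hv.span_eq_top_of_card_eq_finrank' (Module.finrank_eq_card_basis bas).symm
  have h1 : (⟨h, (mem_restrictTotalDegree _ _ _).mpr hh⟩ : V) ∈ Submodule.span k (Set.range v) := by
    rw [hspan]; trivial
  have h2 := Submodule.mem_map_of_mem (f := V.subtype) h1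
  rw [Submodule.map_span, ← Set.range_comp] at h2
  refine Submodule.span_mono ?_ h2
  rintro _ ⟨e, rfl⟩
  exact ⟨e, e.2, rfl⟩

/-- The polynomials in the variables `none` of weight `1` and `some j` of weight `w j` all of whose
monomials have weight at most `N`. -/
noncomputable def weightLE (k : Type*) [Field k] (w : σ → ℕ) (N : ℤ) :
    Submodule k (MvPolynomial (Option σ) k) :=
  restrictSupport k {m | (m none : ℤ) + ∑ j, (w j : ℤ) * m (some j) ≤ N}

theorem mul_mem_weightLE {k : Type*} [Field k] {w : σ → ℕ} {N M : ℤ}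
    {p q : MvPolynomial (Option σ) k} (hp : p ∈ weightLE k w N) (hq : q ∈ weightLE k w M) :
    p * q ∈ weightLE k w (N + M) := by
  classical
  rw [weightLE, mem_restrictSupport_iff] at *
  intro m hm
  obtain ⟨a, ha, b, hb, rfl⟩ := Finset.mem_add.mp (support_mul p q hm)
  have h1 := hp ha
  have h2 := hq hb
  simp only [Set.mem_ofPred_eq, Finsupp.add_apply, Nat.cast_add, mul_add,
    Finset.sum_add_distrib] at *
  linarith

theorem one_mem_weightLE (k : Type*) [Field k] (w : σ → ℕ) : 1 ∈ weightLE k w 0 := by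
  rw [← C_1, C_apply, weightLE, monomial_mem_restrictSupport]
  simp

theorem prod_mem_weightLE {k : Type*} [Field k] {w : σ → ℕ} {ι : Type*} (s : Finset ι)
    (N : ι → ℤ) (p : ι → MvPolynomial (Option σ) k) (hp : ∀ i ∈ s, p i ∈ weightLE k w (N i)) :
    ∏ i ∈ s, p i ∈ weightLE k w (∑ i ∈ s, N i) := by
  classical
  induction s using Finset.induction_on with
  | empty => simpa using one_mem_weightLE k w
  | insert i s hi ih =>
    rw [Finset.prod_insert hi, Finset.sum_insert hi]
    exact mul_mem_weightLE (hp i (by simp)) (ih fun j hj => hp j (by simp [hj]))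

variable [DecidableEq σ]

/-- The monomials `X ^ a` with `a j < w j` generate the polynomial ring over `k[F]`, with control of
degrees: dividing the exponents `e` by `w` gives quotients `q` and remainders `a` with `∑ w j * q j
+ ∑ a j = e.degree`. The weight bound can be negative, and then it forces `G a = 0`; hence the
integer-valued bounds. -/
theorem exists_expansion {k : Type*} [Field k] {w : σ → ℕ} (hw : ∀ j, 0 < w j)
    {F : σ → MvPolynomial σ k}
    (hF : ∀ j, (F j).totalDegree ≤ w j) (hind : LinearIndependent k (quotRemMonomial w F))
    {h : MvPolynomial σ k} {N : ℕ} (hh : h.totalDegree ≤ N) :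
    ∃ G : (∀ j, Fin (w j)) → MvPolynomial σ k,
      h = ∑ a, aeval F (G a) * ∏ j, X j ^ (a j : ℕ) ∧
      ∀ a, rename some (G a) ∈ weightLE k w (N - ∑ j, ((a j : ℕ) : ℤ)) := by
  classical
  have h1 := mem_span_quotRemMonomial hF hind hh
  clear hh
  induction h1 using Submodule.span_induction with
  | mem x hx =>
    obtain ⟨e, he, rfl⟩ := hx
    let b : σ →₀ ℕ := Finsupp.equivFunOnFinite.symm fun j => e j / w j
    let a0 : ∀ j, Fin (w j) := fun j => ⟨e j % w j, Nat.mod_lt _ (hw j)⟩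
    refine ⟨fun a => if a = a0 then monomial b 1 else 0, ?_, fun a => ?_⟩
    · rw [Finset.sum_eq_single a0]
      · simp only [if_true]
        rw [aeval_monomial, map_one, one_mul, Finsupp.prod_fintype _ _ (by simp),
          ← Finset.prod_mul_distrib]
        rfl
      · intro a _ ha; simp [ha]
      · simp
    · by_cases ha : a = a0
      · simp only [if_pos ha, rename_monomial]
        rw [weightLE, monomial_mem_restrictSupport]
        left
        subst ha
        have hsome : ∀ j, (b.mapDomain some) (some j) = e j / w j := fun j => by
          rw [Finsupp.mapDomain_apply (Option.some_injective σ)]; rfl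
        have hnone : (b.mapDomain some) none = 0 :=
          Finsupp.mapDomain_of_notMem_range _ _ (by simp)
        have he' : ∑ j, e j ≤ N := by rw [← Finsupp.degree_eq_sum]; exact he
        simp only [Set.mem_ofPred_eq, hsome, hnone, a0, Nat.cast_zero, zero_add]
        rw [le_sub_iff_add_le, ← Finset.sum_add_distrib]
        refine le_trans (le_of_eq ?_) (Nat.cast_le.mpr he')
        rw [Nat.cast_sum]
        refine Finset.sum_congr rfl fun j _ => ?_
        have := Nat.div_add_mod (e j) (w j)
        exact_mod_cast this
      · simp [ha]
  | zero => exact ⟨0, by simp, fun a => by simp⟩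
  | add x y _ _ hx hy =>
    obtain ⟨G, hG, hG'⟩ := hx
    obtain ⟨H, hH, hH'⟩ := hy
    refine ⟨G + H, ?_, fun a => ?_⟩
    · simp only [Pi.add_apply, map_add, add_mul, Finset.sum_add_distrib, ← hG, ← hH]
    · rw [Pi.add_apply, map_add]
      exact add_mem (hG' a) (hH' a)
  | smul c x _ hx =>
    obtain ⟨G, hG, hG'⟩ := hx
    refine ⟨c • G, ?_, fun a => ?_⟩
    · simp only [Pi.smul_apply, map_smul, smul_mul_assoc, ← Finset.smul_sum, ← hG]
    · rw [Pi.smul_apply, map_smul]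
      exact Submodule.smul_mem _ _ (hG' a)

/-- Cayley–Hamilton: expand `g * X ^ a = ∑ G a a' * X ^ a'` over `k[F]` and take the characteristic
polynomial of `G`, with `X none` as the indeterminate. It is nonzero because it is monic, and it
vanishes at `g, F` because the vector of the `X ^ a` is in the kernel of the specialized matrix. -/
theorem exists_relation_of_linearIndependent {k : Type*} [Field k] {w : σ → ℕ}
    (hw : ∀ j, 0 < w j) {F : σ → MvPolynomial σ k} (hF : ∀ j, (F j).totalDegree ≤ w j)
    (hind : LinearIndependent k (quotRemMonomial w F)) {g : MvPolynomial σ k}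
    (hg : g.totalDegree ≤ 1) :
    ∃ P : MvPolynomial (Option σ) k, P ≠ 0 ∧ aeval (fun o => Option.elim o g F) P = 0 ∧
      P ∈ weightLE k w (∏ j, w j : ℕ) := by
  classical
  let α := ∀ j, Fin (w j)
  let mon : α → MvPolynomial σ k := fun a => ∏ j, X j ^ (a j : ℕ)
  have hmon : ∀ a, (mon a).totalDegree ≤ ∑ j, (a j : ℕ) := fun a => by
    refine (totalDegree_finsetProd _ _).trans (Finset.sum_le_sum fun j _ => ?_)
    refine (totalDegree_pow _ _).trans ((Nat.mul_le_mul_left _ ?_).trans_eq (mul_one _))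
    exact (totalDegree_monomial_le _ _).trans (by simp)
  have hdeg : ∀ a, (g * mon a).totalDegree ≤ 1 + ∑ j, (a j : ℕ) := fun a =>
    (totalDegree_mul _ _).trans (add_le_add hg (hmon a))
  choose G hG hG' using fun a => exists_expansion hw hF hind (hdeg a)
  let M : Matrix α α (MvPolynomial (Option σ) k) := Matrix.of fun a a' =>
    (if a = a' then X none else 0) - rename some (G a a')
  have hM : ∀ a a', M a a' ∈ weightLE k w
      (1 + (∑ j, ((a j : ℕ) : ℤ)) - ∑ j, ((a' j : ℕ) : ℤ)) := by
    intro a a'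
    change (if a = a' then X none else 0) - rename some (G a a') ∈ _
    refine sub_mem ?_ ?_
    · split_ifs with h
      · subst h
        rw [← pow_one (X none), X_pow_eq_monomial, weightLE, monomial_mem_restrictSupport]
        left
        simp
      · exact zero_mem _
    · have := hG' a a'
      push_cast at this
      exact this
  refine ⟨M.det, ?_, ?_, ?_⟩
  · intro h0
    let ψ : MvPolynomial (Option σ) k →ₐ[k] Polynomial (MvPolynomial σ k) :=
      aeval fun o => Option.elim o Polynomial.X fun j => Polynomial.C (X j)
    have hψ : ∀ q : MvPolynomial σ k, ψ (rename some q) = Polynomial.C q := by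
      intro q
      have : ψ.comp (rename some) =
          (Algebra.ofId (MvPolynomial σ k) (Polynomial (MvPolynomial σ k))).restrictScalars k := by
        ext j : 1
        simp [ψ]
      exact DFunLike.congr_fun this q
    have h1 : ψ M.det = (Matrix.of G).charpoly := by
      rw [AlgHom.map_det, Matrix.charpoly]
      congr 1
      ext a a' : 2
      simp only [AlgHom.mapMatrix_apply, Matrix.map_apply, M, map_sub, hψ, Matrix.charmatrix_apply,
        Matrix.of_apply, Matrix.diagonal_apply, apply_ite ψ, map_zero]
      simp [ψ]
    rw [h0, map_zero] at h1
    exact (Matrix.charpoly_monic (Matrix.of G)).ne_zero h1.symm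
  · rw [AlgHom.map_det]
    rw [← Matrix.exists_mulVec_eq_zero_iff]
    refine ⟨mon, ?_, ?_⟩
    · intro h
      -- The kernel vector is nonzero because its entry at `a = 0` is `1`.
      have := congrFun h (fun j => ⟨0, hw j⟩)
      simp [mon] at this
    · ext1 a
      have h2 : ∀ q : MvPolynomial σ k,
          aeval (fun o => Option.elim o g F) (rename some q) = aeval F q := fun q => by
        rw [aeval_rename]; rfl
      simp only [Matrix.mulVec, dotProduct, AlgHom.mapMatrix_apply, Matrix.map_apply, M, Matrix.of_apply, map_sub,
        h2, sub_mul, Finset.sum_sub_distrib, Pi.zero_apply, apply_ite (aeval _), aeval_X, map_zero,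
        Option.elim_none, ite_mul, zero_mul]
      rw [sub_eq_zero]
      rw [Finset.sum_ite_eq, if_pos (Finset.mem_univ a)]
      exact hG a
  · rw [Matrix.det_apply]
    refine sum_mem fun τ _ => ?_
    rw [Units.smul_def, zsmul_eq_mul, ← map_intCast (C : k →+* _), ← smul_eq_C_mul]
    refine Submodule.smul_mem _ _ ?_
    -- For each permutation the terms `∑ τ a j` and `∑ a j` cancel in the sum over all `a`. What
    -- remains is `1` for each index `a`, that is `∏ j, w j`.
    have h3 := prod_mem_weightLE (w := w) Finset.univ
      (fun a => 1 + (∑ j, ((τ a j : ℕ) : ℤ)) - ∑ j, ((a j : ℕ) : ℤ))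
      (fun a => M (τ a) a) (fun a _ => hM (τ a) a)
    convert h3 using 2
    rw [Finset.sum_sub_distrib, Finset.sum_add_distrib,
      Equiv.sum_comp τ (fun a : α => ∑ j, ((a j : ℕ) : ℤ))]
    simp [α]

/-- **Perron's theorem**: `g, f₁, …, fₙ` satisfy a relation whose weight is at most the product of
the degree bounds of the `f j`, for `g` of degree at most one. -/
theorem exists_relation_weight_le {K : Type*} [Field K] {w : σ → ℕ}
    (hw : ∀ j, 0 < w j) {f : σ → MvPolynomial σ K} (hf : ∀ j, (f j).totalDegree ≤ w j)
    {g : MvPolynomial σ K} (hg : g.totalDegree ≤ 1) :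
    ∃ P : MvPolynomial (Option σ) K, P ≠ 0 ∧ aeval (fun o => Option.elim o g f) P = 0 ∧
      P ∈ weightLE K w (∏ j, w j : ℕ) := by
  classical
  let A := Polynomial K
  let E := FractionRing A
  -- A deformation with parameter `t`: at `t = 1` it is `X j ^ w j`, for which the
  -- quotient-remainder products are the ordinary monomials; at `t = 0` it is `f j`.
  let F : σ → MvPolynomial σ A := fun j =>
    C Polynomial.X * X j ^ w j + C (1 - Polynomial.X) * map Polynomial.C (f j)
  let g' : MvPolynomial σ A := map Polynomial.C g
  have hF1 : ∀ j, map (Polynomial.evalRingHom 1) (F j) = X j ^ w j := fun j => by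
    simp [F]
  have hC : ∀ (a : K) (p : MvPolynomial σ K),
      map (Polynomial.evalRingHom a) (map Polynomial.C p) = p := fun a p => by
    rw [map_map]
    have : (Polynomial.evalRingHom a).comp Polynomial.C = RingHom.id K := by ext; simp
    rw [this, map_id]
  have hF0 : ∀ j, map (Polynomial.evalRingHom 0) (F j) = f j := fun j => by
    simp only [F, map_add, map_mul, hC]; simp
  have hind : LinearIndependent E
      (quotRemMonomial w fun j => map (algebraMap A E) (F j)) := by
    have h1 := linearIndependent_map_fractionRing 1 (quotRemMonomial w F) (by
      simp only [map_quotRemMonomial, hF1, quotRemMonomial_X_pow]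
      exact (basisMonomials σ K).linearIndependent)
    convert h1 using 1
    ext1 e
    rw [map_quotRemMonomial]
  have hdeg : ∀ j, (map (algebraMap A E) (F j)).totalDegree ≤ w j := fun j => by
    refine (totalDegree_map_le _ _).trans ((totalDegree_add _ _).trans (max_le ?_ ?_))
    · refine (totalDegree_mul _ _).trans ?_
      rw [totalDegree_C, zero_add, totalDegree_X_pow]
    · refine (totalDegree_mul _ _).trans ?_
      rw [totalDegree_C, zero_add]
      exact (totalDegree_map_le _ _).trans (hf j)
  have hgdeg : (map (algebraMap A E) g').totalDegree ≤ 1 :=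
    (totalDegree_map_le _ _).trans ((totalDegree_map_le _ _).trans hg)
  obtain ⟨P, hP0, hP, hPw⟩ := exists_relation_of_linearIndependent hw hdeg hind hgdeg
  -- Without a relation at `t = 0`, the monomials of bounded weight in `g, f` are independent over
  -- `K`. Then those in `g', F` are independent over the fraction field, which contradicts `P`.
  by_contra hcon
  push Not at hcon
  let S : Set (Option σ →₀ ℕ) :=
    {m | (m none : ℤ) + ∑ j, (w j : ℤ) * m (some j) ≤ (∏ j, w j : ℕ)}
  let v : S → MvPolynomial σ A := fun m => aeval (fun o => Option.elim o g' F) (monomial m.1 1)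
  have hv : LinearIndependent E fun m => map (algebraMap A E) (v m) := by
    refine linearIndependent_map_fractionRing 0 v ?_
    have hv0 : ∀ m : S, map (Polynomial.evalRingHom 0) (v m)
        = aeval (fun o => Option.elim o g f) (monomial m.1 (1 : K)) := fun m => by
      simp only [v, aeval_monomial, map_one, one_mul, Finsupp.prod, map_prod, map_pow]
      refine Finset.prod_congr rfl fun o _ => ?_
      cases o with
      | none => simp only [Option.elim_none, g', hC]
      | some j => simp only [Option.elim_some, hF0]
    rw [linearIndependent_iff']
    intro s l hl
    let p : MvPolynomial (Option σ) K := ∑ m ∈ s, monomial m.1 (l m)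
    have hp : aeval (fun o => Option.elim o g f) p = 0 := by
      rw [← hl, map_sum]
      refine Finset.sum_congr rfl fun m _ => ?_
      rw [hv0, ← map_smul, smul_monomial, smul_eq_mul, mul_one]
    have hpw : p ∈ weightLE K w (∏ j, w j : ℕ) := by
      refine sum_mem fun m _ => ?_
      rw [weightLE, monomial_mem_restrictSupport]
      exact Or.inl m.2
    have hp0 : p = 0 := by
      by_contra h0
      exact hcon p h0 hp hpw
    intro m hm
    have := congrArg (coeff m.1) hp0
    simpa [p, coeff_sum, coeff_monomial, Subtype.val_inj, hm] using this
  refine hP0 ?_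
  have hS : ∀ m ∈ P.support, m ∈ S := fun m hm => hPw hm
  rw [linearIndependent_iff'] at hv
  have h0 := hv (P.support.subtype (· ∈ S)) (fun m => P.coeff m) (by
    rw [Finset.sum_subtype_of_mem (f := fun m => P.coeff m •
      map (algebraMap A E) (aeval (fun o => Option.elim o g' F) (monomial m 1))) hS, ← hP]
    conv_rhs => rw [P.as_sum, map_sum]
    refine Finset.sum_congr rfl fun m _ => ?_
    simp only [aeval_monomial, map_one, one_mul, Finsupp.prod, map_prod, map_pow, smul_eq_C_mul,
      algebraMap_eq]
    congr 1
    refine Finset.prod_congr rfl fun o _ => ?_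
    cases o <;> rfl)
  ext m
  by_cases hm : m ∈ P.support
  · exact h0 ⟨m, hS m hm⟩ (by simpa using hm)
  · simpa using hm

end Perron

/-! ### Certificates and preservation of algebraic independence -/

section Faithful

open MvPolynomial

theorem totalDegree_aeval_le {K σ τ : Type*} [Field K] [Fintype σ] {w : σ → ℕ}
    {b : σ → MvPolynomial τ K} (hb : ∀ j, (b j).totalDegree ≤ w j) {q : MvPolynomial σ K} {N : ℕ}
    (hq : ∀ m ∈ q.support, ∑ j, w j * m j ≤ N) : (aeval b q).totalDegree ≤ N := by
  rw [q.as_sum, map_sum]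
  refine totalDegree_finsetSum_le fun m hm => ?_
  rw [aeval_monomial, algebraMap_eq, Finsupp.prod_fintype _ _ (by simp)]
  refine (totalDegree_mul _ _).trans ?_
  rw [totalDegree_C, zero_add]
  refine (totalDegree_finsetProd _ _).trans (le_trans (Finset.sum_le_sum fun j _ => ?_) (hq m hm))
  refine (totalDegree_pow _ _).trans ?_
  rw [mul_comm]
  exact Nat.mul_le_mul_right _ (hb j)

/-- If `b` is algebraically independent then every variable `X i` has a nonzero certificate `c` of
small degree: any homomorphism that does not kill `c`, and maps the `b j` outside `I` to constants,
maps `X i` to an element that is algebraic over the images of the `b j` with `j ∈ I`. -/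
theorem exists_certificate {K : Type*} [Field K] {n δ : ℕ} (hδ : 1 ≤ δ)
    {b : Fin n → MvPolynomial (Fin n) K} (hb : AlgebraicIndependent K b)
    (hdeg : ∀ j, (b j).totalDegree ≤ δ) (I : Finset (Fin n)) (hI : ∀ j ∉ I, b j = X j)
    (i : Fin n) :
    ∃ c : MvPolynomial (Fin n) K, c ≠ 0 ∧ c.totalDegree ≤ δ ^ I.card ∧
      ∀ (L S : Type u) [Field L] [CommRing S] [IsDomain S] [Algebra K L] [Algebra L S]
        [Algebra K S] [IsScalarTower K L S] (φ : MvPolynomial (Fin n) K →ₐ[K] S),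
        (∀ j ∉ I, ∃ a : L, φ (X j) = algebraMap L S a) → φ c ≠ 0 →
        IsAlgebraic (Algebra.adjoin L (Set.range fun j : I => φ (b j))) (φ (X i)) := by
  classical
  -- Outside `I` the degree of `b j` is one, so Perron's bound is `δ ^ I.card` and not `δ ^ n`.
  let w : Fin n → ℕ := fun j => if j ∈ I then δ else 1
  have hw : ∀ j, 0 < w j := fun j => by dsimp only [w]; split_ifs <;> omega
  have hbw : ∀ j, (b j).totalDegree ≤ w j := fun j => by
    dsimp only [w]
    split_ifs with h
    · exact hdeg j
    · rw [hI j h]; simp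
  obtain ⟨P, hP0, hP, hPw⟩ := exists_relation_weight_le (g := (X i : MvPolynomial (Fin n) K))
    hw hbw (by simp)
  have hprod : ∏ j, w j = δ ^ I.card := by
    simp [w]
  have hP' : optionEquivLeft K (Fin n) P ≠ 0 := by
    simpa using hP0
  -- Regard `P` as a polynomial in the variable that stands for `X i`. The certificate is one of its
  -- nonzero coefficients, evaluated at `b`.
  obtain ⟨k, hk⟩ : ∃ k, (optionEquivLeft K (Fin n) P).coeff k ≠ 0 := by
    by_contra hcon
    push Not at hcon
    exact hP' (Polynomial.ext (by simpa using hcon))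
  refine ⟨aeval b ((optionEquivLeft K (Fin n) P).coeff k), ?_, ?_, ?_⟩
  · intro h
    exact hk (hb (by simpa using h))
  · refine totalDegree_aeval_le hbw fun m hm => ?_
    rw [mem_support_coeff_optionEquivLeft] at hm
    have h1 := hPw hm
    rw [hprod] at h1
    simp only [Set.mem_ofPred_eq, Finsupp.optionElim_apply_none, Finsupp.optionElim_apply_some] at h1
    have h2 : ((∑ j, w j * m j : ℕ) : ℤ) ≤ (δ ^ I.card : ℕ) := by
      push_cast at h1 ⊢
      linarith
    exact_mod_cast h2
  · intro L S _ _ _ _ _ _ _ φ hφ hc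
    let B := Algebra.adjoin L (Set.range fun j : I => φ (b j))
    have hmem : ∀ j, φ (b j) ∈ B := fun j => by
      by_cases hj : j ∈ I
      · exact Algebra.subset_adjoin ⟨⟨j, hj⟩, rfl⟩
      · obtain ⟨a, ha⟩ := hφ j hj
        rw [hI j hj, ha]
        exact B.algebraMap_mem a
    let ρ : MvPolynomial (Fin n) K →ₐ[K] B := aeval fun j => ⟨φ (b j), hmem j⟩
    have hρ : ∀ q, ((ρ q : B) : S) = φ (aeval b q) := fun q => by
      have : ((B.val.restrictScalars K).comp ρ) = φ.comp (aeval b) := by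
        ext j
        simp [ρ]
      exact DFunLike.congr_fun this q
    -- The image of the relation is nonzero because its `k`-th coefficient is `φ c`.
    refine ⟨(optionEquivLeft K (Fin n) P).map (ρ : MvPolynomial (Fin n) K →+* B), ?_, ?_⟩
    · intro h
      have h1 := congrArg (fun q => ((q.coeff k : B) : S)) h
      simp only [Polynomial.coeff_map, RingHom.coe_coe, hρ, Polynomial.coeff_zero,
        ZeroMemClass.coe_zero] at h1
      exact hc h1
    · have : ∀ Q : MvPolynomial (Option (Fin n)) K, Polynomial.aeval (φ (X i))
          ((optionEquivLeft K (Fin n) Q).map (ρ : MvPolynomial (Fin n) K →+* B))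
          = φ (aeval (fun o => Option.elim o (X i) b) Q) := by
        intro Q
        induction Q using MvPolynomial.induction_on with
        | C a =>
          simp only [optionEquivLeft_C, Polynomial.map_C, RingHom.coe_coe, Polynomial.aeval_C,
            algHom_C, Subalgebra.algebraMap_def]
          rw [AlgHom.commutes]
          simp
        | add p q hp hq => simp only [map_add, Polynomial.map_add, hp, hq]
        | mul_X p o hp =>
          rw [map_mul, Polynomial.map_mul, map_mul, hp, map_mul, map_mul]
          congr 1
          cases o with
          | none => simp [optionEquivLeft_X_none]
          | some j =>
            simp only [optionEquivLeft_X_some, Polynomial.map_C, RingHom.coe_coe,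
              Polynomial.aeval_C, Subalgebra.algebraMap_def, hρ, aeval_X, Option.elim_some]
            rfl
      rw [this, hP, map_zero]

/-- The polynomial ring has transcendence degree `r`, so `r` elements over which it is algebraic
form a transcendence basis. -/
theorem algebraicIndependent_of_isAlgebraic_X {L : Type*} [Field L] {r : ℕ} {ι : Type*} [Fintype ι]
    (hι : Fintype.card ι = r) (y : ι → MvPolynomial (Fin r) L)
    (hy : ∀ t, IsAlgebraic (Algebra.adjoin L (Set.range y)) (X t : MvPolynomial (Fin r) L)) :
    AlgebraicIndependent L y := by
  have : Algebra.IsAlgebraic (Algebra.adjoin L (Set.range y)) (MvPolynomial (Fin r) L) :=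
    (IsTranscendenceBasis.mvPolynomial (Fin r) L).isAlgebraic_iff.mpr hy
  refine (Algebra.IsAlgebraic.isTranscendenceBasis_of_lift_le_trdeg_of_finite L y ?_).1
  rw [MvPolynomial.trdeg_of_isDomain]
  simp [hι]

/-- The map is injective on `K[b]`. In a domain, an ideal that contains a nonzero element algebraic
over `K[b]` meets `K[b]` nontrivially, so the kernel cannot contain `a`. -/
theorem map_ne_zero_of_isAlgebraic_adjoin {K A S ι : Type*} [Field K] [CommRing A] [IsDomain A]
    [CommRing S] [Algebra K A] [Algebra K S] {b : ι → A} (φ : A →ₐ[K] S)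
    (hφ : AlgebraicIndependent K fun i => φ (b i)) {a : A} (ha : a ≠ 0)
    (halg : IsAlgebraic (Algebra.adjoin K (Set.range b)) a) : φ a ≠ 0 := by
  intro h0
  have h1 := Ideal.comap_ne_bot_of_algebraic_mem (I := RingHom.ker φ) ha h0 halg
  refine h1 (eq_bot_iff.mpr fun x hx => ?_)
  rw [Ideal.mem_comap, RingHom.mem_ker] at hx
  obtain ⟨x, hxm⟩ := x
  have hxm' := hxm
  rw [Algebra.adjoin_range_eq_range_aeval] at hxm'
  obtain ⟨q, rfl⟩ := hxm'
  have h2 : aeval (fun i => φ (b i)) q = 0 := by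
    rw [← hx]
    change _ = φ (aeval b q)
    rw [← MvPolynomial.comp_aeval_apply]
  have h3 : q = 0 := hφ (by simpa using h2)
  subst h3
  exact Subtype.ext (map_zero _)

open AlgebraicIndependent in
-- Exchange in the algebraic matroid: a basis `s` of the `f i` extends by variables to a
-- transcendence basis of the polynomial ring. The added elements are variables, so all degrees stay
-- at most `δ`.
theorem exists_algebraicIndependent_extension {K : Type u} [Field K] {n m r δ : ℕ} (hδ : 1 ≤ δ)
    (hrn : r ≤ n) {f : Fin m → MvPolynomial (Fin n) K} (hf : ∀ i, (f i).totalDegree ≤ δ)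
    (hr : polyTrdeg f ≤ r) :
    ∃ (I : Finset (Fin n)) (b : Fin n → MvPolynomial (Fin n) K), I.card = r ∧
      AlgebraicIndependent K b ∧ (∀ j, (b j).totalDegree ≤ δ) ∧ (∀ j ∉ I, b j = X j) ∧
      ∀ i, IsAlgebraic (Algebra.adjoin K (Set.range fun j : I => b j)) (f i) := by
  classical
  obtain ⟨s, hs⟩ := (matroid K (MvPolynomial (Fin n) K)).exists_isBasis (Set.range f)
  rw [matroid_isBasis_iff] at hs
  obtain ⟨hsi, hsf, hsa⟩ := hs
  have hsfin : s.Finite := (Set.finite_range f).subset hsf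
  have hscard : s.ncard ≤ r := by
    refine le_trans ?_ hr
    choose g hg using fun x : s => hsf x.2
    have : Fintype s := hsfin.fintype
    have hginj : Function.Injective g := fun x y hxy => by
      apply Subtype.ext; rw [← hg x, ← hg y, hxy]
    have h1 : (Finset.univ.image g).card = s.ncard := by
      rw [Finset.card_image_of_injective _ hginj, Finset.card_univ, ← Set.toFinset_card,
        Set.ncard_eq_toFinset_card']
    rw [← h1]
    refine Finset.le_sup (f := Finset.card) (Finset.mem_filter.mpr ⟨Finset.mem_univ _, ?_⟩)
    let h : {i // i ∈ Finset.univ.image g} → s := fun i =>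
      ⟨f i, by
        obtain ⟨x, _, hx⟩ := Finset.mem_image.mp i.2
        rw [← hx, hg]; exact x.2⟩
    have hinj : Function.Injective h := by
      intro i j hij
      obtain ⟨x, _, hx⟩ := Finset.mem_image.mp i.2
      obtain ⟨y, _, hy⟩ := Finset.mem_image.mp j.2
      have h2 : f i = f j := congrArg Subtype.val hij
      rw [← hx, ← hy, hg, hg] at h2
      apply Subtype.ext
      rw [← hx, ← hy, Subtype.ext h2]
    exact hsi.comp h hinj
  have halg : Algebra.IsAlgebraic
      (Algebra.adjoin K (s ∪ Set.range (X : Fin n → MvPolynomial (Fin n) K)))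
      (MvPolynomial (Fin n) K) := by
    refine (IsTranscendenceBasis.mvPolynomial (Fin n) K).isAlgebraic_iff.mpr fun t => ?_
    exact isAlgebraic_algebraMap (⟨X t, Algebra.subset_adjoin (Or.inr ⟨t, rfl⟩)⟩ :
      Algebra.adjoin K (s ∪ Set.range (X : Fin n → MvPolynomial (Fin n) K)))
  obtain ⟨B, hsB, hBt, hB⟩ := exists_isTranscendenceBasis_between s
    (s ∪ Set.range (X : Fin n → MvPolynomial (Fin n) K)) Set.subset_union_left hsi
  have hBfin : B.Finite := (hsfin.union (Set.finite_range _)).subset hBt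
  have hBcard : B.ncard = n := by
    have := hB.lift_cardinalMk_eq (IsTranscendenceBasis.mvPolynomial (Fin n) K)
    simp only [Cardinal.mk_fin, Cardinal.lift_natCast] at this
    have h2 := congrArg Cardinal.toNat this
    rw [Cardinal.toNat_lift, Cardinal.toNat_natCast] at h2
    exact h2
  let J₀ : Finset (Fin n) := Finset.univ.filter fun j => X j ∈ B \ s
  have hXinj : Function.Injective (X : Fin n → MvPolynomial (Fin n) K) := X_injective
  have hJ₀ : B \ s = X '' (J₀ : Set (Fin n)) := by
    ext p
    constructor
    · intro hp
      rcases hBt hp.1 with h | ⟨j, rfl⟩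
      · exact absurd h hp.2
      · exact ⟨j, by simpa [J₀] using hp, rfl⟩
    · rintro ⟨j, hj, rfl⟩
      simpa [J₀] using hj
  -- The basis has `n` elements and `s` at most `r`, so at least `n - r` variables were added.
  -- Exactly `n - r` of them are set aside as `J`, so that the complement has size `r` even if `s`
  -- is smaller.
  have hJ₀card : n - r ≤ J₀.card := by
    have h1 : (B \ s).ncard = J₀.card := by
      rw [hJ₀, Set.ncard_image_of_injective _ hXinj, Set.ncard_coe_finset]
    have h2 := Set.ncard_sdiff_add_ncard_of_subset hsB hBfin
    omega
  obtain ⟨J, hJJ₀, hJcard⟩ := Finset.exists_subset_card_eq hJ₀card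
  have hXJ : X '' (J : Set (Fin n)) ⊆ B \ s := by
    rw [hJ₀]; exact Set.image_mono (by exact_mod_cast hJJ₀)
  let T : Set (MvPolynomial (Fin n) K) := B \ X '' (J : Set (Fin n))
  have hTfin : T.Finite := hBfin.subset Set.sdiff_subset
  have hTcard : T.ncard = r := by
    have h2 := Set.ncard_sdiff_add_ncard_of_subset (hXJ.trans Set.sdiff_subset) hBfin
    rw [Set.ncard_image_of_injective _ hXinj, Set.ncard_coe_finset, hBcard] at h2
    change T.ncard + _ = _ at h2
    omega
  have hIcard : Jᶜ.card = r := by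
    rw [Finset.card_compl, Fintype.card_fin]; omega
  have : Fintype T := hTfin.fintype
  have hcardeq : Fintype.card (Jᶜ : Finset (Fin n)) = Fintype.card T := by
    rw [Fintype.card_coe, hIcard, ← hTcard, ← Set.toFinset_card, Set.ncard_eq_toFinset_card']
  let e : (Jᶜ : Finset (Fin n)) ≃ T := Fintype.equivOfCardEq hcardeq
  let b : Fin n → MvPolynomial (Fin n) K := fun j => if h : j ∈ Jᶜ then (e ⟨j, h⟩ : T) else X j
  have hbI : ∀ j : (Jᶜ : Finset (Fin n)), b j = e j := fun j => by
    simp only [b, dif_pos j.2]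
  have hbJ : ∀ j ∉ Jᶜ, b j = X j := fun j hj => by simp only [b, dif_neg hj]
  have hbB : ∀ j, b j ∈ B := fun j => by
    by_cases h : j ∈ Jᶜ
    · rw [hbI ⟨j, h⟩]; exact (e ⟨j, h⟩).2.1
    · rw [hbJ j h]; exact (hXJ ⟨j, by simpa using h, rfl⟩).1
  refine ⟨Jᶜ, b, hIcard, ?_, ?_, hbJ, ?_⟩
  · refine hB.1.comp (fun j => ⟨b j, hbB j⟩) fun i j hij => ?_
    have hij' : b i = b j := congrArg Subtype.val hij
    by_cases hi : i ∈ Jᶜ <;> by_cases hj : j ∈ Jᶜ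
    · rw [hbI ⟨i, hi⟩, hbI ⟨j, hj⟩] at hij'
      exact congrArg Subtype.val (e.injective (Subtype.ext hij'))
    · rw [hbI ⟨i, hi⟩, hbJ j hj] at hij'
      exact absurd ⟨j, by simpa using hj, hij'.symm⟩ (e ⟨i, hi⟩).2.2
    · rw [hbI ⟨j, hj⟩, hbJ i hi] at hij'
      exact absurd ⟨i, by simpa using hi, hij'⟩ (e ⟨j, hj⟩).2.2
    · rw [hbJ i hi, hbJ j hj] at hij'
      exact hXinj hij'
  · intro j
    rcases hBt (hbB j) with h | ⟨t, ht⟩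
    · obtain ⟨i, hi⟩ := hsf h
      rw [← hi]; exact hf i
    · rw [← ht]; simpa using hδ
  · intro i
    refine (hsa (f i) ⟨i, rfl⟩).adjoin_of_forall_isAlgebraic fun x hx => ?_
    have hxT : x ∈ T := ⟨hsB hx.1, fun h => (hXJ h).2 hx.1⟩
    have hmem : x ∈ Set.range fun j : (Jᶜ : Finset (Fin n)) => b j :=
      ⟨e.symm ⟨x, hxT⟩, by simp only [hbI, Equiv.apply_symm_apply]⟩
    exact isAlgebraic_algebraMap (⟨x, Algebra.subset_adjoin hmem⟩ :
      Algebra.adjoin K (Set.range fun j : (Jᶜ : Finset (Fin n)) => b j))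

end Faithful

/-! ### Small non-divisors, uniqueness of digits and counting of monomials -/

section NonDivisor

/-- Every prime power in the factorization of `m.centralBinom` is at most `2 * m`, hence divides
`M`. -/
theorem Nat.centralBinom_dvd_of_forall_dvd {m M : ℕ} (hm : 0 < m) (hM : M ≠ 0)
    (h : ∀ p, 1 ≤ p → p ≤ 2 * m → p ∣ M) : m.centralBinom ∣ M := by
  rw [← Nat.factorization_prime_le_iff_dvd m.centralBinom_ne_zero hM]
  intro p hp
  rw [← hp.pow_dvd_iff_le_factorization hM]
  exact h _ (Nat.pos_of_ne_zero (pow_ne_zero _ hp.ne_zero))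
    (Nat.pow_factorization_choose_le (by omega))

/-- Chebyshev's argument: otherwise `k.centralBinom` divides `M`, but it is at least `4 ^ k / (2 *
k)`, which is at least `2 ^ k`. -/
theorem Nat.exists_not_dvd_of_lt_two_pow {M k : ℕ} (hk : 0 < k) (hM : M ≠ 0) (hMk : M < 2 ^ k) :
    ∃ p, 1 ≤ p ∧ p ≤ 2 * k ∧ ¬ p ∣ M := by
  by_contra! h
  have h1 := Nat.le_of_dvd (Nat.pos_of_ne_zero hM) (Nat.centralBinom_dvd_of_forall_dvd hk hM h)
  have h2 := Nat.four_pow_le_two_mul_self_mul_centralBinom k hk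
  have h3 : 2 * k ≤ 2 ^ k := by
    obtain ⟨j, rfl⟩ := Nat.exists_eq_add_of_lt hk
    have := Nat.lt_two_pow_self (n := j)
    rw [zero_add, pow_succ]; omega
  have h4 : (4 : ℕ) ^ k = 2 ^ k * 2 ^ k := by rw [← mul_pow]; norm_num
  have h5 : 2 * k * k.centralBinom ≤ 2 ^ k * M := Nat.mul_le_mul h3 h1
  have h6 : 2 ^ k * M < 2 ^ k * 2 ^ k := Nat.mul_lt_mul_of_pos_left hMk (by positivity)
  omega

theorem Finset.exists_forall_not_dvd {T : Finset ℕ} {a c : ℕ} (hT : ∀ t ∈ T, t ≠ 0 ∧ t < 2 ^ a)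
    (hc : T.card ≤ c) : ∃ p, 1 ≤ p ∧ p ≤ 2 * (a * c + 1) ∧ ∀ t ∈ T, ¬ p ∣ t := by
  have h1 : ∏ t ∈ T, t ≤ 2 ^ (a * c) := by
    calc ∏ t ∈ T, t ≤ ∏ _t ∈ T, 2 ^ a := Finset.prod_le_prod' fun t ht => (hT t ht).2.le
      _ = 2 ^ (a * T.card) := by rw [Finset.prod_const, ← pow_mul]
      _ ≤ 2 ^ (a * c) := Nat.pow_le_pow_right (by norm_num) (Nat.mul_le_mul_left _ hc)
  obtain ⟨p, hp1, hp2, hp⟩ := Nat.exists_not_dvd_of_lt_two_pow (M := ∏ t ∈ T, t)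
    (k := a * c + 1) (by omega) (Finset.prod_ne_zero_iff.mpr fun t ht => (hT t ht).1)
    (lt_of_le_of_lt h1 (Nat.pow_lt_pow_right (by norm_num) (by omega)))
  exact ⟨p, hp1, hp2, fun t ht hd => hp (hd.trans (Finset.dvd_prod_of_mem _ ht))⟩

/-- At the differing index with the least `ρ`, comparing the sums modulo `D ^ (ρ i + 1)` shows that
`D` divides `a i - b i`, whose absolute value is less than `D`. -/
theorem Finset.eq_of_sum_mul_pow_eq {ι : Type*} [DecidableEq ι] {s : Finset ι} {ρ a b : ι → ℕ}
    {D : ℕ} (hρ : Set.InjOn ρ s) (ha : ∀ i ∈ s, a i < D) (hb : ∀ i ∈ s, b i < D)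
    (h : ∑ i ∈ s, a i * D ^ ρ i = ∑ i ∈ s, b i * D ^ ρ i) : ∀ i ∈ s, a i = b i := by
  by_contra! hcon
  obtain ⟨i₀, hi₀, hne₀⟩ := hcon
  obtain ⟨i, hi, hmin⟩ := Finset.exists_min_image (s.filter fun i => a i ≠ b i) ρ
    ⟨i₀, by simp [hi₀, hne₀]⟩
  rw [Finset.mem_filter] at hi
  obtain ⟨his, hne⟩ := hi
  have hD : 0 < D := lt_of_le_of_lt (Nat.zero_le _) (ha i his)
  have h1 : ∑ j ∈ s, ((a j : ℤ) - b j) * (D : ℤ) ^ ρ j = 0 := by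
    simp only [sub_mul, Finset.sum_sub_distrib, sub_eq_zero]
    exact_mod_cast h
  rw [← Finset.add_sum_erase _ _ his] at h1
  have h2 : (D : ℤ) ^ (ρ i + 1) ∣ ∑ j ∈ s.erase i, ((a j : ℤ) - b j) * (D : ℤ) ^ ρ j := by
    refine Finset.dvd_sum fun j hj => ?_
    rw [Finset.mem_erase] at hj
    by_cases hab : a j = b j
    · simp [hab]
    · have h3 := hmin j (Finset.mem_filter.mpr ⟨hj.2, hab⟩)
      have h4 : ρ i ≠ ρ j := fun h => hj.1 (hρ hj.2 his h.symm)
      exact Dvd.dvd.mul_left (pow_dvd_pow _ (by omega)) _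
  have h5 : (D : ℤ) ^ (ρ i + 1) ∣ ((a i : ℤ) - b i) * (D : ℤ) ^ ρ i := by
    rw [eq_neg_of_add_eq_zero_left h1]
    exact (dvd_neg).mpr h2
  rw [pow_succ'] at h5
  have h6 : (D : ℤ) ∣ (a i : ℤ) - b i :=
    Int.dvd_of_mul_dvd_mul_right (by positivity) h5
  have h7 := Int.eq_zero_of_abs_lt_dvd h6 (by
    have := ha i his
    have := hb i his
    rw [abs_lt]; constructor <;> omega)
  omega

/-- An exponent vector of degree at most `k + 1` has degree at most `k`, or arises from such a
vector by raising one of the `n` entries by one. -/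
theorem card_finsupp_degree_le {n : ℕ} (k : ℕ) (s : Finset (Fin n →₀ ℕ))
    (hs : ∀ e ∈ s, e.degree ≤ k) : s.card ≤ (n + 1) ^ k := by
  classical
  induction k generalizing s with
  | zero =>
    rw [pow_zero, Finset.card_le_one]
    intro a ha b hb
    have h1 := hs a ha
    have h2 := hs b hb
    rw [Nat.le_zero, Finsupp.degree_eq_zero_iff] at h1 h2
    rw [h1, h2]
  | succ k ih =>
    let S₀ := s.filter fun e => e.degree ≤ k
    let S : Fin n → Finset (Fin n →₀ ℕ) := fun j =>
      (s.filter fun e => 1 ≤ e j).image fun e => e - Finsupp.single j 1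
    have hS₀ : S₀.card ≤ (n + 1) ^ k := ih S₀ fun e he => (Finset.mem_filter.mp he).2
    have hsub : ∀ j (e : Fin n →₀ ℕ), 1 ≤ e j → e - Finsupp.single j 1 + Finsupp.single j 1 = e :=
      fun j e he => tsub_add_cancel_of_le (by simpa using he)
    have hS : ∀ j, (S j).card ≤ (n + 1) ^ k := fun j => by
      refine ih _ fun e' he' => ?_
      obtain ⟨e, he, rfl⟩ := Finset.mem_image.mp he'
      rw [Finset.mem_filter] at he
      have h1 := congrArg Finsupp.degree (hsub j e he.2)
      have h2 := hs e he.1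
      rw [map_add, Finsupp.degree_single] at h1
      omega
    have hcov : s ⊆ S₀ ∪ Finset.univ.biUnion
        (fun j => (S j).image fun e => e + Finsupp.single j 1) := by
      intro e he
      by_cases h0 : e.degree ≤ k
      · exact Finset.mem_union_left _ (Finset.mem_filter.mpr ⟨he, h0⟩)
      · refine Finset.mem_union_right _ ?_
        have hne : e ≠ 0 := by rintro rfl; simp at h0
        obtain ⟨j, hj⟩ := Finsupp.ne_iff.mp hne
        have hj' : 1 ≤ e j := Nat.one_le_iff_ne_zero.mpr hj
        rw [Finset.mem_biUnion]
        refine ⟨j, Finset.mem_univ _, Finset.mem_image.mpr ⟨_, Finset.mem_image.mpr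
          ⟨e, Finset.mem_filter.mpr ⟨he, hj'⟩, rfl⟩, hsub j e hj'⟩⟩
    calc s.card ≤ _ := Finset.card_le_card hcov
      _ ≤ S₀.card + ∑ j, ((S j).image fun e => e + Finsupp.single j 1).card :=
        (Finset.card_union_le _ _).trans (Nat.add_le_add_left Finset.card_biUnion_le _)
      _ ≤ (n + 1) ^ k + ∑ _j : Fin n, (n + 1) ^ k :=
        Nat.add_le_add hS₀ (Finset.sum_le_sum fun j _ => Finset.card_image_le.trans (hS j))
      _ = (n + 1) ^ (k + 1) := by simp [pow_succ]; ring

/-- The left side is the bound of `Finset.exists_forall_not_dvd` for the at most `r * (n + 1) ^ δ ^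
r` differences of Kronecker exponents, each below `2 ^ (clog * (n + 1))`. -/
theorem two_mul_le_pMax {n r δ : ℕ} (hr : 1 ≤ r) (hrn : r ≤ n) (hδ : 1 ≤ δ) :
    2 * (Nat.clog 2 (paramD r δ) * (n + 1) * (r * (n + 1) ^ δ ^ r) + 1) ≤ pMax n r δ := by
  rw [pMax]
  set l := Nat.clog 2 (paramD r δ)
  set a := δ ^ r with ha
  have ha1 : 1 ≤ a := Nat.one_le_pow _ _ hδ
  have hl : 1 ≤ l := by
    have h2 : 2 ≤ paramD r δ := by
      have : 1 ≤ δ ^ (r + 1) := Nat.one_le_pow _ _ hδ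
      rw [paramD]; omega
    exact Nat.clog_pos (by norm_num) h2
  have haδ : a ≤ δ ^ (r + 1) := Nat.pow_le_pow_right hδ (by omega)
  set N := n + a
  have hN : 2 ≤ N := by omega
  have hNa : 1 ≤ N ^ (a + 3) := Nat.one_le_pow _ _ (by omega)
  have h1 : (n + 1) * (r * (n + 1) ^ a) ≤ N ^ (a + 2) := by
    have : (n + 1) * (r * (n + 1) ^ a) ≤ N * (N * N ^ a) := by gcongr <;> omega
    refine this.trans_eq (by ring)
  have h2 : 2 * N ^ (a + 2) ≤ N ^ (a + 3) := by
    rw [pow_succ N (a + 2), mul_comm]; exact Nat.mul_le_mul_left _ hN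
  have h3 : 2 * N ^ (a + 3) ≤ N ^ (a + 4) := by
    rw [pow_succ N (a + 3), mul_comm]; exact Nat.mul_le_mul_left _ hN
  have h4 : N ^ (a + 4) ≤ N ^ (8 * δ ^ (r + 1)) := Nat.pow_le_pow_right (by omega) (by omega)
  calc 2 * (l * (n + 1) * (r * (n + 1) ^ a) + 1)
      = l * (2 * ((n + 1) * (r * (n + 1) ^ a))) + 2 := by ring
    _ ≤ l * N ^ (a + 3) + 2 := by gcongr; omega
    _ ≤ l * (N ^ (a + 4)) + 1 := by
        have : l * N ^ (a + 3) + l * N ^ (a + 3) ≤ l * N ^ (a + 4) := by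
          rw [← mul_add, ← two_mul]; exact Nat.mul_le_mul_left _ h3
        have : 1 ≤ l * N ^ (a + 3) := Nat.mul_pos hl hNa
        omega
    _ ≤ N ^ (8 * δ ^ (r + 1)) * l ^ 2 + 1 := by
        have : l ≤ l ^ 2 := Nat.le_self_pow (by norm_num) l
        have : l * N ^ (a + 4) ≤ l ^ 2 * N ^ (8 * δ ^ (r + 1)) := by gcongr
        rw [mul_comm (N ^ _)]; omega

end NonDivisor

/-! ### Kronecker substitution with exponents reduced modulo `p` -/

section Kronecker

open MvPolynomial

theorem rankIn_injOn {n : ℕ} (I : Finset (Fin n)) : Set.InjOn (rankIn I) I := by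
  have key : ∀ i ∈ I, ∀ j ∈ I, i < j → rankIn I i < rankIn I j := by
    intro i hi j hj hij
    apply Finset.card_lt_card
    refine ⟨fun k hk => ?_, fun h => ?_⟩
    · rw [Finset.mem_filter] at hk ⊢
      exact ⟨hk.1, hk.2.trans hij⟩
    · exact lt_irrefl i (Finset.mem_filter.mp (h (Finset.mem_filter.mpr ⟨hi, hij⟩))).2
  intro i hi j hj hij
  rcases lt_trichotomy i j with h | h | h
  · exact absurd hij (key i hi j hj h).ne
  · exact h
  · exact absurd hij (key j hj i hi h).ne'

/-- The exponent of `t` in the image of the monomial with exponents `e` under `PhiMod`. -/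
def kroneckerExp {n : ℕ} (I : Finset (Fin n)) (D p : ℕ) (e : Fin n →₀ ℕ) : ℕ :=
  ∑ j ∈ Iᶜ, e j * (D ^ (rankIn Iᶜ j + 1) % p)

/-- The exponent of `z` in the image of the monomial with exponents `e` under `PhiMod`. -/
noncomputable def innerExp {n r : ℕ} (I : Finset (Fin n)) (hI : I.card = r) (e : Fin n →₀ ℕ) :
    Fin r →₀ ℕ :=
  ∑ j ∈ I.attach, Finsupp.single ⟨rankIn I j, rankIn_lt hI j.2⟩ (e j)

theorem innerExp_apply {n r : ℕ} {I : Finset (Fin n)} (hI : I.card = r) (e : Fin n →₀ ℕ)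
    {i : Fin n} (hi : i ∈ I) : innerExp I hI e ⟨rankIn I i, rankIn_lt hI hi⟩ = e i := by
  rw [innerExp, Finsupp.finsetSum_apply, Finset.sum_eq_single ⟨i, hi⟩]
  · simp
  · intro j _ hj
    rw [Finsupp.single_apply, if_neg]
    intro h
    exact hj (Subtype.ext (rankIn_injOn I j.2 hi (Fin.mk.inj_iff.mp h)))
  · simp

theorem PhiMod_monomial {L : Type u} [Field L] {n r : ℕ} (I : Finset (Fin n)) (hI : I.card = r)
    (D p : ℕ) (e : Fin n →₀ ℕ) (a : L) :
    PhiMod L I hI D p (monomial e a) =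
      Polynomial.monomial (kroneckerExp I D p e) (monomial (innerExp I hI e) a) := by
  rw [PhiMod, aeval_monomial, Finsupp.prod_fintype _ _ (by simp), ← Finset.prod_mul_prod_compl I]
  have h1 : ∏ j ∈ I, (if hj : j ∈ I then
      Polynomial.C (X ⟨rankIn I j, rankIn_lt hI hj⟩ : MvPolynomial (Fin r) L)
      else Polynomial.X ^ (D ^ (rankIn Iᶜ j + 1) % p)) ^ e j
      = Polynomial.C (monomial (innerExp I hI e) 1) := by
    rw [← Finset.prod_attach, innerExp, monomial_sum_one, map_prod]
    refine Finset.prod_congr rfl fun j _ => ?_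
    rw [dif_pos j.2, ← map_pow, X_pow_eq_monomial]
  have h2 : ∏ j ∈ Iᶜ, (if hj : j ∈ I then
      Polynomial.C (X ⟨rankIn I j, rankIn_lt hI hj⟩ : MvPolynomial (Fin r) L)
      else Polynomial.X ^ (D ^ (rankIn Iᶜ j + 1) % p)) ^ e j
      = Polynomial.X ^ kroneckerExp I D p e := by
    rw [kroneckerExp, ← Finset.prod_pow_eq_pow_sum]
    refine Finset.prod_congr rfl fun j hj => ?_
    rw [dif_neg (by simpa using hj), ← pow_mul, mul_comm]
  rw [h1, h2, ← mul_assoc, Polynomial.algebraMap_apply, algebraMap_eq, ← map_mul, C_mul_monomial,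
    mul_one, Polynomial.C_mul_X_pow_eq_monomial]

/-- No other monomial of `c` lands on the image of `e₀`. Equal images give equal `z` exponents and
Kronecker sums congruent modulo `p`. By the choice of `p` the sums are then equal, and uniqueness of
base `D` digits recovers the exponents outside `I`. -/
theorem PhiMod_ne_zero {L : Type u} [Field L] {n r : ℕ} {I : Finset (Fin n)} (hI : I.card = r)
    {D p : ℕ} {c : MvPolynomial (Fin n) L} (hdeg : c.totalDegree < D) {e₀ : Fin n →₀ ℕ}
    (he₀ : e₀ ∈ c.support)
    (hp : ∀ e ∈ c.support, ∀ t : ℕ,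
      t = ((∑ j ∈ Iᶜ, e j * D ^ (rankIn Iᶜ j + 1) : ℕ) -
        (∑ j ∈ Iᶜ, e₀ j * D ^ (rankIn Iᶜ j + 1) : ℕ) : ℤ).natAbs → t ≠ 0 → ¬ p ∣ t) :
    PhiMod L I hI D p c ≠ 0 := by
  classical
  intro h0
  have hlt : ∀ e ∈ c.support, ∀ j, e j < D := fun e he j =>
    lt_of_le_of_lt ((Finsupp.le_degree j e).trans (le_totalDegree he)) hdeg
  have key : ∀ e ∈ c.support, kroneckerExp I D p e = kroneckerExp I D p e₀ →
      innerExp I hI e = innerExp I hI e₀ → e = e₀ := by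
    intro e he hk hin
    have hmod : ∀ e : Fin n →₀ ℕ,
        kroneckerExp I D p e ≡ ∑ j ∈ Iᶜ, e j * D ^ (rankIn Iᶜ j + 1) [MOD p] := by
      intro e
      rw [kroneckerExp]
      exact Nat.ModEq.sum fun j _ => (Nat.mod_modEq _ _).mul_left _
    have h1 : (∑ j ∈ Iᶜ, e j * D ^ (rankIn Iᶜ j + 1)) ≡
        ∑ j ∈ Iᶜ, e₀ j * D ^ (rankIn Iᶜ j + 1) [MOD p] :=
      ((hmod e).symm.trans (by rw [hk])).trans (hmod e₀)
    have h2 : (∑ j ∈ Iᶜ, e j * D ^ (rankIn Iᶜ j + 1)) =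
        ∑ j ∈ Iᶜ, e₀ j * D ^ (rankIn Iᶜ j + 1) := by
      by_contra hne
      refine hp e he _ rfl ?_ ?_
      · rw [Int.natAbs_ne_zero, sub_ne_zero]
        exact_mod_cast hne
      · rw [← Int.natCast_dvd_natCast, Int.dvd_natAbs]
        exact (Nat.modEq_iff_dvd.mp h1.symm)
    have h3 := Finset.eq_of_sum_mul_pow_eq (s := Iᶜ) (ρ := fun j => rankIn Iᶜ j + 1)
      (fun i hi j hj hij => rankIn_injOn Iᶜ hi hj (by simpa using hij))
      (fun i _ => hlt e he i) (fun i _ => hlt e₀ he₀ i) h2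
    ext j
    by_cases hj : j ∈ I
    · rw [← innerExp_apply hI e hj, hin, innerExp_apply hI e₀ hj]
    · exact h3 j (by simpa using hj)
  have h1 := congrArg
    (fun q => coeff (innerExp I hI e₀) (q.coeff (kroneckerExp I D p e₀))) h0
  rw [c.as_sum, map_sum] at h1
  simp only [PhiMod_monomial, Polynomial.finsetSum_coeff, coeff_sum, Polynomial.coeff_monomial,
    Polynomial.coeff_zero, coeff_zero] at h1
  rw [Finset.sum_eq_single e₀] at h1
  · simp only [if_true, coeff_monomial] at h1
    exact mem_support_iff.mp he₀ h1
  · intro e he hne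
    split_ifs with hk
    · rw [coeff_monomial, if_neg]
      intro hin
      exact hne (key e he hk hin)
    · simp
  · intro h; exact absurd he₀ h

theorem natDegree_PhiMod_le {L : Type u} [Field L] {n r : ℕ} {I : Finset (Fin n)} (hI : I.card = r)
    {D p : ℕ} (hp : 1 ≤ p) (c : MvPolynomial (Fin n) L) :
    (PhiMod L I hI D p c).natDegree ≤ c.totalDegree * (p - 1) := by
  rw [c.as_sum, map_sum, ← c.as_sum]
  refine Polynomial.natDegree_sum_le_of_forall_le _ _ fun e he => ?_
  rw [PhiMod_monomial]
  refine (Polynomial.natDegree_monomial_le _).trans ?_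
  rw [kroneckerExp]
  calc ∑ j ∈ Iᶜ, e j * (D ^ (rankIn Iᶜ j + 1) % p) ≤ ∑ j ∈ Iᶜ, e j * (p - 1) :=
        Finset.sum_le_sum fun j _ => Nat.mul_le_mul_left _
          (Nat.le_sub_one_of_lt (Nat.mod_lt _ hp))
    _ = (∑ j ∈ Iᶜ, e j) * (p - 1) := (Finset.sum_mul _ _ _).symm
    _ ≤ e.degree * (p - 1) := by
        rw [Finsupp.degree_eq_sum]
        exact Nat.mul_le_mul_right _ (Finset.sum_le_sum_of_subset (Finset.subset_univ _))
    _ ≤ c.totalDegree * (p - 1) := Nat.mul_le_mul_right _ (le_totalDegree he)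

/-- Finitely many nonzero polynomials of small degree survive under `PhiMod` for a small modulus. -/
theorem exists_modulus {L : Type u} [Field L] {n r δ : ℕ} (hr : 1 ≤ r) (hrn : r ≤ n) (hδ : 1 ≤ δ)
    {I : Finset (Fin n)} (hI : I.card = r) {c : Fin n → MvPolynomial (Fin n) L}
    (hc : ∀ i, c i ≠ 0) (hdeg : ∀ i, (c i).totalDegree ≤ δ ^ r) :
    ∃ p, 1 ≤ p ∧ p ≤ pMax n r δ ∧ ∀ i ∈ I, PhiMod L I hI (paramD r δ) p (c i) ≠ 0 := by
  classical
  set D := paramD r δ with hD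
  have hδD : δ ^ r < D := by
    rw [hD, paramD]
    exact Nat.lt_succ_of_le (Nat.pow_le_pow_right hδ (by omega))
  have hex : ∀ i, ∃ e, e ∈ (c i).support := fun i => by
    have := support_nonempty.mpr (hc i)
    exact this
  choose e₀ he₀ using hex
  -- The Kronecker exponent before reduction modulo `p`.
  let κ : (Fin n →₀ ℕ) → ℕ := fun e => ∑ j ∈ Iᶜ, e j * D ^ (rankIn Iᶜ j + 1)
  have hκ : ∀ i, ∀ e ∈ (c i).support, κ e < D ^ (n + 1) := fun i e he => by
    calc κ e ≤ ∑ j ∈ Iᶜ, e j * D ^ n := by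
          refine Finset.sum_le_sum fun j hj => Nat.mul_le_mul_left _
            (Nat.pow_le_pow_right (by omega) ?_)
          have h1 := rankIn_lt (I := Iᶜ) rfl hj
          have h2 : (Iᶜ : Finset (Fin n)).card ≤ n := by simpa using Finset.card_le_univ (Iᶜ)
          omega
      _ = (∑ j ∈ Iᶜ, e j) * D ^ n := (Finset.sum_mul _ _ _).symm
      _ ≤ e.degree * D ^ n := by
          rw [Finsupp.degree_eq_sum]
          exact Nat.mul_le_mul_right _ (Finset.sum_le_sum_of_subset (Finset.subset_univ _))
      _ < D * D ^ n := by
          refine Nat.mul_lt_mul_of_pos_right ?_ (Nat.pow_pos (by omega))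
          exact lt_of_le_of_lt ((le_totalDegree he).trans (hdeg i)) hδD
      _ = D ^ (n + 1) := (pow_succ' _ _).symm
  -- Only differences from one fixed monomial of each `c i` with `i ∈ I` are needed, not all pairs
  -- of monomials.
  let T : Finset ℕ := (I.biUnion fun i => (c i).support.image fun e =>
    ((κ e : ℤ) - κ (e₀ i)).natAbs).erase 0
  have hT : ∀ t ∈ T, t ≠ 0 ∧ t < 2 ^ (Nat.clog 2 D * (n + 1)) := by
    intro t ht
    rw [Finset.mem_erase, Finset.mem_biUnion] at ht
    obtain ⟨h0, i, _, ht⟩ := ht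
    obtain ⟨e, he, rfl⟩ := Finset.mem_image.mp ht
    refine ⟨h0, ?_⟩
    have h1 := hκ i e he
    have h2 := hκ i _ (he₀ i)
    have h3 : D ^ (n + 1) ≤ 2 ^ (Nat.clog 2 D * (n + 1)) := by
      rw [pow_mul]
      exact Nat.pow_le_pow_left (Nat.le_pow_clog (by norm_num) D) _
    omega
  have hcard : T.card ≤ r * (n + 1) ^ δ ^ r := by
    refine (Finset.card_erase_le).trans ((Finset.card_biUnion_le_card_mul _ _ _ fun i _ => ?_).trans_eq
      (by rw [hI]))
    exact Finset.card_image_le.trans (card_finsupp_degree_le _ _ fun e he =>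
      (le_totalDegree he).trans (hdeg i))
  obtain ⟨p, hp1, hp2, hp⟩ := Finset.exists_forall_not_dvd hT hcard
  refine ⟨p, hp1, hp2.trans (two_mul_le_pMax hr hrn hδ), fun i hi => ?_⟩
  refine PhiMod_ne_zero hI (lt_of_le_of_lt (hdeg i) hδD) (he₀ i) fun e he t ht ht0 => ?_
  refine hp t (Finset.mem_erase.mpr ⟨ht0, Finset.mem_biUnion.mpr ⟨i, hi, ?_⟩⟩)
  exact Finset.mem_image.mpr ⟨e, he, ht.symm⟩

theorem exists_Phi_ne_zero {L : Type u} [Field L] {n r δ : ℕ} (hr : 1 ≤ r) (hrn : r ≤ n)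
    (hδ : 1 ≤ δ) {I : Finset (Fin n)} (hI : I.card = r) {c : Fin n → MvPolynomial (Fin n) L}
    (hc : ∀ i, c i ≠ 0) (hdeg : ∀ i, (c i).totalDegree ≤ δ ^ r) {H : Finset L}
    (hH : H.card = δ ^ r * r * pMax n r δ) :
    ∃ p, 1 ≤ p ∧ p ≤ pMax n r δ ∧ ∃ a ∈ H, ∀ i ∈ I, Phi L I hI (paramD r δ) p a (c i) ≠ 0 := by
  classical
  obtain ⟨p, hp1, hp2, hp⟩ := exists_modulus hr hrn hδ hI hc hdeg
  refine ⟨p, hp1, hp2, ?_⟩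
  let Q := ∏ i ∈ I, PhiMod L I hI (paramD r δ) p (c i)
  have hQ : Q ≠ 0 := Finset.prod_ne_zero_iff.mpr hp
  -- All `r` images must survive the same constant, so the roots of their product are counted. Its
  -- degree in `t` is at most `δ ^ r * r * (p - 1)`, and `p - 1 < pMax n r δ` makes this smaller
  -- than `H.card`.
  have hQdeg : Q.natDegree < (H.image (C : L → MvPolynomial (Fin r) L)).card := by
    rw [Finset.card_image_of_injective _ (C_injective _ _), hH]
    calc Q.natDegree ≤ ∑ i ∈ I, (PhiMod L I hI (paramD r δ) p (c i)).natDegree :=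
          Polynomial.natDegree_prod_le _ _
      _ ≤ ∑ _i ∈ I, δ ^ r * (p - 1) := Finset.sum_le_sum fun i _ =>
          (natDegree_PhiMod_le hI hp1 _).trans (Nat.mul_le_mul_right _ (hdeg i))
      _ = δ ^ r * r * (p - 1) := by rw [Finset.sum_const, hI, smul_eq_mul]; ring
      _ < δ ^ r * r * pMax n r δ := by
          refine Nat.mul_lt_mul_of_pos_left (by omega) ?_
          exact Nat.mul_pos (Nat.pow_pos (by omega)) (by omega)
  by_contra! hcon
  refine hQ (Polynomial.eq_zero_of_natDegree_lt_card_of_eval_eq_zero' Q _ ?_ hQdeg)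
  intro x hx
  obtain ⟨a, ha, rfl⟩ := Finset.mem_image.mp hx
  obtain ⟨i, hi, h0⟩ := hcon a ha
  rw [Polynomial.eval_prod]
  refine Finset.prod_eq_zero hi ?_
  rw [← h0, Phi]
  rfl

end Kronecker

/-! ### The hitting property -/

section HittingSet

open MvPolynomial

/-- The only property of circuits that the hitting property needs. A reference to a missing gate
reads the default `0`, which is also in the subalgebra. -/
theorem ArithCircuit.eval_mem_adjoin {K : Type u} [Field K] {m : ℕ} {R : Type u} [CommRing R]
    [Algebra K R] (C : ArithCircuit K m) (x : Fin m → R) :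
    C.eval x ∈ Algebra.adjoin K (Set.range x) := by
  have hgetD : ∀ (l : List R), (∀ y ∈ l, y ∈ Algebra.adjoin K (Set.range x)) → ∀ i,
      l.getD i 0 ∈ Algebra.adjoin K (Set.range x) := by
    intro l hl i
    rw [List.getD_eq_getElem?_getD]
    rcases h : l[i]? with _ | y
    · exact zero_mem _
    · exact hl y (List.mem_of_getElem? h)
  have hfold : ∀ (gs : List (Gate K m)) (l : List R),
      (∀ y ∈ l, y ∈ Algebra.adjoin K (Set.range x)) →
      ∀ y ∈ gs.foldl (fun prev g => prev ++ [g.val x prev]) l,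
        y ∈ Algebra.adjoin K (Set.range x) := by
    intro gs
    induction gs with
    | nil => exact fun l hl => hl
    | cons g gs ih =>
      intro l hl
      refine ih _ fun y hy => ?_
      rcases List.mem_append.mp hy with h | h
      · exact hl y h
      · rw [List.mem_singleton] at h
        subst h
        cases g with
        | input i => exact Algebra.subset_adjoin ⟨i, rfl⟩
        | const a => exact Subalgebra.algebraMap_mem _ a
        | add i j => exact add_mem (hgetD l hl i) (hgetD l hl j)
        | mul i j => exact mul_mem (hgetD l hl i) (hgetD l hl j)
  rw [ArithCircuit.eval, List.getLastD_eq_getLast?]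
  rcases h : (List.foldl (fun prev g => prev ++ [Gate.val x prev g]) [] C).getLast? with _ | y
  · exact zero_mem _
  · exact hfold C [] (by simp) y (List.mem_of_getLast? h)

theorem Phi_X_of_mem {L : Type u} [Field L] {n r : ℕ} {I : Finset (Fin n)} (hI : I.card = r)
    (D p : ℕ) (c : L) {j : Fin n} (hj : j ∈ I) :
    Phi L I hI D p c (X j) = X ⟨rankIn I j, rankIn_lt hI hj⟩ := by
  simp [Phi, PhiMod, hj]

theorem Phi_X_of_notMem {L : Type u} [Field L] {n r : ℕ} {I : Finset (Fin n)} (hI : I.card = r)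
    (D p : ℕ) (c : L) {j : Fin n} (hj : j ∉ I) :
    Phi L I hI D p c (X j) = C (c ^ (D ^ (rankIn Iᶜ j + 1) % p)) := by
  simp [Phi, PhiMod, hj]

theorem totalDegree_Phi_le {L : Type u} [Field L] {n r : ℕ} {I : Finset (Fin n)} (hI : I.card = r)
    (D p : ℕ) (c : L) (q : MvPolynomial (Fin n) L) :
    (Phi L I hI D p c q).totalDegree ≤ q.totalDegree := by
  have h1 : Phi L I hI D p c = aeval fun j => Phi L I hI D p c (X j) := by
    ext j : 1; simp
  rw [h1]
  refine totalDegree_aeval_le (w := fun _ => 1) (fun j => ?_) fun m hm => ?_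
  · by_cases hj : j ∈ I
    · rw [Phi_X_of_mem hI D p c hj, totalDegree_X]
    · rw [Phi_X_of_notMem hI D p c hj, totalDegree_C]; exact Nat.zero_le _
  · simp only [one_mul]
    rw [← Finsupp.degree_eq_sum]
    exact le_totalDegree hm

theorem isHittingSet_hittingSet (K : Type u) [Field K] {n d r δ : ℕ} (hr : 1 ≤ r) (hrn : r ≤ n)
    (hδ : 1 ≤ δ) {H₁ H₂ : Finset (AlgebraicClosure K)}
    (hH₁ : H₁.card = δ ^ r * r * pMax n r δ) (hH₂ : H₂.card = d + 1) :
    IsHittingSet (hittingSet n r δ H₁ H₂) (circuitClass K n d r δ) := by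
  classical
  rintro g ⟨m, Γ, S, hS, htr, hg, hgd⟩ hg0
  let L := AlgebraicClosure K
  obtain ⟨I, b, hI, hb, hbdeg, hbX, halg⟩ := exists_algebraicIndependent_extension hδ hrn hS htr
  choose c hc0 hcdeg hc using exists_certificate.{u} hδ hb hbdeg I hbX
  rw [hI] at hcdeg
  have hinj : Function.Injective (algebraMap K L) := (algebraMap K L).injective
  obtain ⟨p, hp1, hp2, a, ha, hΦ⟩ := exists_Phi_ne_zero (L := L) hr hrn hδ hI
    (c := fun i => map (algebraMap K L) (c i))
    (fun i h => hc0 i (map_injective _ hinj (by simpa using h)))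
    (fun i => (totalDegree_map_le _ _).trans (hcdeg i)) hH₁
  let φ : MvPolynomial (Fin n) K →ₐ[K] MvPolynomial (Fin r) L :=
    ((Phi L I hI (paramD r δ) p a).restrictScalars K).comp (mapAlgHom (Algebra.ofId K L))
  have hφ : ∀ q, φ q = Phi L I hI (paramD r δ) p a (map (algebraMap K L) q) := fun q => rfl
  have hφX : ∀ j, φ (X j) = Phi L I hI (paramD r δ) p a (X j) := fun j => by rw [hφ, map_X]
  -- The certificates survive, so each variable `X t = φ (X i)` with `i ∈ I` is algebraic over `L[φ
  -- (b j)]`. This gives independence over `L`, which implies independence over `K`.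
  have hφb : AlgebraicIndependent K fun j : I => φ (b j) := by
    have h1 : AlgebraicIndependent L fun j : I => φ (b j) := by
      refine algebraicIndependent_of_isAlgebraic_X (by rw [Fintype.card_coe, hI]) _ fun t => ?_
      obtain ⟨i, hi, hit⟩ : ∃ i, ∃ hi : i ∈ I, (⟨rankIn I i, rankIn_lt hI hi⟩ : Fin r) = t := by
        let ρ : I → Fin r := fun i => ⟨rankIn I i, rankIn_lt hI i.2⟩
        have hρ : Function.Injective ρ := fun i j hij =>
          Subtype.ext (rankIn_injOn I i.2 j.2 (Fin.mk.inj_iff.mp hij))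
        have hbij := (Fintype.bijective_iff_injective_and_card ρ).mpr ⟨hρ, by simp [hI]⟩
        obtain ⟨i, hi⟩ := hbij.2 t
        exact ⟨i, i.2, hi⟩
      have h2 := hc i L (MvPolynomial (Fin r) L) φ
        (fun j hj => ⟨_, (hφX j).trans (Phi_X_of_notMem hI _ p a hj)⟩) (hΦ i hi)
      rwa [hφX, Phi_X_of_mem hI _ p a hi, hit] at h2
    exact h1.restrictScalars hinj
  have hφg : φ g ≠ 0 := by
    refine map_ne_zero_of_isAlgebraic_adjoin (b := fun j : I => b j) φ hφb hg0 ?_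
    have h1 := Γ.eval_mem_adjoin (K := K) fun i => (S i).poly
    rw [← hg] at h1
    -- The elements algebraic over `K[b j : j ∈ I]` form a subalgebra, so it suffices that each
    -- input polynomial belongs to it.
    have h2 : Algebra.adjoin K (Set.range fun i => (S i).poly) ≤
        (Subalgebra.algebraicClosure (Algebra.adjoin K (Set.range fun j : I => b j))
          (MvPolynomial (Fin n) K)).restrictScalars K := by
      refine Algebra.adjoin_le ?_
      rintro _ ⟨i, rfl⟩
      exact halg i
    exact h2 h1
  -- The degree of `φ g` in each variable is at most `d`, less than the size of `H₂`, so it cannot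
  -- vanish on the whole grid.
  obtain ⟨z, hz, hne⟩ : ∃ z : Fin r → L, (∀ i, z i ∈ H₂) ∧ eval z (φ g) ≠ 0 := by
    by_contra! hcon
    refine hφg (eq_zero_of_eval_zero_at_prod_finset (φ g) (fun _ => H₂) (fun i => ?_) hcon)
    rw [hH₂, Nat.lt_succ_iff]
    refine (degreeOf_le_totalDegree _ _).trans (le_trans ?_ hgd)
    exact (totalDegree_Phi_le hI _ p a _).trans (totalDegree_map_le _ _)
  refine ⟨_, ⟨I, hI, p, a, z, hp1, hp2, ha, hz, rfl⟩, ?_⟩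
  have h3 : aeval (fun j => eval z (Phi L I hI (paramD r δ) p a (X j))) g = eval z (φ g) := by
    have : aeval (fun j => eval z (Phi L I hI (paramD r δ) p a (X j))) =
        ((aeval z : MvPolynomial (Fin r) L →ₐ[L] L).restrictScalars K).comp φ := by
      ext j
      rw [aeval_X, AlgHom.comp_apply, hφX, AlgHom.restrictScalars_apply, ← coe_aeval_eq_eval]
      rfl
    rw [this, AlgHom.comp_apply, AlgHom.restrictScalars_apply, ← coe_aeval_eq_eval]
    rfl
  rw [h3]
  exact hne

end HittingSet

/-! ### Running times of programs and arithmetic subroutines -/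

section Machine

variable {L : Type u} [Field L]

/-- The program `P`, started in `s`, halts in `s'` after at most `T` steps. -/
def ExecLE (P : Prog) (s : RamState L) (T : ℕ) (s' : RamState L) : Prop :=
  ∃ t ≤ T, Exec P s t s'

theorem ExecLE.mono {P : Prog} {s s' : RamState L} {T T' : ℕ} (h : ExecLE P s T s') (hT : T ≤ T') :
    ExecLE P s T' s' :=
  let ⟨t, ht, h⟩ := h
  ⟨t, ht.trans hT, h⟩

theorem ExecLE.seq {P Q : Prog} {s s' s'' : RamState L} {T T' : ℕ} (h : ExecLE P s T s')
    (h' : ExecLE Q s' T' s'') : ExecLE (.seq P Q) s (T + T') s'' :=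
  let ⟨t, ht, h⟩ := h
  let ⟨t', ht', h'⟩ := h'
  ⟨t + t', Nat.add_le_add ht ht', .seq h h'⟩

theorem ExecLE.ifLt_pos {x y : ℕ} {P Q : Prog} {s s' : RamState L} {T : ℕ}
    (hxy : s.reg x < s.reg y) (h : ExecLE P s T s') : ExecLE (.ifLt x y P Q) s (T + 1) s' :=
  let ⟨t, ht, h⟩ := h
  ⟨t + 1, Nat.succ_le_succ ht, .ifLt_pos hxy h⟩

theorem ExecLE.ifLt_neg {x y : ℕ} {P Q : Prog} {s s' : RamState L} {T : ℕ}
    (hxy : ¬ s.reg x < s.reg y) (h : ExecLE Q s T s') : ExecLE (.ifLt x y P Q) s (T + 1) s' :=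
  let ⟨t, ht, h⟩ := h
  ⟨t + 1, Nat.succ_le_succ ht, .ifLt_neg hxy h⟩

theorem ExecLE.while_done {x y : ℕ} {P : Prog} {s : RamState L} (h : ¬ s.reg x < s.reg y) :
    ExecLE (.whileLt x y P) s 1 s :=
  ⟨1, le_rfl, .while_done h⟩

theorem ExecLE.while_step {x y : ℕ} {P : Prog} {s s' s'' : RamState L} {T T' : ℕ}
    (hxy : s.reg x < s.reg y) (h : ExecLE P s T s') (h' : ExecLE (.whileLt x y P) s' T' s'') :
    ExecLE (.whileLt x y P) s (T + T' + 1) s'' :=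
  let ⟨t, ht, h⟩ := h
  let ⟨t', ht', h'⟩ := h'
  ⟨t + t' + 1, by omega, .while_step hxy h h'⟩

/-- `S k` is the complete state after `k` rounds, so `S` serves as the loop invariant; the induction
is on the number of rounds left. -/
theorem ExecLE.whileLt {x y : ℕ} {P : Prog} (S : ℕ → RamState L) (N T : ℕ)
    (hlt : ∀ k < N, (S k).reg x < (S k).reg y) (hN : ¬ (S N).reg x < (S N).reg y)
    (hP : ∀ k < N, ExecLE P (S k) T (S (k + 1))) :
    ExecLE (.whileLt x y P) (S 0) (N * (T + 1) + 1) (S N) := by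
  have key : ∀ m ≤ N, ExecLE (.whileLt x y P) (S (N - m)) (m * (T + 1) + 1) (S N) := by
    intro m
    induction m with
    | zero => exact fun _ => (ExecLE.while_done hN).mono (by omega)
    | succ m ih =>
      intro hm
      have h1 := hP (N - (m + 1)) (by omega)
      have h2 : N - (m + 1) + 1 = N - m := by omega
      rw [h2] at h1
      exact (ExecLE.while_step (hlt _ (by omega)) h1 (ih (by omega))).mono (by
        rw [Nat.succ_mul]; omega)
  simpa using key N le_rfl

/-- A sequence of instructions, ended by a test that does nothing. -/
def Prog.block : List Instr → Prog
  | [] => .whileLt 0 0 (.instr (.set 0 0))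
  | i :: is => .seq (.instr i) (Prog.block is)

/-- The contents of the registers that start with the list `l` and are zero after it. -/
def regs {α : Type*} [Zero α] (l : List α) : ℕ → α := fun k => l.getD k 0

/-- The list `l`, padded by zeros if necessary, with `v` at position `i`. -/
def upd {α : Type*} [Zero α] : List α → ℕ → α → List α
  | [], 0, v => [v]
  | [], i + 1, v => 0 :: upd [] i v
  | _ :: l, 0, v => v :: l
  | a :: l, i + 1, v => a :: upd l i v

theorem update_regs {α : Type*} [Zero α] (l : List α) (i : ℕ) (v : α) :
    Function.update (regs l) i v = regs (upd l i v) := by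
  induction i generalizing l with
  | zero =>
    cases l <;> (funext k; cases k <;> simp [regs, upd])
  | succ i ih =>
    cases l with
    | nil =>
      funext k
      cases k with
      | zero => simp [regs, upd]
      | succ k =>
        have := congrFun (ih []) k
        simp only [Function.update_apply, regs, upd, List.getD_cons_succ, Nat.succ_inj] at this ⊢
        rw [← this]
        rfl
    | cons a l =>
      funext k
      cases k with
      | zero => simp [regs, upd]
      | succ k =>
        have := congrFun (ih l) k
        simp only [Function.update_apply, regs, upd, List.getD_cons_succ, Nat.succ_inj] at this ⊢
        exact this

/-- The state with integer registers `l`, field registers `f`, field memory `fm` and output `o`. -/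
def St (fm : ℕ → L) (l : List ℕ) (f o : List L) : RamState L where
  reg := regs l
  mem := fun _ => 0
  freg := regs f
  fmem := fm
  out := o

/-- The contents of the integer registers after an instruction that does not access the memory. -/
def Instr.onRegs : Instr → List ℕ → List ℕ
  | .set x k, l => upd l x k
  | .add x y z, l => upd l x (regs l y + regs l z)
  | .sub x y z, l => upd l x (regs l y - regs l z)
  | _, l => l

/-- The contents of the field registers after an instruction. -/
def Instr.onFregs (fm : ℕ → L) (l : List ℕ) : Instr → List L → List L
  | .fzero v, f => upd f v 0
  | .fone v, f => upd f v 1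
  | .fmul v w w', f => upd f v (regs f w * regs f w')
  | .fload v x, f => upd f v (fm (regs l x))
  | _, f => f

/-- The output after an instruction. -/
def Instr.onOut (f : List L) : Instr → List L → List L
  | .print v, o => o ++ [regs f v]
  | _, o => o

/-- The instructions that the programs below use. -/
def Instr.simple : Instr → Bool
  | .set _ _ | .add _ _ _ | .sub _ _ _ | .fzero _ | .fone _ | .fmul _ _ _ | .fload _ _
  | .print _ => true
  | _ => false

theorem Instr.apply_St (fm : ℕ → L) (l : List ℕ) (f o : List L) (i : Instr)
    (hi : i.simple = true) :
    i.apply (St fm l f o) = St fm (i.onRegs l) (i.onFregs fm l f) (i.onOut f o) := by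
  cases i <;> first
    | exact absurd hi Bool.false_ne_true
    | simp [Instr.apply, St, Instr.onRegs, Instr.onFregs, Instr.onOut, update_regs]

/-- The contents of the registers and the output after a sequence of instructions. -/
def runBlock (fm : ℕ → L) : List Instr → List ℕ → List L → List L → List ℕ × List L × List L
  | [], l, f, o => (l, f, o)
  | i :: is, l, f, o => runBlock fm is (i.onRegs l) (i.onFregs fm l f) (i.onOut f o)

/-- Symbolic execution: on explicit register lists `runBlock` reduces by computation, so the
resulting state of a block is checked by definitional unfolding. -/
theorem ExecLE.block (fm : ℕ → L) (is : List Instr) (l : List ℕ) (f o : List L)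
    (his : is.all Instr.simple = true) :
    ExecLE (Prog.block is) (St fm l f o) (is.length + 1)
      (St fm (runBlock fm is l f o).1 (runBlock fm is l f o).2.1 (runBlock fm is l f o).2.2) := by
  induction is generalizing l f o with
  | nil => exact ExecLE.while_done (lt_irrefl _)
  | cons i is ih =>
    rw [List.all_cons, Bool.and_eq_true] at his
    have h1 : ExecLE (.instr i) (St fm l f o) 1 (i.apply (St fm l f o)) := ⟨1, le_rfl, .instr i _⟩
    rw [Instr.apply_St fm l f o i his.1] at h1
    exact (h1.seq (ih _ _ _ his.2)).mono (by simp only [List.length_cons]; omega)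

/-! ### Arithmetic subroutines

Register 4 holds `0`, register 5 holds `1`. The arguments are in registers 6 and 7, the result is in
register 8. -/

/-- Multiplication. -/
def mulProg : Prog :=
  .seq (.block [.set 8 0, .set 9 0]) <|
  .seq (.whileLt 9 6 (.block [.add 8 8 7, .add 9 9 5])) (.block [.set 9 0])

/-- Repeated addition: the cost is linear in the value of the factor in register 6 and does not
depend on the other one. -/
theorem exec_mulProg (fm : ℕ → L) (f o : List L) (x₀ x₁ x₂ x₃ A B C E : ℕ) (l : List ℕ) :
    ExecLE mulProg (St fm (x₀ :: x₁ :: x₂ :: x₃ :: 0 :: 1 :: A :: B :: C :: E :: l) f o)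
      (4 * A + 6)
      (St fm (x₀ :: x₁ :: x₂ :: x₃ :: 0 :: 1 :: A :: B :: A * B :: 0 :: l) f o) := by
  have h1 := ExecLE.block fm [.set 8 0, .set 9 0]
    (x₀ :: x₁ :: x₂ :: x₃ :: 0 :: 1 :: A :: B :: C :: E :: l) f o rfl
  have h2 := ExecLE.whileLt (x := 9) (y := 6) (P := .block [.add 8 8 7, .add 9 9 5])
    (fun k => St fm (x₀ :: x₁ :: x₂ :: x₃ :: 0 :: 1 :: A :: B :: k * B :: k :: l) f o) A 3
    (fun k hk => hk) (lt_irrefl A) (fun k _ => by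
      have h := ExecLE.block fm [.add 8 8 7, .add 9 9 5]
        (x₀ :: x₁ :: x₂ :: x₃ :: 0 :: 1 :: A :: B :: k * B :: k :: l) f o rfl
      rw [Nat.succ_mul]
      exact h)
  have h3 := ExecLE.block fm [.set 9 0]
    (x₀ :: x₁ :: x₂ :: x₃ :: 0 :: 1 :: A :: B :: A * B :: A :: l) f o rfl
  rw [Nat.zero_mul] at h2
  exact (h1.seq (h2.seq h3)).mono (by simp only [List.length_cons, List.length_nil]; omega)

/-- Division with remainder. The remainder is in register 9. -/
def divProg : Prog :=
  .seq (.block [.set 8 0, .add 9 6 5]) <|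
  .seq (.whileLt 7 9 (.block [.add 8 8 5, .sub 9 9 7])) (.block [.sub 9 9 5])

theorem exec_divProg (fm : ℕ → L) (f o : List L) (x₀ x₁ x₂ x₃ A B C E : ℕ) (l : List ℕ)
    (hB : 0 < B) :
    ExecLE divProg (St fm (x₀ :: x₁ :: x₂ :: x₃ :: 0 :: 1 :: A :: B :: C :: E :: l) f o)
      (4 * A + 6)
      (St fm (x₀ :: x₁ :: x₂ :: x₃ :: 0 :: 1 :: A :: B :: A / B :: A % B :: l) f o) := by
  have h1 := ExecLE.block fm [.set 8 0, .add 9 6 5]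
    (x₀ :: x₁ :: x₂ :: x₃ :: 0 :: 1 :: A :: B :: C :: E :: l) f o rfl
  have hle : ∀ k, (k + 1) * B ≤ A ↔ k < A / B := fun k => (Nat.le_div_iff_mul_le hB).symm
  -- Register 9 is kept one above the current remainder, so that the strict test `B < A + 1 - k * B`
  -- decides whether another `B` can be subtracted.
  have h2 := ExecLE.whileLt (x := 7) (y := 9) (P := .block [.add 8 8 5, .sub 9 9 7])
    (fun k => St fm
      (x₀ :: x₁ :: x₂ :: x₃ :: 0 :: 1 :: A :: B :: k :: (A + 1 - k * B) :: l) f o) (A / B) 3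
    (fun k hk => by
      have := (hle k).mpr hk
      rw [Nat.succ_mul] at this
      change B < A + 1 - k * B
      omega)
    (by
      have : ¬ (A / B + 1) * B ≤ A := by rw [hle]; exact lt_irrefl _
      rw [Nat.succ_mul] at this
      change ¬ B < A + 1 - A / B * B
      omega)
    (fun k _ => by
      have h := ExecLE.block fm [.add 8 8 5, .sub 9 9 7]
        (x₀ :: x₁ :: x₂ :: x₃ :: 0 :: 1 :: A :: B :: k :: (A + 1 - k * B) :: l) f o rfl
      rw [Nat.succ_mul, ← Nat.sub_sub]
      exact h)
  have h3 := ExecLE.block fm [.sub 9 9 5]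
    (x₀ :: x₁ :: x₂ :: x₃ :: 0 :: 1 :: A :: B :: A / B :: (A + 1 - A / B * B) :: l) f o rfl
  rw [Nat.zero_mul] at h2
  have h4 : A + 1 - A / B * B - 1 = A % B := by
    have := Nat.div_add_mod' A B
    omega
  have h5 := h1.seq (h2.seq h3)
  change ExecLE _ _ _ (St fm (x₀ :: x₁ :: x₂ :: x₃ :: 0 :: 1 :: A :: B :: A / B ::
    (A + 1 - A / B * B - 1) :: l) f o) at h5
  rw [h4] at h5
  have h6 : A / B ≤ A := Nat.div_le_self A B
  exact h5.mono (by simp only [List.length_cons, List.length_nil]; omega)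

/-- Exponentiation, from registers 10 (base) and 11 (exponent) to register 12. -/
def powProg : Prog :=
  .seq (.block [.set 12 1, .set 13 0]) <|
  .seq (.whileLt 13 11 <|
    .seq (.block [.add 6 12 4, .add 7 10 4]) <|
    .seq mulProg (.block [.add 12 8 4, .add 13 13 5, .set 6 0, .set 7 0, .set 8 0]))
  (.block [.set 13 0])

theorem exec_powProg (fm : ℕ → L) (f o : List L) (x₀ x₁ x₂ x₃ E F G H W : ℕ) (l : List ℕ)
    (hE : 0 < E) (hW : E ^ F ≤ W) :
    ExecLE powProg (St fm (x₀ :: x₁ :: x₂ :: x₃ :: 0 :: 1 :: 0 :: 0 :: 0 :: 0 :: E :: F :: G :: H :: l) f o)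
      (F * (4 * W + 16) + 6)
      (St fm (x₀ :: x₁ :: x₂ :: x₃ :: 0 :: 1 :: 0 :: 0 :: 0 :: 0 :: E :: F :: E ^ F :: 0 :: l)
        f o) := by
  have h1 := ExecLE.block fm [.set 12 1, .set 13 0]
    (x₀ :: x₁ :: x₂ :: x₃ :: 0 :: 1 :: 0 :: 0 :: 0 :: 0 :: E :: F :: G :: H :: l) f o rfl
  have h2 := ExecLE.whileLt (x := 13) (y := 11)
    (P := .seq (.block [.add 6 12 4, .add 7 10 4]) <|
      .seq mulProg (.block [.add 12 8 4, .add 13 13 5, .set 6 0, .set 7 0, .set 8 0]))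
    (fun k => St fm
      (x₀ :: x₁ :: x₂ :: x₃ :: 0 :: 1 :: 0 :: 0 :: 0 :: 0 :: E :: F :: E ^ k :: k :: l) f o)
    F (4 * W + 15)
    (fun k hk => hk) (lt_irrefl F) (fun k hk => by
      have g1 := ExecLE.block fm [.add 6 12 4, .add 7 10 4]
        (x₀ :: x₁ :: x₂ :: x₃ :: 0 :: 1 :: 0 :: 0 :: 0 :: 0 :: E :: F :: E ^ k :: k :: l) f o rfl
      have g2 := exec_mulProg fm f o x₀ x₁ x₂ x₃ (E ^ k) E 0 0 (E :: F :: E ^ k :: k :: l)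
      have g3 := ExecLE.block fm [.add 12 8 4, .add 13 13 5, .set 6 0, .set 7 0, .set 8 0]
        (x₀ :: x₁ :: x₂ :: x₃ :: 0 :: 1 :: E ^ k :: E :: E ^ k * E :: 0 :: E :: F :: E ^ k ::
          k :: l) f o rfl
      rw [pow_succ]
      have : E ^ k ≤ W := (Nat.pow_le_pow_right hE hk.le).trans hW
      exact (g1.seq (g2.seq g3)).mono (by simp only [List.length_cons, List.length_nil]; omega))
  have h3 := ExecLE.block fm [.set 13 0]
    (x₀ :: x₁ :: x₂ :: x₃ :: 0 :: 1 :: 0 :: 0 :: 0 :: 0 :: E :: F :: E ^ F :: F :: l) f o rfl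
  rw [pow_zero] at h2
  exact (h1.seq (h2.seq h3)).mono (by
    simp only [List.length_cons, List.length_nil, Nat.add_assoc, Nat.reduceAdd]; omega)

/-- The binary logarithm of register 6, rounded up. -/
def clogProg : Prog :=
  .seq (.block [.set 7 1, .set 8 0]) <|
  .whileLt 7 6 (.block [.add 7 7 7, .add 8 8 5])

theorem exec_clogProg (fm : ℕ → L) (f o : List L) (x₀ x₁ x₂ x₃ A B C : ℕ) (l : List ℕ) :
    ExecLE clogProg (St fm (x₀ :: x₁ :: x₂ :: x₃ :: 0 :: 1 :: A :: B :: C :: l) f o)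
      (4 * Nat.clog 2 A + 4)
      (St fm (x₀ :: x₁ :: x₂ :: x₃ :: 0 :: 1 :: A :: 2 ^ Nat.clog 2 A :: Nat.clog 2 A :: l)
        f o) := by
  have h1 := ExecLE.block fm [.set 7 1, .set 8 0]
    (x₀ :: x₁ :: x₂ :: x₃ :: 0 :: 1 :: A :: B :: C :: l) f o rfl
  have h2 := ExecLE.whileLt (x := 7) (y := 6) (P := .block [.add 7 7 7, .add 8 8 5])
    (fun k => St fm (x₀ :: x₁ :: x₂ :: x₃ :: 0 :: 1 :: A :: 2 ^ k :: k :: l) f o)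
    (Nat.clog 2 A) 3
    (fun k hk => (Nat.lt_clog_iff_pow_lt (by norm_num)).mp hk)
    (Nat.le_pow_clog (by norm_num) A).not_gt (fun k _ => by
      have h := ExecLE.block fm [.add 7 7 7, .add 8 8 5]
        (x₀ :: x₁ :: x₂ :: x₃ :: 0 :: 1 :: A :: 2 ^ k :: k :: l) f o rfl
      rw [pow_succ, mul_two]
      exact h)
  rw [pow_zero] at h2
  exact (h1.seq h2).mono (by simp only [List.length_cons, List.length_nil]; omega)

/-- The power of field register 1 with exponent in register 6, stored in field register 0. -/
def fpowProg : Prog :=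
  .seq (.block [.fone 0, .set 9 0]) <|
  .seq (.whileLt 9 6 (.block [.fmul 0 0 1, .add 9 9 5])) (.block [.set 9 0])

theorem exec_fpowProg (fm : ℕ → L) (o : List L) (a c : L) (x₀ x₁ x₂ x₃ A B C E : ℕ) (l : List ℕ) :
    ExecLE fpowProg (St fm (x₀ :: x₁ :: x₂ :: x₃ :: 0 :: 1 :: A :: B :: C :: E :: l) [a, c] o)
      (4 * A + 6)
      (St fm (x₀ :: x₁ :: x₂ :: x₃ :: 0 :: 1 :: A :: B :: C :: 0 :: l) [c ^ A, c] o) := by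
  have h1 := ExecLE.block fm [.fone 0, .set 9 0]
    (x₀ :: x₁ :: x₂ :: x₃ :: 0 :: 1 :: A :: B :: C :: E :: l) [a, c] o rfl
  have h2 := ExecLE.whileLt (x := 9) (y := 6) (P := .block [.fmul 0 0 1, .add 9 9 5])
    (fun k => St fm (x₀ :: x₁ :: x₂ :: x₃ :: 0 :: 1 :: A :: B :: C :: k :: l) [c ^ k, c] o) A 3
    (fun k hk => hk) (lt_irrefl A) (fun k _ => by
      have h := ExecLE.block fm [.fmul 0 0 1, .add 9 9 5]
        (x₀ :: x₁ :: x₂ :: x₃ :: 0 :: 1 :: A :: B :: C :: k :: l) [c ^ k, c] o rfl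
      rw [pow_succ]
      exact h)
  have h3 := ExecLE.block fm [.set 9 0]
    (x₀ :: x₁ :: x₂ :: x₃ :: 0 :: 1 :: A :: B :: C :: A :: l) [c ^ A, c] o rfl
  rw [pow_zero] at h2
  exact (h1.seq (h2.seq h3)).mono (by simp only [List.length_cons, List.length_nil]; omega)

end Machine

/-! ### Encoding the points by integers -/

section Scan

variable {L : Type u} [Field L]

/-- The last `m` coordinates of the point that is encoded by the code `v` and the number `gap` of
coordinates before the next free one, where `rem` free coordinates are left. The values of the free
coordinates are `A 0, …, A (d₁ - 1)`. -/
def scan (n d₁ D p : ℕ) (A : ℕ → L) (c : L) : ℕ → ℕ → ℕ → ℕ → ℕ → List L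
  | 0, _, _, _, _ => []
  | m + 1, v, gap, rem, pw =>
    if 0 < rem ∧ (m + 1 ≤ rem ∨ gap = 0) then
      A (v % d₁) :: scan n d₁ D p A c m (v / d₁ / n) (v / d₁ % n) (rem - 1) pw
    else c ^ (pw * D % p) :: scan n d₁ D p A c m v (gap - 1) rem (pw * D % p)

theorem length_scan (n d₁ D p : ℕ) (A : ℕ → L) (c : L) (m v gap rem pw : ℕ) :
    (scan n d₁ D p A c m v gap rem pw).length = m := by
  induction m generalizing v gap rem pw with
  | zero => rfl
  | succ m ih => rw [scan]; split_ifs <;> simp [ih]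

/-- The coordinate at position `i` of a point with free coordinates at the positions in `B`. -/
def patternCoord (D p : ℕ) (c : L) (B : ℕ → Bool) (a : ℕ → L) (k i : ℕ) : L :=
  if B i then a i else c ^ (D ^ (k + Nat.count (fun j => B j = false) i + 1) % p)

/-- Every code is valid, whatever its digits: as soon as only `rem` coordinates are left, the test
in `scan` makes all of them free. Hence exactly `rem` coordinates are free. The residue `pw` is the
running power of `D` modulo `p`. -/
theorem exists_scan_eq_pattern {n d₁ D p : ℕ} (A : ℕ → L) (c : L) (hd₁ : 0 < d₁) (m v gap : ℕ) :
    ∀ rem pw k : ℕ, rem ≤ m → pw ≡ D ^ k [MOD p] →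
    ∃ (B : ℕ → Bool) (a : ℕ → L), Nat.count (fun j => B j = true) m = rem ∧
      (∀ i, ∃ t < d₁, a i = A t) ∧
      scan n d₁ D p A c m v gap rem pw = (List.range m).map (patternCoord D p c B a k) := by
  induction m generalizing v gap with
  | zero =>
    intro rem pw k hrem _
    exact ⟨fun _ => false, fun _ => A 0, by simp; omega, fun i => ⟨0, hd₁, rfl⟩, rfl⟩
  | succ m ih =>
    intro rem pw k hrem hpw
    rw [scan]
    split_ifs with h
    · obtain ⟨B, a, hB, ha, hs⟩ := ih (v / d₁ / n) (v / d₁ % n) (rem - 1) pw k (by omega) hpw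
      refine ⟨fun i => Nat.casesOn i true B, fun i => Nat.casesOn i (A (v % d₁)) a, ?_, ?_, ?_⟩
      · rw [Nat.count_succ']
        simp [hB]
        omega
      · intro i
        cases i with
        | zero => exact ⟨v % d₁, Nat.mod_lt _ hd₁, rfl⟩
        | succ i => exact ha i
      · rw [hs, List.range_succ_eq_map, List.map_cons, List.map_map]
        congr 1
        refine List.map_congr_left fun i _ => ?_
        simp only [Function.comp_apply, patternCoord, Nat.succ_eq_add_one, Nat.count_succ']
        simp
    · have hpw' : pw * D % p ≡ D ^ (k + 1) [MOD p] := by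
        rw [pow_succ]
        exact (Nat.mod_modEq _ _).trans (hpw.mul_right _)
      obtain ⟨B, a, hB, ha, hs⟩ := ih v (gap - 1) rem (pw * D % p) (k + 1) (by omega) hpw'
      refine ⟨fun i => Nat.casesOn i false B, fun i => Nat.casesOn i (A 0) a, ?_, ?_, ?_⟩
      · rw [Nat.count_succ']
        simp [hB]
      · intro i
        cases i with
        | zero => exact ⟨0, hd₁, rfl⟩
        | succ i => exact ha i
      · rw [hs, List.range_succ_eq_map, List.map_cons, List.map_map]
        congr 1
        · have : pw * D % p = D ^ (k + 1) % p := by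
            have := hpw'
            rwa [Nat.ModEq, Nat.mod_mod] at this
          simp [patternCoord, this]
        · refine List.map_congr_left fun i _ => ?_
          simp only [Function.comp_apply, patternCoord, Nat.succ_eq_add_one, Nat.count_succ']
          simp [Nat.add_right_comm k 1, ← Nat.add_assoc]

/-- The code is built from the last coordinate backwards. A free coordinate pushes the digit `gap`
to base `n` and then the index of its value to base `d₁`; any other coordinate raises `gap` by one.
The bound on `gap` plus the number of free coordinates keeps `gap < n`, a legal digit. -/
theorem exists_pattern_eq_scan {n d₁ D p : ℕ} (A : ℕ → L) (c : L) (m : ℕ) :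
    ∀ (B : ℕ → Bool) (a : ℕ → L) (pw k : ℕ), m ≤ n → (∀ i, ∃ t < d₁, a i = A t) →
    pw ≡ D ^ k [MOD p] →
    ∃ v gap, v < (n * d₁) ^ Nat.count (fun j => B j = true) m ∧
      gap + Nat.count (fun j => B j = true) m ≤ m ∧
      scan n d₁ D p A c m v gap (Nat.count (fun j => B j = true) m) pw =
        (List.range m).map (patternCoord D p c B a k) := by
  induction m with
  | zero =>
    intro B a pw k _ _ _
    exact ⟨0, 0, by simp, by simp, rfl⟩
  | succ m ih =>
    intro B a pw k hm ha hpw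
    have hcount : Nat.count (fun j => B (j + 1) = true) m ≤ m := Nat.count_le _
    have hpw' : pw * D % p ≡ D ^ (k + 1) [MOD p] := by
      rw [pow_succ]
      exact (Nat.mod_modEq _ _).trans (hpw.mul_right _)
    rw [Nat.count_succ']
    cases hB : B 0 with
    | true =>
      obtain ⟨v, gap, hv, hgap, hs⟩ := ih (fun i => B (i + 1)) (fun i => a (i + 1)) pw k (by omega)
        (fun i => ha (i + 1)) hpw
      obtain ⟨t, ht, hat⟩ := ha 0
      simp only [if_true]
      have hd₁ : 0 < d₁ := by omega
      have hn : 0 < n := by omega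
      have h1 : ((v * n + gap) * d₁ + t) % d₁ = t := by
        rw [Nat.mul_add_mod_self_right, Nat.mod_eq_of_lt ht]
      have h2 : ((v * n + gap) * d₁ + t) / d₁ = v * n + gap := by
        rw [mul_comm, Nat.mul_add_div hd₁, Nat.div_eq_of_lt ht, add_zero]
      have hgn : gap < n := by omega
      have h3 : (v * n + gap) / n = v := by
        rw [mul_comm, Nat.mul_add_div hn, Nat.div_eq_of_lt hgn, add_zero]
      have h4 : (v * n + gap) % n = gap := by
        rw [Nat.mul_add_mod_self_right, Nat.mod_eq_of_lt hgn]
      refine ⟨(v * n + gap) * d₁ + t, 0, ?_, by omega, ?_⟩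
      · rw [pow_succ]
        calc (v * n + gap) * d₁ + t < ((v * n + gap) + 1) * d₁ := by rw [Nat.succ_mul]; omega
          _ ≤ ((v + 1) * n) * d₁ := Nat.mul_le_mul_right _ (by rw [Nat.succ_mul]; omega)
          _ = (v + 1) * (n * d₁) := by ring
          _ ≤ _ := Nat.mul_le_mul_right _ hv
      · rw [scan, if_pos ⟨by omega, Or.inr rfl⟩, h1, h2, h3, h4, Nat.add_sub_cancel, hs,
          List.range_succ_eq_map, List.map_cons, List.map_map]
        congr 1
        · simp [patternCoord, hB, hat]
        · refine List.map_congr_left fun i _ => ?_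
          simp only [Function.comp_apply, patternCoord, Nat.succ_eq_add_one, Nat.count_succ']
          simp [hB]
    | false =>
      obtain ⟨v, gap, hv, hgap, hs⟩ := ih (fun i => B (i + 1)) (fun i => a (i + 1)) (pw * D % p)
        (k + 1) (by omega) (fun i => ha (i + 1)) hpw'
      simp only [Bool.false_eq_true, if_false, add_zero]
      refine ⟨v, gap + 1, hv, by omega, ?_⟩
      -- The test fails because the gap is positive and at most `m` free coordinates remain for `m +
      -- 1` positions.
      rw [scan, if_neg (by omega), Nat.add_sub_cancel, hs, List.range_succ_eq_map, List.map_cons,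
        List.map_map]
      congr 1
      · have : pw * D % p = D ^ (k + 1) % p := by
          have := hpw'
          rwa [Nat.ModEq, Nat.mod_mod] at this
        simp [patternCoord, this, hB]
      · refine List.map_congr_left fun i _ => ?_
        simp only [Function.comp_apply, patternCoord, Nat.succ_eq_add_one, Nat.count_succ']
        simp [hB, Nat.add_right_comm k 1, ← Nat.add_assoc]

theorem rankIn_eq_count {n : ℕ} (I : Finset (Fin n)) (B : ℕ → Bool) (b : Bool)
    (hI : ∀ j : Fin n, j ∈ I ↔ B j = b) (j : Fin n) :
    rankIn I j = Nat.count (fun i => B i = b) j := by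
  rw [rankIn, Nat.count_eq_card_filter_range, ← Finset.card_map Fin.valEmbedding]
  congr 1
  ext i
  simp only [Finset.mem_map, Finset.mem_filter, Fin.valEmbedding_apply, Finset.mem_range]
  constructor
  · rintro ⟨i, ⟨h1, h2⟩, rfl⟩
    exact ⟨h2, (hI i).mp h1⟩
  · rintro ⟨h1, h2⟩
    exact ⟨⟨i, h1.trans j.2⟩, ⟨(hI _).mpr h2, h1⟩, rfl⟩

theorem card_eq_count {n : ℕ} (I : Finset (Fin n)) (B : ℕ → Bool)
    (hI : ∀ j : Fin n, j ∈ I ↔ B j = true) : I.card = Nat.count (fun i => B i = true) n := by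
  rw [Nat.count_eq_card_filter_range, ← Finset.card_map Fin.valEmbedding]
  congr 1
  ext i
  simp only [Finset.mem_map, Finset.mem_filter, Fin.valEmbedding_apply, Finset.mem_range]
  constructor
  · rintro ⟨i, h1, rfl⟩
    exact ⟨i.2, (hI i).mp h1⟩
  · rintro ⟨h1, h2⟩
    exact ⟨⟨i, h1⟩, (hI _).mpr h2, rfl⟩

theorem eval_Phi_X {n r : ℕ} {I : Finset (Fin n)} (hI : I.card = r) (D p : ℕ) (c : L)
    (a : Fin r → L) (j : Fin n) :
    MvPolynomial.eval a (Phi L I hI D p c (MvPolynomial.X j)) =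
      if hj : j ∈ I then a ⟨rankIn I j, rankIn_lt hI hj⟩
      else c ^ (D ^ (rankIn Iᶜ j + 1) % p) := by
  split_ifs with hj
  · rw [Phi_X_of_mem hI D p c hj, MvPolynomial.eval_X]
  · rw [Phi_X_of_notMem hI D p c hj, MvPolynomial.eval_C]

/-- The points of the hitting set in terms of the patterns of their free coordinates. -/
theorem mem_hittingSet_iff {n r δ : ℕ} {H₁ H₂ : Finset L} (hH₂ : H₂.Nonempty) (x : Fin n → L) :
    x ∈ hittingSet n r δ H₁ H₂ ↔ ∃ (p : ℕ) (c : L) (B : ℕ → Bool) (a : ℕ → L),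
      1 ≤ p ∧ p ≤ pMax n r δ ∧ c ∈ H₁ ∧ (∀ i, a i ∈ H₂) ∧
      Nat.count (fun i => B i = true) n = r ∧
      ∀ j : Fin n, x j = patternCoord (paramD r δ) p c B a 0 j := by
  classical
  obtain ⟨h₂, hh₂⟩ := hH₂
  constructor
  · rintro ⟨I, hI, p, c, a, hp1, hp2, hc, ha, rfl⟩
    let B : ℕ → Bool := fun i => if h : i < n then decide (⟨i, h⟩ ∈ I) else false
    have hB : ∀ j : Fin n, B j = decide (j ∈ I) := fun j => by simp [B]
    -- The values at positions outside `I` are never read; `h₂` only keeps them in `H₂`.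
    refine ⟨p, c, B, fun i => if h : ∃ h : i < n, ⟨i, h⟩ ∈ I then
      a ⟨rankIn I ⟨i, h.1⟩, rankIn_lt hI h.2⟩ else h₂, hp1, hp2, hc, fun i => ?_, ?_, fun j => ?_⟩
    · dsimp only
      split_ifs
      · exact ha _
      · exact hh₂
    · rw [← hI, card_eq_count I B fun j => by rw [hB]; simp]
    · dsimp only
      rw [eval_Phi_X]
      by_cases hj : j ∈ I
      · simp [patternCoord, hB, hj]
      · rw [rankIn_eq_count Iᶜ B false fun j => by rw [hB]; simp]
        simp [patternCoord, hB, hj]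
  · rintro ⟨p, c, B, a, hp1, hp2, hc, ha, hB, hx⟩
    let I : Finset (Fin n) := Finset.univ.filter fun j => B j = true
    have hIB : ∀ j : Fin n, j ∈ I ↔ B j = true := fun j => by simp [I]
    have hI : I.card = r := by rw [card_eq_count I B hIB, hB]
    refine ⟨I, hI, p, c, fun t => if h : ∃ j ∈ I, rankIn I j = t then a h.choose else h₂,
      hp1, hp2, hc, fun t => ?_, ?_⟩
    · dsimp only
      split_ifs
      · exact ha _
      · exact hh₂
    · funext j
      rw [hx, eval_Phi_X]
      by_cases hj : j ∈ I
      · have hex : ∃ i ∈ I, rankIn I i = rankIn I j := ⟨j, hj, rfl⟩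
        have hch : hex.choose = j := rankIn_injOn I hex.choose_spec.1 hj hex.choose_spec.2
        rw [dif_pos hj, dif_pos hex, hch, patternCoord, if_pos ((hIB j).mp hj)]
      · rw [dif_neg hj, rankIn_eq_count Iᶜ B false fun j => by
          rw [Finset.mem_compl, hIB]; simp]
        rw [patternCoord, if_neg (by rwa [← hIB]), zero_add]

/-- The coordinates of the point with the code `idx`. -/
def codePoint (n r d₁ D h₁ pm : ℕ) (fm : ℕ → L) (idx : ℕ) : List L :=
  scan n d₁ D (idx % pm + 1) (fun t => fm (h₁ + t)) (fm (idx / pm % h₁)) n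
    (idx / pm / h₁ / n) (idx / pm / h₁ % n) r 1

theorem length_codePoint (n r d₁ D h₁ pm : ℕ) (fm : ℕ → L) (idx : ℕ) :
    (codePoint n r d₁ D h₁ pm fm idx).length = n := length_scan ..

/-- The digits of `idx`, from the lowest, are `p - 1` to base `pMax`, the position of `c` in the
list to base `h₁`, the first gap to base `n`, and the code `v`. The converse needs no bound on
`idx`, since every code decodes to a point. -/
theorem mem_hittingSet_iff_codePoint {n d r δ h₁ : ℕ} (hr : 1 ≤ r) (hrn : r ≤ n)
    {H₁ H₂ : Finset L} {fm : ℕ → L} (hh₁ : 0 < h₁)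
    (hH₁ : ∀ c, c ∈ H₁ ↔ ∃ t < h₁, fm t = c) (hH₂ : ∀ c, c ∈ H₂ ↔ ∃ t < d + 1, fm (h₁ + t) = c)
    (x : Fin n → L) :
    x ∈ hittingSet n r δ H₁ H₂ ↔
      ∃ idx < (n * (d + 1)) ^ r * n * h₁ * pMax n r δ,
        List.ofFn x = codePoint n r (d + 1) (paramD r δ) h₁ (pMax n r δ) fm idx := by
  have hne : H₂.Nonempty := ⟨fm (h₁ + 0), (hH₂ _).mpr ⟨0, by omega, rfl⟩⟩
  have hpm : 0 < pMax n r δ := Nat.succ_pos _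
  have hn : 0 < n := by omega
  have hofFn : ∀ g : ℕ → L, (List.ofFn x = (List.range n).map g ↔ ∀ j : Fin n, x j = g j) := by
    intro g
    have h : (List.range n).map g = List.ofFn fun j : Fin n => g j :=
      List.ext_getElem (by simp) (by simp)
    rw [h, List.ofFn_inj, funext_iff]
  rw [mem_hittingSet_iff hne]
  constructor
  · rintro ⟨p, c, B, a, hp1, hp2, hc, ha, hB, hx⟩
    obtain ⟨t, ht, rfl⟩ := (hH₁ c).mp hc
    obtain ⟨v, gap, hv, hgap, hs⟩ := exists_pattern_eq_scan (n := n) (d₁ := d + 1)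
      (D := paramD r δ) (p := p) (fun t => fm (h₁ + t)) (fm t) n B a 1 0 le_rfl
      (fun i => by
        obtain ⟨t, ht, h⟩ := (hH₂ _).mp (ha i)
        exact ⟨t, ht, h.symm⟩) (by rw [pow_zero])
    rw [hB] at hv hgap hs
    have hgn : gap < n := by omega
    have hp : p - 1 < pMax n r δ := by omega
    have e1 : (((v * n + gap) * h₁ + t) * pMax n r δ + (p - 1)) % pMax n r δ = p - 1 := by
      rw [Nat.mul_add_mod_self_right, Nat.mod_eq_of_lt hp]
    have e2 : (((v * n + gap) * h₁ + t) * pMax n r δ + (p - 1)) / pMax n r δ =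
        (v * n + gap) * h₁ + t := by
      rw [mul_comm, Nat.mul_add_div hpm, Nat.div_eq_of_lt hp, add_zero]
    have e3 : ((v * n + gap) * h₁ + t) % h₁ = t := by
      rw [Nat.mul_add_mod_self_right, Nat.mod_eq_of_lt ht]
    have e4 : ((v * n + gap) * h₁ + t) / h₁ = v * n + gap := by
      rw [mul_comm, Nat.mul_add_div hh₁, Nat.div_eq_of_lt ht, add_zero]
    have e5 : (v * n + gap) % n = gap := by
        rw [Nat.mul_add_mod_self_right, Nat.mod_eq_of_lt hgn]
    have e6 : (v * n + gap) / n = v := by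
      rw [mul_comm, Nat.mul_add_div hn, Nat.div_eq_of_lt hgn, add_zero]
    refine ⟨((v * n + gap) * h₁ + t) * pMax n r δ + (p - 1), ?_, ?_⟩
    · calc ((v * n + gap) * h₁ + t) * pMax n r δ + (p - 1)
          < ((v * n + gap) * h₁ + t + 1) * pMax n r δ := by rw [Nat.succ_mul]; omega
        _ ≤ ((v * n + gap + 1) * h₁) * pMax n r δ :=
          Nat.mul_le_mul_right _ (by rw [Nat.succ_mul]; omega)
        _ ≤ (((v + 1) * n) * h₁) * pMax n r δ :=
          Nat.mul_le_mul_right _ (Nat.mul_le_mul_right _ (by rw [Nat.succ_mul]; omega))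
        _ ≤ _ := Nat.mul_le_mul_right _ (Nat.mul_le_mul_right _ (Nat.mul_le_mul_right _ hv))
    · rw [codePoint, e1, e2, e3, e4, e5, e6, Nat.sub_add_cancel hp1, hs, hofFn]
      exact hx
  · rintro ⟨idx, _, hx⟩
    obtain ⟨B, a, hB, ha, hs⟩ := exists_scan_eq_pattern (n := n) (d₁ := d + 1) (D := paramD r δ)
      (p := idx % pMax n r δ + 1) (fun t => fm (h₁ + t)) (fm (idx / pMax n r δ % h₁))
      (Nat.succ_pos d) n (idx / pMax n r δ / h₁ / n) (idx / pMax n r δ / h₁ % n) r 1 0 hrn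
      (by rw [pow_zero])
    rw [codePoint, hs, hofFn] at hx
    refine ⟨_, _, B, a, Nat.succ_pos _, Nat.mod_lt _ hpm,
      (hH₁ _).mpr ⟨_, Nat.mod_lt _ hh₁, rfl⟩, fun i => ?_, hB, hx⟩
    obtain ⟨t, ht, h⟩ := ha i
    exact (hH₂ _).mpr ⟨t, ht, h.symm⟩

end Scan

/-! ### The program and its execution -/

section Program

variable {L : Type u} [Field L]

/-- Print the next free coordinate and decode the distance to the following one. -/
def freeProg : Prog :=
  .seq (.block [.add 6 20 4, .add 7 16 4]) <|
  .seq divProg <|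
  .seq (.block [.add 26 15 9, .fload 0 26, .print 0, .add 6 8 4, .add 7 0 4]) <|
  .seq divProg <|
  .block [.add 20 8 4, .add 22 9 4, .sub 23 23 5, .set 6 0, .set 7 0, .set 8 0, .set 9 0, .set 26 0,
    .fzero 0, .add 25 25 5]

/-- Print the next power of the constant `c`. -/
def powerProg : Prog :=
  .seq (.block [.sub 22 22 5, .add 6 24 4, .add 7 17 4]) <|
  .seq mulProg <|
  .seq (.block [.add 6 8 4, .add 7 21 4]) <|
  .seq divProg <|
  .seq (.block [.add 24 9 4, .add 6 9 4]) <|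
  .seq fpowProg <|
  .block [.print 0, .set 6 0, .set 7 0, .set 8 0, .set 9 0, .set 26 0, .fzero 0, .add 25 25 5]

/-- Print the next coordinate. -/
def coordProg : Prog :=
  .seq (.block [.sub 26 0 25]) <|
  .ifLt 4 23 (.ifLt 23 26 (.ifLt 22 5 freeProg powerProg) freeProg) powerProg

/-- Print the point with the code in register 19. -/
def pointProg : Prog :=
  .seq (.block [.add 6 19 4, .add 7 14 4]) <|
  .seq divProg <|
  .seq (.block [.add 21 9 5, .add 6 8 4, .add 7 15 4]) <|
  .seq divProg <|
  .seq (.block [.fload 1 9, .add 6 8 4, .add 7 0 4]) <|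
  .seq divProg <|
  .seq (.block [.add 20 8 4, .add 22 9 4, .add 23 2 4, .set 24 1, .set 25 0, .set 6 0, .set 7 0,
    .set 8 0, .set 9 0]) <|
  .seq (.whileLt 25 0 coordProg) <|
  .block [.set 20 0, .set 21 0, .set 22 0, .set 23 0, .set 24 0, .set 25 0, .fzero 1, .add 19 19 5]

/-- Compute `δ ^ r`, `paramD r δ` and `(n + δ ^ r) ^ (8 * δ ^ (r + 1))`. -/
def paramProg : Prog :=
  .seq (.block [.set 5 1, .add 10 3 4, .add 11 2 4]) <|
  .seq powProg <|
  .seq (.block [.add 15 12 4, .add 6 12 4, .add 7 3 4]) <|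
  .seq mulProg <|
  .seq (.block [.add 17 8 5, .add 10 0 15, .add 11 8 8, .add 11 11 11, .add 11 11 11, .set 6 0,
    .set 7 0, .set 8 0]) powProg

/-- Compute `pMax n r δ`. -/
def pMaxProg : Prog :=
  .seq (.block [.add 14 12 4, .add 6 17 4]) <|
  .seq clogProg <|
  .seq (.block [.add 16 8 4, .add 6 16 4, .add 7 14 4]) <|
  .seq mulProg <|
  .seq (.block [.add 6 16 4, .add 7 8 4]) <|
  .seq mulProg <|
  .block [.add 14 8 5]

/-- Compute the sizes of the sets of field elements. -/
def cardProg : Prog :=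
  .seq (.block [.add 6 2 4, .add 7 15 4]) <|
  .seq mulProg <|
  .seq (.block [.add 6 8 4, .add 7 14 4]) <|
  .seq mulProg <|
  .block [.add 15 8 4, .add 16 1 5]

/-- Compute the number of points. -/
def countProg : Prog :=
  .seq (.block [.add 6 0 4, .add 7 16 4]) <|
  .seq mulProg <|
  .seq (.block [.add 10 8 4, .add 11 2 4, .set 6 0, .set 7 0, .set 8 0]) <|
  .seq powProg <|
  .seq (.block [.add 6 12 4, .add 7 0 4]) <|
  .seq mulProg <|
  .seq (.block [.add 6 8 4, .add 7 15 4]) <|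
  .seq mulProg <|
  .seq (.block [.add 6 8 4, .add 7 14 4]) <|
  .seq mulProg <|
  .block [.add 18 8 4, .set 6 0, .set 7 0, .set 8 0, .set 10 0, .set 11 0, .set 12 0]

/-- Compute the parameters. -/
def setupProg : Prog :=
  .seq paramProg <| .seq pMaxProg <| .seq cardProg countProg

/-- The program that prints the hitting set. -/
def hittingSetProg : Prog := .seq setupProg (.whileLt 19 18 pointProg)

/-- From register 14 on, the registers hold `pm, h₁, d₁, D, N, idx, v, p, gap, rem, pw, j` and a
scratch value. Registers 6 to 13 are scratch and are cleared again. `W` bounds the number to be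
divided and hence the cost. -/
theorem exec_freeProg (fm : ℕ → L) (o : List L) (c : L)
    (n d r δ pm h₁ d₁ D N idx v p gap rem pw j x W : ℕ) (hd₁ : 0 < d₁) (hn : 0 < n) (hv : v ≤ W) :
    ExecLE freeProg
      (St fm [n, d, r, δ, 0, 1, 0, 0, 0, 0, 0, 0, 0, 0, pm, h₁, d₁, D, N, idx, v, p, gap, rem, pw,
        j, x] [0, c] o) (8 * W + 40)
      (St fm [n, d, r, δ, 0, 1, 0, 0, 0, 0, 0, 0, 0, 0, pm, h₁, d₁, D, N, idx, v / d₁ / n, p,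
        v / d₁ % n, rem - 1, pw, j + 1, 0] [0, c] (o ++ [fm (h₁ + v % d₁)])) := by
  have e1 := ExecLE.block fm [.add 6 20 4, .add 7 16 4]
    [n, d, r, δ, 0, 1, 0, 0, 0, 0, 0, 0, 0, 0, pm, h₁, d₁, D, N, idx, v, p, gap, rem, pw, j, x]
    [0, c] o rfl
  have e2 := exec_divProg fm [0, c] o n d r δ v d₁ 0 0
    [0, 0, 0, 0, pm, h₁, d₁, D, N, idx, v, p, gap, rem, pw, j, x] hd₁
  have e3 := ExecLE.block fm [.add 26 15 9, .fload 0 26, .print 0, .add 6 8 4, .add 7 0 4]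
    [n, d, r, δ, 0, 1, v, d₁, v / d₁, v % d₁, 0, 0, 0, 0, pm, h₁, d₁, D, N, idx, v, p, gap, rem, pw,
      j, x] [0, c] o rfl
  have e4 := exec_divProg fm [fm (h₁ + v % d₁), c] (o ++ [fm (h₁ + v % d₁)]) n d r δ (v / d₁) n
    (v / d₁) (v % d₁)
    [0, 0, 0, 0, pm, h₁, d₁, D, N, idx, v, p, gap, rem, pw, j, h₁ + v % d₁] hn
  have e5 := ExecLE.block fm [.add 20 8 4, .add 22 9 4, .sub 23 23 5, .set 6 0, .set 7 0, .set 8 0,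
    .set 9 0, .set 26 0, .fzero 0, .add 25 25 5]
    [n, d, r, δ, 0, 1, v / d₁, n, v / d₁ / n, v / d₁ % n, 0, 0, 0, 0, pm, h₁, d₁, D, N, idx, v, p,
      gap, rem, pw, j, h₁ + v % d₁] [fm (h₁ + v % d₁), c] (o ++ [fm (h₁ + v % d₁)]) rfl
  have hv' : v / d₁ ≤ W := (Nat.div_le_self _ _).trans hv
  exact (e1.seq (e2.seq (e3.seq (e4.seq e5)))).mono (by
    simp only [List.length_cons, List.length_nil]; omega)

theorem exec_powerProg (fm : ℕ → L) (o : List L) (c : L)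
    (n d r δ pm h₁ d₁ D N idx v p gap rem pw j x W : ℕ) (hp : 0 < p) (hpw : pw ≤ W)
    (hpD : pw * D ≤ W) :
    ExecLE powerProg
      (St fm [n, d, r, δ, 0, 1, 0, 0, 0, 0, 0, 0, 0, 0, pm, h₁, d₁, D, N, idx, v, p, gap, rem, pw,
        j, x] [0, c] o) (12 * W + 50)
      (St fm [n, d, r, δ, 0, 1, 0, 0, 0, 0, 0, 0, 0, 0, pm, h₁, d₁, D, N, idx, v, p,
        gap - 1, rem, pw * D % p, j + 1, 0] [0, c] (o ++ [c ^ (pw * D % p)])) := by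
  have e1 := ExecLE.block fm [.sub 22 22 5, .add 6 24 4, .add 7 17 4]
    [n, d, r, δ, 0, 1, 0, 0, 0, 0, 0, 0, 0, 0, pm, h₁, d₁, D, N, idx, v, p, gap, rem, pw, j, x]
    [0, c] o rfl
  have e2 := exec_mulProg fm [0, c] o n d r δ pw D 0 0
    [0, 0, 0, 0, pm, h₁, d₁, D, N, idx, v, p, gap - 1, rem, pw, j, x]
  have e3 := ExecLE.block fm [.add 6 8 4, .add 7 21 4]
    [n, d, r, δ, 0, 1, pw, D, pw * D, 0, 0, 0, 0, 0, pm, h₁, d₁, D, N, idx, v, p, gap - 1, rem, pw,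
      j, x] [0, c] o rfl
  have e4 := exec_divProg fm [0, c] o n d r δ (pw * D) p (pw * D) 0
    [0, 0, 0, 0, pm, h₁, d₁, D, N, idx, v, p, gap - 1, rem, pw, j, x] hp
  have e5 := ExecLE.block fm [.add 24 9 4, .add 6 9 4]
    [n, d, r, δ, 0, 1, pw * D, p, pw * D / p, pw * D % p, 0, 0, 0, 0, pm, h₁, d₁, D, N, idx, v, p,
      gap - 1, rem, pw, j, x] [0, c] o rfl
  have e6 := exec_fpowProg fm o 0 c n d r δ (pw * D % p) p (pw * D / p) (pw * D % p)
    [0, 0, 0, 0, pm, h₁, d₁, D, N, idx, v, p, gap - 1, rem, pw * D % p, j, x]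
  have e7 := ExecLE.block fm [.print 0, .set 6 0, .set 7 0, .set 8 0, .set 9 0, .set 26 0, .fzero 0,
    .add 25 25 5]
    [n, d, r, δ, 0, 1, pw * D % p, p, pw * D / p, 0, 0, 0, 0, 0, pm, h₁, d₁, D, N, idx, v, p,
      gap - 1, rem, pw * D % p, j, x] [c ^ (pw * D % p), c] o rfl
  have hmod : pw * D % p ≤ W := (Nat.mod_le _ _).trans hpD
  exact (e1.seq (e2.seq (e3.seq (e4.seq (e5.seq (e6.seq e7)))))).mono (by
    simp only [List.length_cons, List.length_nil]; omega)

theorem exec_coordProg (fm : ℕ → L) (o : List L) (c : L)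
    (n d r δ pm h₁ d₁ D N idx v p gap rem pw j W : ℕ) (hd₁ : 0 < d₁) (hp : 0 < p) (hj : j < n)
    (hv : v ≤ W) (hpw : pw ≤ W) (hpD : pw * D ≤ W) :
    ExecLE coordProg
      (St fm [n, d, r, δ, 0, 1, 0, 0, 0, 0, 0, 0, 0, 0, pm, h₁, d₁, D, N, idx, v, p, gap, rem, pw,
        j, 0] [0, c] o) (12 * W + 60)
      (if 0 < rem ∧ (n - j ≤ rem ∨ gap = 0) then
        St fm [n, d, r, δ, 0, 1, 0, 0, 0, 0, 0, 0, 0, 0, pm, h₁, d₁, D, N, idx, v / d₁ / n, p,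
          v / d₁ % n, rem - 1, pw, j + 1, 0] [0, c] (o ++ [fm (h₁ + v % d₁)])
      else St fm [n, d, r, δ, 0, 1, 0, 0, 0, 0, 0, 0, 0, 0, pm, h₁, d₁, D, N, idx, v, p,
          gap - 1, rem, pw * D % p, j + 1, 0] [0, c] (o ++ [c ^ (pw * D % p)])) := by
  have e1 := ExecLE.block fm [.sub 26 0 25]
    [n, d, r, δ, 0, 1, 0, 0, 0, 0, 0, 0, 0, 0, pm, h₁, d₁, D, N, idx, v, p, gap, rem, pw, j, 0]
    [0, c] o rfl
  change ExecLE _ _ _ (St fm [n, d, r, δ, 0, 1, 0, 0, 0, 0, 0, 0, 0, 0, pm, h₁, d₁, D, N, idx, v, p,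
    gap, rem, pw, j, n - j] [0, c] o) at e1
  have e2 := exec_freeProg fm o c n d r δ pm h₁ d₁ D N idx v p gap rem pw j (n - j) W hd₁
    (by omega) hv
  have e3 := exec_powerProg fm o c n d r δ pm h₁ d₁ D N idx v p gap rem pw j (n - j) W hp hpw hpD
  -- The nested branches evaluate the test of `scan`; register 26 holds the number `n - j` of
  -- coordinates still to print.
  by_cases h1 : 0 < rem
  · by_cases h2 : rem < n - j
    · by_cases h3 : gap < 1
      · rw [if_pos ⟨h1, Or.inr (by omega)⟩]
        exact (e1.seq (.ifLt_pos (x := 4) (y := 23) h1 (.ifLt_pos (x := 23) (y := 26) h2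
          (.ifLt_pos (x := 22) (y := 5) h3 e2)))).mono (by
          simp only [List.length_cons, List.length_nil]; omega)
      · rw [if_neg (by omega)]
        exact (e1.seq (.ifLt_pos (x := 4) (y := 23) h1 (.ifLt_pos (x := 23) (y := 26) h2
          (.ifLt_neg (x := 22) (y := 5) h3 e3)))).mono (by
          simp only [List.length_cons, List.length_nil]; omega)
    · rw [if_pos ⟨h1, Or.inl (by omega)⟩]
      exact (e1.seq (.ifLt_pos (x := 4) (y := 23) h1 (.ifLt_neg (x := 23) (y := 26) h2 e2))).mono
        (by
          simp only [List.length_cons, List.length_nil]; omega)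
  · rw [if_neg (by omega)]
    exact (e1.seq (.ifLt_neg (x := 4) (y := 23) h1 e3)).mono (by
      simp only [List.length_cons, List.length_nil]; omega)

/-- Induction on the number `m` of coordinates still to print. The final decoding registers are left
unspecified because `pointProg` clears them. -/
theorem exec_coordLoop (fm : ℕ → L) (c : L) (n d r δ pm h₁ d₁ D N idx p W : ℕ) (hd₁ : 0 < d₁)
    (hp : 0 < p) (hpW : p ≤ W) (hpD : p * D ≤ W) (m : ℕ) :
    ∀ (v gap rem pw : ℕ) (o : List L), m ≤ n → v ≤ W → pw ≤ p →
    ∃ v' gap' rem' pw', ExecLE (.whileLt 25 0 coordProg)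
      (St fm [n, d, r, δ, 0, 1, 0, 0, 0, 0, 0, 0, 0, 0, pm, h₁, d₁, D, N, idx, v, p, gap, rem, pw,
        n - m, 0] [0, c] o) (m * (12 * W + 61) + 1)
      (St fm [n, d, r, δ, 0, 1, 0, 0, 0, 0, 0, 0, 0, 0, pm, h₁, d₁, D, N, idx, v', p, gap', rem',
        pw', n, 0] [0, c] (o ++ scan n d₁ D p (fun t => fm (h₁ + t)) c m v gap rem pw)) := by
  induction m with
  | zero =>
    intro v gap rem pw o _ _ _
    refine ⟨v, gap, rem, pw, ?_⟩
    rw [scan, List.append_nil, Nat.sub_zero]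
    exact (ExecLE.while_done (lt_irrefl n)).mono (by omega)
  | succ m ih =>
    intro v gap rem pw o hm hv hpw
    have hpwD : pw * D ≤ W := (Nat.mul_le_mul_right _ hpw).trans hpD
    have e1 := exec_coordProg fm o c n d r δ pm h₁ d₁ D N idx v p gap rem pw (n - (m + 1)) W hd₁ hp
      (by omega) hv (hpw.trans hpW) hpwD
    have hsub : n - (n - (m + 1)) = m + 1 := by omega
    have hsub' : n - (m + 1) + 1 = n - m := by omega
    rw [hsub, hsub'] at e1
    rw [scan]
    have hlt : n - (m + 1) < n := by omega
    split_ifs with h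
    · rw [if_pos h] at e1
      obtain ⟨v', gap', rem', pw', e2⟩ := ih (v / d₁ / n) (v / d₁ % n) (rem - 1) pw
        (o ++ [fm (h₁ + v % d₁)]) (by omega)
        ((Nat.div_le_self _ _).trans ((Nat.div_le_self _ _).trans hv)) hpw
      refine ⟨v', gap', rem', pw', ?_⟩
      rw [List.append_assoc, List.singleton_append] at e2
      exact (ExecLE.while_step hlt e1 e2).mono (by rw [Nat.succ_mul m (12 * W + 61)]; omega)
    · rw [if_neg h] at e1
      obtain ⟨v', gap', rem', pw', e2⟩ := ih v (gap - 1) rem (pw * D % p)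
        (o ++ [c ^ (pw * D % p)]) (by omega) hv (Nat.mod_lt _ hp).le
      refine ⟨v', gap', rem', pw', ?_⟩
      rw [List.append_assoc, List.singleton_append] at e2
      exact (ExecLE.while_step hlt e1 e2).mono (by rw [Nat.succ_mul m (12 * W + 61)]; omega)

theorem exec_pointProg (fm : ℕ → L) (o : List L) (n d r δ pm h₁ d₁ D N idx W : ℕ)
    (hd₁ : 0 < d₁) (hn : 0 < n) (hh₁ : 0 < h₁) (hpm : 0 < pm) (hpmW : pm ≤ W) (hpD : pm * D ≤ W)
    (hidx : idx ≤ W) :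
    ExecLE pointProg
      (St fm [n, d, r, δ, 0, 1, 0, 0, 0, 0, 0, 0, 0, 0, pm, h₁, d₁, D, N, idx, 0, 0, 0, 0, 0, 0, 0]
        [0, 0] o) (12 * W + n * (12 * W + 61) + 60)
      (St fm [n, d, r, δ, 0, 1, 0, 0, 0, 0, 0, 0, 0, 0, pm, h₁, d₁, D, N, idx + 1, 0, 0, 0, 0, 0, 0,
        0] [0, 0] (o ++ codePoint n r d₁ D h₁ pm fm idx)) := by
  have e1 := ExecLE.block fm [.add 6 19 4, .add 7 14 4]
    [n, d, r, δ, 0, 1, 0, 0, 0, 0, 0, 0, 0, 0, pm, h₁, d₁, D, N, idx, 0, 0, 0, 0, 0, 0, 0]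
    [0, 0] o rfl
  have e2 := exec_divProg fm [0, 0] o n d r δ idx pm 0 0
    [0, 0, 0, 0, pm, h₁, d₁, D, N, idx, 0, 0, 0, 0, 0, 0, 0] hpm
  have e3 := ExecLE.block fm [.add 21 9 5, .add 6 8 4, .add 7 15 4]
    [n, d, r, δ, 0, 1, idx, pm, idx / pm, idx % pm, 0, 0, 0, 0, pm, h₁, d₁, D, N, idx, 0, 0, 0, 0,
      0, 0, 0] [0, 0] o rfl
  have e4 := exec_divProg fm [0, 0] o n d r δ (idx / pm) h₁ (idx / pm) (idx % pm)
    [0, 0, 0, 0, pm, h₁, d₁, D, N, idx, 0, idx % pm + 1, 0, 0, 0, 0, 0] hh₁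
  have e5 := ExecLE.block fm [.fload 1 9, .add 6 8 4, .add 7 0 4]
    [n, d, r, δ, 0, 1, idx / pm, h₁, idx / pm / h₁, idx / pm % h₁, 0, 0, 0, 0, pm, h₁, d₁, D, N,
      idx, 0, idx % pm + 1, 0, 0, 0, 0, 0] [0, 0] o rfl
  have e6 := exec_divProg fm [0, fm (idx / pm % h₁)] o n d r δ (idx / pm / h₁) n (idx / pm / h₁)
    (idx / pm % h₁) [0, 0, 0, 0, pm, h₁, d₁, D, N, idx, 0, idx % pm + 1, 0, 0, 0, 0, 0] hn
  have e7 := ExecLE.block fm [.add 20 8 4, .add 22 9 4, .add 23 2 4, .set 24 1, .set 25 0, .set 6 0,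
    .set 7 0, .set 8 0, .set 9 0]
    [n, d, r, δ, 0, 1, idx / pm / h₁, n, idx / pm / h₁ / n, idx / pm / h₁ % n, 0, 0, 0, 0, pm, h₁,
      d₁, D, N, idx, 0, idx % pm + 1, 0, 0, 0, 0, 0] [0, fm (idx / pm % h₁)] o rfl
  have hp : idx % pm + 1 ≤ pm := Nat.mod_lt _ hpm
  have l1 : idx / pm ≤ W := (Nat.div_le_self _ _).trans hidx
  have l2 : idx / pm / h₁ ≤ W := (Nat.div_le_self _ _).trans l1
  have l3 : idx / pm / h₁ / n ≤ W := (Nat.div_le_self _ _).trans l2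
  obtain ⟨v', gap', rem', pw', e8⟩ := exec_coordLoop fm (fm (idx / pm % h₁)) n d r δ pm h₁ d₁ D N idx
    (idx % pm + 1) W hd₁ (Nat.succ_pos _) (hp.trans hpmW) ((Nat.mul_le_mul_right _ hp).trans hpD) n
    (idx / pm / h₁ / n) (idx / pm / h₁ % n) r 1 o le_rfl l3 (by omega)
  rw [Nat.sub_self] at e8
  have e9 := ExecLE.block fm [.set 20 0, .set 21 0, .set 22 0, .set 23 0, .set 24 0, .set 25 0,
    .fzero 1, .add 19 19 5]
    [n, d, r, δ, 0, 1, 0, 0, 0, 0, 0, 0, 0, 0, pm, h₁, d₁, D, N, idx, v', idx % pm + 1, gap', rem',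
      pw', n, 0] [0, fm (idx / pm % h₁)] (o ++ codePoint n r d₁ D h₁ pm fm idx) rfl
  exact (e1.seq (e2.seq (e3.seq (e4.seq (e5.seq (e6.seq (e7.seq (e8.seq e9)))))))).mono (by
    simp only [List.length_cons, List.length_nil]; omega)

theorem exec_paramProg (fm : ℕ → L) (n d r δ W : ℕ) (hδ : 0 < δ) (ha : δ ^ r ≤ W)
    (hQ : (n + δ ^ r) ^ (8 * (δ ^ r * δ)) ≤ W) :
    ExecLE paramProg
      (St fm [n, d, r, δ, 0, 0, 0, 0, 0, 0, 0, 0, 0, 0, 0, 0, 0, 0, 0, 0, 0, 0, 0, 0, 0, 0, 0]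
        [0, 0] []) (4 * W + (r + 8 * (δ ^ r * δ)) * (4 * W + 16) + 40)
      (St fm [n, d, r, δ, 0, 1, 0, 0, 0, 0, n + δ ^ r, 8 * (δ ^ r * δ),
        (n + δ ^ r) ^ (8 * (δ ^ r * δ)), 0, 0, δ ^ r, 0, δ ^ r * δ + 1, 0, 0, 0, 0, 0, 0, 0, 0, 0]
        [0, 0] []) := by
  have ha0 : 0 < δ ^ r := Nat.pow_pos hδ
  have e1 := ExecLE.block fm [.set 5 1, .add 10 3 4, .add 11 2 4]
    [n, d, r, δ, 0, 0, 0, 0, 0, 0, 0, 0, 0, 0, 0, 0, 0, 0, 0, 0, 0, 0, 0, 0, 0, 0, 0] [0, 0]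
    ([] : List L) rfl
  have e2 := exec_powProg fm [0, 0] ([] : List L) n d r δ δ r 0 0 W
    [0, 0, 0, 0, 0, 0, 0, 0, 0, 0, 0, 0, 0] hδ ha
  generalize δ ^ r = a at *
  have e3 := ExecLE.block fm [.add 15 12 4, .add 6 12 4, .add 7 3 4]
    [n, d, r, δ, 0, 1, 0, 0, 0, 0, δ, r, a, 0, 0, 0, 0, 0, 0, 0, 0, 0, 0, 0, 0, 0, 0] [0, 0]
    ([] : List L) rfl
  have e4 := exec_mulProg fm [0, 0] ([] : List L) n d r δ a δ 0 0
    [δ, r, a, 0, 0, a, 0, 0, 0, 0, 0, 0, 0, 0, 0, 0, 0]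
  generalize a * δ = b at *
  have e5 := ExecLE.block fm [.add 17 8 5, .add 10 0 15, .add 11 8 8, .add 11 11 11, .add 11 11 11,
    .set 6 0, .set 7 0, .set 8 0]
    [n, d, r, δ, 0, 1, a, δ, b, 0, δ, r, a, 0, 0, a, 0, 0, 0, 0, 0, 0, 0, 0, 0, 0, 0] [0, 0]
    ([] : List L) rfl
  have h8 : b + b + (b + b) + (b + b + (b + b)) = 8 * b := by ring
  change ExecLE _ _ _ (St fm [n, d, r, δ, 0, 1, 0, 0, 0, 0, n + a,
    b + b + (b + b) + (b + b + (b + b)), a, 0, 0, a, 0, b + 1, 0, 0, 0, 0, 0, 0, 0, 0, 0] [0, 0]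
    ([] : List L)) at e5
  rw [h8] at e5
  have e6 := exec_powProg fm [0, 0] ([] : List L) n d r δ (n + a) (8 * b) a 0 W
    [0, a, 0, b + 1, 0, 0, 0, 0, 0, 0, 0, 0, 0] (by omega) hQ
  have t := Nat.add_mul r (8 * b) (4 * W + 16)
  exact (e1.seq (e2.seq (e3.seq (e4.seq (e5.seq e6))))).mono (by
    simp only [List.length_cons, List.length_nil]; omega)

theorem exec_pMaxProg (fm : ℕ → L) (n d r δ E F Q a D W : ℕ) (hl : Nat.clog 2 D ≤ W) :
    ExecLE pMaxProg
      (St fm [n, d, r, δ, 0, 1, 0, 0, 0, 0, E, F, Q, 0, 0, a, 0, D, 0, 0, 0, 0, 0, 0, 0, 0, 0]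
        [0, 0] []) (12 * W + 40)
      (St fm [n, d, r, δ, 0, 1, Nat.clog 2 D, Nat.clog 2 D * Q,
        Nat.clog 2 D * (Nat.clog 2 D * Q), 0, E, F, Q, 0, Nat.clog 2 D * (Nat.clog 2 D * Q) + 1, a,
        Nat.clog 2 D, D, 0, 0, 0, 0, 0, 0, 0, 0, 0] [0, 0] []) := by
  have e1 := ExecLE.block fm [.add 14 12 4, .add 6 17 4]
    [n, d, r, δ, 0, 1, 0, 0, 0, 0, E, F, Q, 0, 0, a, 0, D, 0, 0, 0, 0, 0, 0, 0, 0, 0] [0, 0]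
    ([] : List L) rfl
  have e2 := exec_clogProg fm [0, 0] ([] : List L) n d r δ D 0 0
    [0, E, F, Q, 0, Q, a, 0, D, 0, 0, 0, 0, 0, 0, 0, 0, 0]
  generalize Nat.clog 2 D = l at *
  generalize 2 ^ l = x at *
  have e3 := ExecLE.block fm [.add 16 8 4, .add 6 16 4, .add 7 14 4]
    [n, d, r, δ, 0, 1, D, x, l, 0, E, F, Q, 0, Q, a, 0, D, 0, 0, 0, 0, 0, 0, 0, 0, 0]
    [0, 0] ([] : List L) rfl
  have e4 := exec_mulProg fm [0, 0] ([] : List L) n d r δ l Q l 0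
    [E, F, Q, 0, Q, a, l, D, 0, 0, 0, 0, 0, 0, 0, 0, 0]
  generalize l * Q = y at *
  have e5 := ExecLE.block fm [.add 6 16 4, .add 7 8 4]
    [n, d, r, δ, 0, 1, l, Q, y, 0, E, F, Q, 0, Q, a, l, D, 0, 0, 0, 0, 0, 0, 0, 0, 0]
    [0, 0] ([] : List L) rfl
  have e6 := exec_mulProg fm [0, 0] ([] : List L) n d r δ l y y 0
    [E, F, Q, 0, Q, a, l, D, 0, 0, 0, 0, 0, 0, 0, 0, 0]
  generalize l * y = z at *
  have e7 := ExecLE.block fm [.add 14 8 5]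
    [n, d, r, δ, 0, 1, l, y, z, 0, E, F, Q, 0, Q, a, l, D, 0, 0, 0, 0, 0, 0, 0, 0, 0]
    [0, 0] ([] : List L) rfl
  exact (e1.seq (e2.seq (e3.seq (e4.seq (e5.seq (e6.seq e7)))))).mono (by
    simp only [List.length_cons, List.length_nil]; omega)

theorem exec_cardProg (fm : ℕ → L) (n d r δ x y z E F Q pm a l D W : ℕ) (hr : r ≤ W)
    (hra : r * a ≤ W) :
    ExecLE cardProg
      (St fm [n, d, r, δ, 0, 1, x, y, z, 0, E, F, Q, 0, pm, a, l, D, 0, 0, 0, 0, 0, 0, 0, 0, 0]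
        [0, 0] []) (8 * W + 30)
      (St fm [n, d, r, δ, 0, 1, r * a, pm, r * a * pm, 0, E, F, Q, 0, pm, r * a * pm, d + 1, D,
        0, 0, 0, 0, 0, 0, 0, 0, 0] [0, 0] []) := by
  have e1 := ExecLE.block fm [.add 6 2 4, .add 7 15 4]
    [n, d, r, δ, 0, 1, x, y, z, 0, E, F, Q, 0, pm, a, l, D, 0, 0, 0, 0, 0, 0, 0, 0, 0] [0, 0]
    ([] : List L) rfl
  have e2 := exec_mulProg fm [0, 0] ([] : List L) n d r δ r a z 0
    [E, F, Q, 0, pm, a, l, D, 0, 0, 0, 0, 0, 0, 0, 0, 0]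
  generalize r * a = b at *
  have e3 := ExecLE.block fm [.add 6 8 4, .add 7 14 4]
    [n, d, r, δ, 0, 1, r, a, b, 0, E, F, Q, 0, pm, a, l, D, 0, 0, 0, 0, 0, 0, 0, 0, 0]
    [0, 0] ([] : List L) rfl
  have e4 := exec_mulProg fm [0, 0] ([] : List L) n d r δ b pm b 0
    [E, F, Q, 0, pm, a, l, D, 0, 0, 0, 0, 0, 0, 0, 0, 0]
  generalize b * pm = h₁ at *
  have e5 := ExecLE.block fm [.add 15 8 4, .add 16 1 5]
    [n, d, r, δ, 0, 1, b, pm, h₁, 0, E, F, Q, 0, pm, a, l, D, 0, 0, 0, 0, 0, 0, 0, 0, 0]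
    [0, 0] ([] : List L) rfl
  exact (e1.seq (e2.seq (e3.seq (e4.seq e5)))).mono (by
    simp only [List.length_cons, List.length_nil]; omega)

theorem exec_countProg (fm : ℕ → L) (n d r δ x y z E F Q pm h₁ d₁ D W : ℕ) (hn : 0 < n)
    (hd₁ : 0 < d₁) (hnW : n ≤ W) (hM : (n * d₁) ^ r ≤ W) (hMn : (n * d₁) ^ r * n ≤ W)
    (hMnh : (n * d₁) ^ r * n * h₁ ≤ W) :
    ExecLE countProg
      (St fm [n, d, r, δ, 0, 1, x, y, z, 0, E, F, Q, 0, pm, h₁, d₁, D, 0, 0, 0, 0, 0, 0, 0, 0, 0]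
        [0, 0] []) (16 * W + r * (4 * W + 16) + 70)
      (St fm [n, d, r, δ, 0, 1, 0, 0, 0, 0, 0, 0, 0, 0, pm, h₁, d₁, D,
        (n * d₁) ^ r * n * h₁ * pm, 0, 0, 0, 0, 0, 0, 0, 0] [0, 0] []) := by
  have e1 := ExecLE.block fm [.add 6 0 4, .add 7 16 4]
    [n, d, r, δ, 0, 1, x, y, z, 0, E, F, Q, 0, pm, h₁, d₁, D, 0, 0, 0, 0, 0, 0, 0, 0, 0] [0, 0]
    ([] : List L) rfl
  have e2 := exec_mulProg fm [0, 0] ([] : List L) n d r δ n d₁ z 0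
    [E, F, Q, 0, pm, h₁, d₁, D, 0, 0, 0, 0, 0, 0, 0, 0, 0]
  have hb : 0 < n * d₁ := Nat.mul_pos hn hd₁
  generalize n * d₁ = b at *
  have e3 := ExecLE.block fm [.add 10 8 4, .add 11 2 4, .set 6 0, .set 7 0, .set 8 0]
    [n, d, r, δ, 0, 1, n, d₁, b, 0, E, F, Q, 0, pm, h₁, d₁, D, 0, 0, 0, 0, 0, 0, 0, 0, 0] [0, 0]
    ([] : List L) rfl
  have e4 := exec_powProg fm [0, 0] ([] : List L) n d r δ b r Q 0 W
    [pm, h₁, d₁, D, 0, 0, 0, 0, 0, 0, 0, 0, 0] hb hM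
  generalize b ^ r = M at *
  have e5 := ExecLE.block fm [.add 6 12 4, .add 7 0 4]
    [n, d, r, δ, 0, 1, 0, 0, 0, 0, b, r, M, 0, pm, h₁, d₁, D, 0, 0, 0, 0, 0, 0, 0, 0, 0] [0, 0]
    ([] : List L) rfl
  have e6 := exec_mulProg fm [0, 0] ([] : List L) n d r δ M n 0 0
    [b, r, M, 0, pm, h₁, d₁, D, 0, 0, 0, 0, 0, 0, 0, 0, 0]
  generalize M * n = A at *
  have e7 := ExecLE.block fm [.add 6 8 4, .add 7 15 4]
    [n, d, r, δ, 0, 1, M, n, A, 0, b, r, M, 0, pm, h₁, d₁, D, 0, 0, 0, 0, 0, 0, 0, 0, 0] [0, 0]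
    ([] : List L) rfl
  have e8 := exec_mulProg fm [0, 0] ([] : List L) n d r δ A h₁ A 0
    [b, r, M, 0, pm, h₁, d₁, D, 0, 0, 0, 0, 0, 0, 0, 0, 0]
  generalize A * h₁ = B at *
  have e9 := ExecLE.block fm [.add 6 8 4, .add 7 14 4]
    [n, d, r, δ, 0, 1, A, h₁, B, 0, b, r, M, 0, pm, h₁, d₁, D, 0, 0, 0, 0, 0, 0, 0, 0, 0] [0, 0]
    ([] : List L) rfl
  have e10 := exec_mulProg fm [0, 0] ([] : List L) n d r δ B pm B 0
    [b, r, M, 0, pm, h₁, d₁, D, 0, 0, 0, 0, 0, 0, 0, 0, 0]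
  generalize B * pm = N at *
  have e11 := ExecLE.block fm [.add 18 8 4, .set 6 0, .set 7 0, .set 8 0, .set 10 0, .set 11 0,
    .set 12 0]
    [n, d, r, δ, 0, 1, B, pm, N, 0, b, r, M, 0, pm, h₁, d₁, D, 0, 0, 0, 0, 0, 0, 0, 0, 0] [0, 0]
    ([] : List L) rfl
  exact (e1.seq (e2.seq (e3.seq (e4.seq (e5.seq (e6.seq (e7.seq (e8.seq (e9.seq (e10.seq
    e11)))))))))).mono (by simp only [List.length_cons, List.length_nil]; omega)

/-- The number of codes of points. -/
def numCodes (n d r δ : ℕ) : ℕ :=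
  (n * (d + 1)) ^ r * n * (δ ^ r * r * pMax n r δ) * pMax n r δ

/-- The numbers whose size determines the cost are factors of `numCodes`, or of `pMax - 1`, and so
at most `W`. The exponent `8 * δ ^ (r + 1)`, the number of rounds of `powProg`, is bounded
separately. -/
theorem exec_setupProg (fm : ℕ → L) (n d r δ W : ℕ) (hn : 0 < n) (hδ : 0 < δ) (hr : 0 < r)
    (hexp : 8 * δ ^ (r + 1) ≤ W) (hNW : numCodes n d r δ ≤ W) :
    ExecLE setupProg
      (St fm [n, d, r, δ, 0, 0, 0, 0, 0, 0, 0, 0, 0, 0, 0, 0, 0, 0, 0, 0, 0, 0, 0, 0, 0, 0, 0]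
        [0, 0] []) (12 * (W * W) + 100 * W + 200)
      (St fm [n, d, r, δ, 0, 1, 0, 0, 0, 0, 0, 0, 0, 0, pMax n r δ, δ ^ r * r * pMax n r δ, d + 1,
        paramD r δ, numCodes n d r δ, 0, 0, 0, 0, 0, 0, 0, 0] [0, 0] []) := by
  have hpm : pMax n r δ = Nat.clog 2 (δ ^ r * δ + 1) * (Nat.clog 2 (δ ^ r * δ + 1) *
      (n + δ ^ r) ^ (8 * (δ ^ r * δ))) + 1 := by
    rw [pMax, paramD, pow_succ δ r]; ring
  have ha0 : 0 < δ ^ r := Nat.pow_pos hδ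
  have hpm0 : 0 < pMax n r δ := Nat.succ_pos _
  have hM0 : 0 < (n * (d + 1)) ^ r := Nat.pow_pos (Nat.mul_pos hn (Nat.succ_pos d))
  have hl0 : 0 < Nat.clog 2 (δ ^ r * δ + 1) :=
    Nat.clog_pos (by norm_num) (by have := Nat.mul_pos ha0 hδ; omega)
  have hh0 : 0 < δ ^ r * r * pMax n r δ := Nat.mul_pos (Nat.mul_pos ha0 hr) hpm0
  have w0 : pMax n r δ ≤ W := (Nat.le_mul_of_pos_left _ (Nat.mul_pos (Nat.mul_pos hM0 hn) hh0)).trans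
    hNW
  have w6 : (n * (d + 1)) ^ r * n * (δ ^ r * r * pMax n r δ) ≤ W :=
    (Nat.le_mul_of_pos_right _ hpm0).trans hNW
  have w7 : (n * (d + 1)) ^ r * n ≤ W := (Nat.le_mul_of_pos_right _ hh0).trans w6
  have w8 : (n * (d + 1)) ^ r ≤ W := (Nat.le_mul_of_pos_right _ hn).trans w7
  have w1 : n ≤ W := (Nat.le_mul_of_pos_left _ hM0).trans w7
  have w9 : δ ^ r * r * pMax n r δ ≤ W := (Nat.le_mul_of_pos_left _ (Nat.mul_pos hM0 hn)).trans w6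
  have w10 : δ ^ r * r ≤ W := (Nat.le_mul_of_pos_right _ hpm0).trans w9
  have w11 : δ ^ r ≤ W := (Nat.le_mul_of_pos_right _ hr).trans w10
  have w12 : r ≤ W := (Nat.le_mul_of_pos_left _ ha0).trans w10
  have w2 : Nat.clog 2 (δ ^ r * δ + 1) * (Nat.clog 2 (δ ^ r * δ + 1) *
    (n + δ ^ r) ^ (8 * (δ ^ r * δ))) ≤ W := by omega
  have w3 := (Nat.le_mul_of_pos_left _ hl0).trans w2
  have w4 := (Nat.le_mul_of_pos_left _ hl0).trans w3
  have w5 := (Nat.le_mul_of_pos_right (Nat.clog 2 (δ ^ r * δ + 1))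
    (Nat.pow_pos (n := 8 * (δ ^ r * δ)) (by omega : 0 < n + δ ^ r))).trans w3
  rw [mul_comm (δ ^ r) r] at *
  rw [pow_succ] at hexp
  have e1 := exec_paramProg fm n d r δ W hδ w11 w4
  have e2 := exec_pMaxProg fm n d r δ (n + δ ^ r) (8 * (δ ^ r * δ))
    ((n + δ ^ r) ^ (8 * (δ ^ r * δ))) (δ ^ r) (δ ^ r * δ + 1) W w5
  rw [← hpm] at e2
  have e3 := exec_cardProg fm n d r δ (Nat.clog 2 (δ ^ r * δ + 1)) (Nat.clog 2 (δ ^ r * δ + 1) *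
    (n + δ ^ r) ^ (8 * (δ ^ r * δ))) (Nat.clog 2 (δ ^ r * δ + 1) * (Nat.clog 2 (δ ^ r * δ + 1) *
    (n + δ ^ r) ^ (8 * (δ ^ r * δ)))) (n + δ ^ r) (8 * (δ ^ r * δ))
    ((n + δ ^ r) ^ (8 * (δ ^ r * δ))) (pMax n r δ) (δ ^ r) (Nat.clog 2 (δ ^ r * δ + 1))
    (δ ^ r * δ + 1) W w12 w10
  have e4 := exec_countProg fm n d r δ (r * δ ^ r) (pMax n r δ) (r * δ ^ r * pMax n r δ)
    (n + δ ^ r) (8 * (δ ^ r * δ)) ((n + δ ^ r) ^ (8 * (δ ^ r * δ))) (pMax n r δ)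
    (r * δ ^ r * pMax n r δ) (d + 1) (δ ^ r * δ + 1) W hn (Nat.succ_pos d) w1 w8 w7 w6
  have t1 : r * (4 * W + 16) ≤ W * (4 * W + 16) := Nat.mul_le_mul_right _ w12
  have t2 : (r + 8 * (δ ^ r * δ)) * (4 * W + 16) ≤ (W + W) * (4 * W + 16) :=
    Nat.mul_le_mul_right _ (Nat.add_le_add w12 hexp)
  have t3 : W * (4 * W + 16) = 4 * (W * W) + 16 * W := by ring
  rw [Nat.add_mul W W, t3] at t2
  rw [t3] at t1
  rw [numCodes, mul_comm (δ ^ r) r, paramD, pow_succ δ r]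
  exact (e1.seq (e2.seq (e3.seq e4))).mono (by omega)

end Program

/-! ### Correctness and the time bound -/

section Construction

variable {L : Type u} [Field L]

theorem initState_eq_St (n d r δ : ℕ) (l : List L) :
    initState n d r δ l = St (fun k => l.getD k 0)
      [n, d, r, δ, 0, 0, 0, 0, 0, 0, 0, 0, 0, 0, 0, 0, 0, 0, 0, 0, 0, 0, 0, 0, 0, 0, 0] [0, 0] [] := by
  have h1 : (fun k => [n, d, r, δ].getD k 0) = regs
      [n, d, r, δ, 0, 0, 0, 0, 0, 0, 0, 0, 0, 0, 0, 0, 0, 0, 0, 0, 0, 0, 0, 0, 0, 0, 0] := by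
    funext k
    rcases lt_or_ge k 27 with hk | hk
    · interval_cases k <;> rfl
    · rw [regs, List.getD_eq_default _ _ (by simp; omega), List.getD_eq_default _ _ (by simpa)]
  have h2 : (fun _ => 0 : ℕ → L) = regs [0, 0] := by
    funext k
    rcases k with _ | _ | k <;> rfl
  rw [initState, St, h1, h2]

theorem exec_hittingSetProg (fm : ℕ → L) (n d r δ W : ℕ) (hn : 0 < n) (hδ : 0 < δ) (hr : 0 < r)
    (hexp : 8 * δ ^ (r + 1) ≤ W) (hN : numCodes n d r δ ≤ W)
    (hpD : pMax n r δ * paramD r δ ≤ W) (hpm : pMax n r δ ≤ W) (hnW : n ≤ W) :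
    ExecLE hittingSetProg
      (St fm [n, d, r, δ, 0, 0, 0, 0, 0, 0, 0, 0, 0, 0, 0, 0, 0, 0, 0, 0, 0, 0, 0, 0, 0, 0, 0]
        [0, 0] []) (459 * W ^ 3)
      (St fm [n, d, r, δ, 0, 1, 0, 0, 0, 0, 0, 0, 0, 0, pMax n r δ, δ ^ r * r * pMax n r δ, d + 1,
        paramD r δ, numCodes n d r δ, numCodes n d r δ, 0, 0, 0, 0, 0, 0, 0] [0, 0]
        ((List.range (numCodes n d r δ)).map
          (codePoint n r (d + 1) (paramD r δ) (δ ^ r * r * pMax n r δ) (pMax n r δ) fm)).flatten) := by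
  have hpm0 : 0 < pMax n r δ := Nat.succ_pos _
  have hh₁ : 0 < δ ^ r * r * pMax n r δ := Nat.mul_pos (Nat.mul_pos (Nat.pow_pos hδ) hr) hpm0
  have e1 := exec_setupProg fm n d r δ W hn hδ hr hexp hN
  generalize paramD r δ = D at *
  generalize δ ^ r * r * pMax n r δ = h₁ at *
  generalize pMax n r δ = pm at *
  generalize numCodes n d r δ = N at *
  have e2 := ExecLE.whileLt (x := 19) (y := 18) (P := pointProg)
    (fun k => St fm [n, d, r, δ, 0, 1, 0, 0, 0, 0, 0, 0, 0, 0, pm, h₁, d + 1, D, N, k, 0, 0, 0, 0, 0,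
      0, 0] [0, 0] ((List.range k).map (codePoint n r (d + 1) D h₁ pm fm)).flatten) N
    (12 * W + n * (12 * W + 61) + 60) (fun k hk => hk) (lt_irrefl N) (fun k hk => by
      rw [List.range_succ, List.map_append, List.flatten_append, List.map_singleton,
        List.flatten_singleton]
      exact exec_pointProg fm _ n d r δ pm h₁ (d + 1) D N k W (Nat.succ_pos d) hn hh₁ hpm0 hpm hpD
        (hk.le.trans hN))
  -- The constant is the sum of the coefficients of the cost as a polynomial in `W`: `12 + 73 + 61 +
  -- 1` for the main loop and `12 + 100 + 200` for the setup.
  refine (e1.seq e2).mono ?_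
  have h1 : N * (12 * W + n * (12 * W + 61) + 60 + 1) ≤ W * (12 * W + W * (12 * W + 61) + 60 + 1) :=
    Nat.mul_le_mul hN (by have := Nat.mul_le_mul_right (12 * W + 61) hnW; omega)
  have hW : 1 ≤ W := hn.trans_le hnW
  have h2 : W ≤ W ^ 3 := Nat.le_self_pow (by norm_num) W
  have h3 : W * W ≤ W ^ 3 := by rw [← sq]; exact Nat.pow_le_pow_right hW (by norm_num)
  have h4 : W * (12 * W + W * (12 * W + 61) + 60 + 1) = 12 * W ^ 3 + 73 * (W * W) + 61 * W := by ring
  omega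

theorem constructs_hittingSetProg {n d r δ T : ℕ} (hr : 1 ≤ r) (hrn : r ≤ n) (hδ : 1 ≤ δ)
    {H₁ H₂ : Finset L} (hH₁ : H₁.card = δ ^ r * r * pMax n r δ) (hH₂ : H₂.card = d + 1)
    {l₁ l₂ : List L} (hl₁ : l₁.Nodup) (hm₁ : ∀ c, c ∈ l₁ ↔ c ∈ H₁) (hl₂ : l₂.Nodup)
    (hm₂ : ∀ c, c ∈ l₂ ↔ c ∈ H₂)
    (hT : 459 * (numCodes n d r δ * paramD r δ) ^ 3 ≤ T) :
    ∃ t ≤ T, Constructs hittingSetProg n d r δ (l₁ ++ l₂) t (hittingSet n r δ H₁ H₂) := by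
  classical
  have hlen : ∀ (l : List L) (H : Finset L), l.Nodup → (∀ c, c ∈ l ↔ c ∈ H) → l.length = H.card := by
    intro l H hl hm
    rw [← List.toFinset_card_of_nodup hl]
    congr 1
    ext c
    rw [List.mem_toFinset, hm]
  -- Without repetitions the first list has length `h₁`, so the second one starts at the address
  -- `h₁` that the program computes.
  have hlen₁ := (hlen l₁ H₁ hl₁ hm₁).trans hH₁
  have hlen₂ := (hlen l₂ H₂ hl₂ hm₂).trans hH₂
  have hmem : ∀ (l : List L) (c : L), c ∈ l ↔ ∃ t < l.length, l.getD t 0 = c := by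
    intro l c
    rw [List.mem_iff_getElem]
    refine exists_congr fun t => ⟨fun ⟨ht, h⟩ => ⟨ht, ?_⟩, fun ⟨ht, h⟩ => ⟨ht, ?_⟩⟩
    · rw [List.getD_eq_getElem _ _ ht, h]
    · rw [← h, List.getD_eq_getElem _ _ ht]
  have hn : 0 < n := by omega
  have hpm0 : 0 < pMax n r δ := Nat.succ_pos _
  have hh₁ : 0 < δ ^ r * r * pMax n r δ := Nat.mul_pos (Nat.mul_pos (Nat.pow_pos hδ) hr) hpm0
  have hD0 : 0 < paramD r δ := Nat.succ_pos _
  have hM : 0 < (n * (d + 1)) ^ r := Nat.pow_pos (Nat.mul_pos hn (Nat.succ_pos d))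
  have hpmN : pMax n r δ ≤ numCodes n d r δ :=
    Nat.le_mul_of_pos_left _ (Nat.mul_pos (Nat.mul_pos hM hn) hh₁)
  have hnN : n ≤ numCodes n d r δ :=
    (Nat.le_mul_of_pos_left _ hM).trans
      ((Nat.le_mul_of_pos_right _ hh₁).trans (Nat.le_mul_of_pos_right _ hpm0))
  have hNW : numCodes n d r δ ≤ numCodes n d r δ * paramD r δ := Nat.le_mul_of_pos_right _ hD0
  have hexp : 8 * δ ^ (r + 1) ≤ pMax n r δ := by
    have hl : 0 < Nat.clog 2 (paramD r δ) :=
      Nat.clog_pos (by norm_num) (Nat.succ_le_succ (Nat.pow_pos hδ))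
    calc 8 * δ ^ (r + 1) ≤ 2 ^ (8 * δ ^ (r + 1)) := Nat.lt_two_pow_self.le
      _ ≤ (n + δ ^ r) ^ (8 * δ ^ (r + 1)) :=
        Nat.pow_le_pow_left (Nat.add_le_add hn (Nat.pow_pos hδ)) _
      _ ≤ (n + δ ^ r) ^ (8 * δ ^ (r + 1)) * Nat.clog 2 (paramD r δ) ^ 2 :=
        Nat.le_mul_of_pos_right _ (Nat.pow_pos hl)
      _ ≤ pMax n r δ := Nat.le_succ _
  -- The bound `W = numCodes * paramD` also covers the products `pw * D` that occur before reduction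
  -- modulo `p`.
  obtain ⟨t, ht, he⟩ := exec_hittingSetProg (fun k => (l₁ ++ l₂).getD k 0) n d r δ
    (numCodes n d r δ * paramD r δ) hn hδ hr
    (hexp.trans (hpmN.trans hNW)) hNW
    (Nat.mul_le_mul_right _ hpmN) (hpmN.trans hNW) (hnN.trans hNW)
  rw [← initState_eq_St] at he
  have hpts : ∀ idx, List.ofFn (fun j : Fin n => (codePoint n r (d + 1) (paramD r δ)
      (δ ^ r * r * pMax n r δ) (pMax n r δ) (fun k => (l₁ ++ l₂).getD k 0) idx).getD j 0) =
      codePoint n r (d + 1) (paramD r δ) (δ ^ r * r * pMax n r δ) (pMax n r δ)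
        (fun k => (l₁ ++ l₂).getD k 0) idx := by
    intro idx
    refine List.ext_getElem (by rw [List.length_ofFn, length_codePoint]) fun i h1 h2 => ?_
    rw [List.getElem_ofFn, List.getD_eq_getElem _ _ h2]
  refine ⟨t, ht.trans hT, _, (List.range (numCodes n d r δ)).map fun idx (j : Fin n) =>
    (codePoint n r (d + 1) (paramD r δ) (δ ^ r * r * pMax n r δ) (pMax n r δ)
      (fun k => (l₁ ++ l₂).getD k 0) idx).getD j 0, he, ?_, fun x => ?_⟩
  · rw [List.map_map]
    exact congrArg List.flatten (List.map_congr_left fun idx _ => (hpts idx).symm)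
  · rw [mem_hittingSet_iff_codePoint (d := d) hr hrn (fm := fun k => (l₁ ++ l₂).getD k 0) hh₁
      (fun c => ?_) fun c => ?_, List.mem_map]
    · refine exists_congr fun idx => and_congr List.mem_range ?_
      conv_rhs => rw [← hpts idx, List.ofFn_inj]
      exact eq_comm
    · rw [← hm₁, hmem, hlen₁]
      refine exists_congr fun t => and_congr_right fun ht => ?_
      rw [List.getD_append _ _ _ _ (by omega)]
    · rw [← hm₂, hmem, hlen₂]
      refine exists_congr fun t => and_congr_right fun ht => ?_
      rw [List.getD_append_right _ _ _ _ (by omega), hlen₁, Nat.add_sub_cancel_left]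

/-- With `B = d * r * δ * n + 2` and `Y = B ^ (r * δ ^ (r + 1))`, each factor is at most a power of
`Y`: `D ≤ Y ^ 3` and `pMax ≤ Y ^ 23`, so `numCodes * D ≤ Y ^ (2 + 1 + 1 + 1 + 23 + 23 + 3) = Y ^
54`. The cube and `459 ≤ 2 ^ 9 ≤ Y ^ 9` give the exponent `3 * 54 + 9 = 171`. -/
theorem time_bound {n d r δ : ℕ} (hd : 1 ≤ d) (hr : 1 ≤ r) (hrn : r ≤ n) (hδ : 1 ≤ δ) :
    459 * (numCodes n d r δ * paramD r δ) ^ 3 ≤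
      ((d * r * δ * n + 2) ^ 171) ^ (r * δ ^ (r + 1)) := by
  have hn : 1 ≤ n := hr.trans hrn
  have hX : ∀ a b c, a = b * c → 0 < a → b ≤ a := fun a b c h h0 =>
    Nat.le_of_dvd h0 ⟨c, h⟩
  have hpos : 0 < d * r * δ * n := by positivity
  have hdX := hX (d * r * δ * n) d (r * δ * n) (by ring) hpos
  have hrX := hX (d * r * δ * n) r (d * δ * n) (by ring) hpos
  have hδX := hX (d * r * δ * n) δ (d * r * n) (by ring) hpos
  have hnX := hX (d * r * δ * n) n (d * r * δ) (by ring) hpos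
  obtain ⟨B, hB⟩ : ∃ B, B = d * r * δ * n + 2 := ⟨_, rfl⟩
  rw [← hB, ← pow_mul]
  have hB2 : 2 ≤ B := by omega
  have hB1 : 1 ≤ B := by omega
  have hb : 1 ≤ δ ^ (r + 1) := Nat.pow_pos hδ
  have hre : r ≤ r * δ ^ (r + 1) := Nat.le_mul_of_pos_right _ hb
  have hbe : 16 * (r * δ ^ (r + 1)) = 2 * r * (8 * δ ^ (r + 1)) := by ring
  rw [numCodes, pMax, paramD]
  have hD1 : δ ^ (r + 1) ≤ B ^ (r + 1) := Nat.pow_le_pow_left (by omega) _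
  have hQ : (n + δ ^ r) ^ (8 * δ ^ (r + 1)) ≤ B ^ (16 * (r * δ ^ (r + 1))) := by
    rw [hbe, pow_mul B (2 * r)]
    refine Nat.pow_le_pow_left ?_ _
    have h1 : δ ^ r ≤ B ^ r := Nat.pow_le_pow_left (by omega) _
    have h2 : n ≤ B ^ r := (by omega : n ≤ B).trans (Nat.le_self_pow (by omega) B)
    calc n + δ ^ r ≤ 2 * B ^ r := by omega
      _ ≤ B ^ r * B ^ r := Nat.mul_le_mul_right _ (hB2.trans (Nat.le_self_pow (by omega) B))
      _ = B ^ (2 * r) := by ring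
  have ha : δ ^ r ≤ B ^ (r * δ ^ (r + 1)) :=
    (Nat.pow_le_pow_left (by omega : δ ≤ B) _).trans (Nat.pow_le_pow_right hB1 hre)
  have hM : (n * (d + 1)) ^ r ≤ (B ^ (r * δ ^ (r + 1))) ^ 2 := by
    calc (n * (d + 1)) ^ r ≤ (B * B) ^ r :=
          Nat.pow_le_pow_left (Nat.mul_le_mul (by omega) (by omega)) _
      _ = (B ^ r) ^ 2 := by ring
      _ ≤ _ := Nat.pow_le_pow_left (Nat.pow_le_pow_right hB1 hre) _
  have hD2 : B ^ (r + 1) ≤ (B ^ (r * δ ^ (r + 1))) ^ 2 := by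
    rw [← pow_mul]; exact Nat.pow_le_pow_right hB1 (by omega)
  rw [mul_comm 16, pow_mul B] at hQ
  rw [mul_comm 171, pow_mul B]
  have hle : B ≤ B ^ (r * δ ^ (r + 1)) := Nat.le_self_pow (by omega) B
  generalize B ^ (r * δ ^ (r + 1)) = Y at *
  have hY : 2 ≤ Y := hB2.trans hle
  have hD : δ ^ (r + 1) + 1 ≤ Y ^ 3 := by
    have h1 : 1 ≤ Y ^ 2 := Nat.pow_pos (by omega)
    calc δ ^ (r + 1) + 1 ≤ Y ^ 2 * 2 := by omega
      _ ≤ Y ^ 2 * Y := Nat.mul_le_mul_left _ hY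
      _ = Y ^ 3 := by ring
  have hl : Nat.clog 2 (δ ^ (r + 1) + 1) ≤ Y ^ 3 :=
    (Nat.clog_le_of_le_pow Nat.lt_two_pow_self.le).trans hD
  have hpm : (n + δ ^ r) ^ (8 * δ ^ (r + 1)) * Nat.clog 2 (δ ^ (r + 1) + 1) ^ 2 + 1 ≤ Y ^ 23 := by
    have h1 : 1 ≤ Y ^ 22 := Nat.pow_pos (by omega)
    have h2 := Nat.mul_le_mul hQ (Nat.pow_le_pow_left hl 2)
    have h3 : Y ^ 16 * (Y ^ 3) ^ 2 = Y ^ 22 := by ring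
    calc _ ≤ Y ^ 22 * 2 := by omega
      _ ≤ Y ^ 22 * Y := Nat.mul_le_mul_left _ hY
      _ = Y ^ 23 := by ring
  calc _ ≤ Y ^ 9 * (Y ^ 2 * Y * (Y * Y * Y ^ 23) * Y ^ 23 * Y ^ 3) ^ 3 := by
        refine Nat.mul_le_mul ?_ (Nat.pow_le_pow_left ?_ 3)
        · exact (by norm_num : 459 ≤ 2 ^ 9).trans (Nat.pow_le_pow_left hY 9)
        · exact Nat.mul_le_mul (Nat.mul_le_mul (Nat.mul_le_mul (Nat.mul_le_mul hM (by omega))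
            (Nat.mul_le_mul (Nat.mul_le_mul ha (by omega)) hpm)) hpm) hD
    _ = Y ^ 171 := by ring

end Construction

theorem mainTheorem6 :
    (∀ (K : Type u) [Field K] (n d r δ : ℕ), 1 ≤ d → 1 ≤ r → r ≤ n → 1 ≤ δ →
      ∀ H₁ H₂ : Finset (AlgebraicClosure K),
        H₁.card = δ ^ r * r * pMax n r δ → H₂.card = d + 1 →
        IsHittingSet (hittingSet n r δ H₁ H₂) (circuitClass K n d r δ)) ∧
    (∃ (P : Prog) (q : Polynomial ℕ),
      ∀ (K : Type u) [Field K] (n d r δ : ℕ), 1 ≤ d → 1 ≤ r → r ≤ n → 1 ≤ δ →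
        ∀ H₁ H₂ : Finset (AlgebraicClosure K),
          H₁.card = δ ^ r * r * pMax n r δ → H₂.card = d + 1 →
          ∀ l₁ l₂ : List (AlgebraicClosure K),
            l₁.Nodup → (∀ c, c ∈ l₁ ↔ c ∈ H₁) → l₂.Nodup → (∀ c, c ∈ l₂ ↔ c ∈ H₂) →
            ∃ t : ℕ, t ≤ (q.eval (d * r * δ * n)) ^ (r * δ ^ (r + 1)) ∧
              Constructs P n d r δ (l₁ ++ l₂) t (hittingSet n r δ H₁ H₂)) := by
  refine ⟨fun K _ n d r δ _ hr hrn hδ H₁ H₂ h₁ h₂ => isHittingSet_hittingSet K hr hrn hδ h₁ h₂,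
    hittingSetProg, (Polynomial.X + 2) ^ 171, fun K _ n d r δ hd hr hrn hδ H₁ H₂ h₁ h₂ l₁ l₂ hl₁ hm₁
      hl₂ hm₂ => constructs_hittingSetProg hr hrn hδ h₁ h₂ hl₁ hm₁ hl₂ hm₂ ?_⟩
  have hq : Polynomial.eval (d * r * δ * n) ((Polynomial.X + 2 : Polynomial ℕ) ^ 171) =
      (d * r * δ * n + 2) ^ 171 := by
    simp
  rw [hq]
  exact time_bound hd hr hrn hδ
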